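/- A \emph{ring expression} is built from variables $x_0,x_1,\dots$ and the constants $0,1$ by $+$ and $\cdot$; its degree is defined by $\deg x_k=1$, $\deg 0=\deg 1=0$, $\deg(a+b)=\max(\deg a,\deg b)$, $\deg(ab)=\deg a+\deg b$. A \emph{ring identity} $L=R$ is a pair of ring expressions that can be transformed into each other by commutativity and associativity of $+$ and $\cdot$, distributivity, and the laws $0+a=a$, $0\cdot a=0$, $1\cdot a=a$, applied to subexpressions. For $n\ge 1$ the CNF $\varphi^{\mathrm{Wall}}_{L=R}(n)$ is defined as follows. Each ring variable is a vector of $n$ input bits, the constants $0,1$ are one-bit vectors. For $L$ and for $R$ there is a circuit that has a separate subcircuit for each occurrence of an operation; bit-vectors are padded with constant bits $0$ to equal width. Every gate constraint $z=f(a_1,\dots,a_r)$ is encoded by all clauses that forbid $a=v$, $z\ne f(v)$, for $v\in\{0,1\}^r$; constant bits are fixed by unit clauses. An adder has inputs $a_0,a_1,a_2$, sum-bit $a_0\oplus a_1\oplus a_2$ and carry-bit $\mathrm{MAJ}(a_0,a_1,a_2)$; missing inputs are $0$. - An addition of two $w$-bit vectors is a ripple-carry adder with $w+1$ output bits. - A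 multiplication of two $N$-bit vectors $\mathbf x,\mathbf y$ is a Wallace tree multiplier with $2N$ output bits. Column $i$ $(0\le i<2N)$ of layer $0$ consists of the partial products $x_{i-j}\wedge y_j$ in order of increasing $j$. Each column of a layer is cut, in order, into consecutive triples (the last one possibly smaller), each of which is input to an adder. For $j=0,1,2,\dots$ in turn, the sum-bit of the $j$-th adder of column $i$ is appended to column $i$ of the next layer and then the carry-bit of the $j$-th adder of column $i-1$ (if that adder has at least two inputs; an adder with one input is a wire). At the first layer all of whose columns have at most two entries, a carry-lookahead adder, a tree of 4-bit lookahead units on $4^m$ digits with the least $m$ such that $4^m\ge 2N$, adds the two rows; its lowest $2N$ output bits are the output of the multiplier. Finally, with $o^L,o^R$ the output bits of the two circuits, padded to a common width $M$, there are the constraints $e_i=o^L_i\oplus o^R_i$ $(0\le i<M)$ and the clause $e_0\vee\dots\vee e_{M-1}$. A resolution refutation is a sequence of clauses, each of them a clause of the formula or the resolvent of two earlier clauses, that ends with the empty clause; its size is the number of clauses. It is \emph{regular} if on every path of its DAG each variable is resolved on at most once. \textbf{Theorem.} For every ring identity $L=R$ with $\deg L\le 2$ and $\deg R\le 2$ there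 is a constant $C$ such that for every $n\ge 1$ the formula $\varphi^{\mathrm{Wall}}_{L=R}(n)$ has a regular resolution refutation of size at most $C\,n^{C\lfloor\log_2 n\rfloor}$, that is, of size $n^{O(\log n)}$. -/

import Mathlib

namespace WallaceCNF

/-! ### Clauses, resolution and regular resolution -/

/-- A clause is a finite set of literals; the literal `(x, b)` is true when `x` has the value `b`,
so `(x, true)` is the positive and `(x, false)` the negated literal on `x`. -/
abbrev Clause (V : Type) : Type := Finset (V × Bool)

/-- A resolution refutation of the set of clauses `φ`: a sequence of `size` clauses that ends with
the empty clause. If `step k = none` then the `k`-th clause is a clause of `φ`; if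
`step k = some (x, i, j)` then it is the resolvent on the variable `x` of the two earlier
clauses with numbers `i` and `j`. -/
structure Refutation {V : Type} [DecidableEq V] (φ : Set (Clause V)) where
  size : ℕ
  clause : Fin size → Clause V
  step : Fin size → Option (V × Fin size × Fin size)
  initial : ∀ k, step k = none → clause k ∈ φ
  resolvent : ∀ k x i j, step k = some (x, i, j) →
    i < k ∧ j < k ∧ (x, true) ∈ clause i ∧ (x, false) ∈ clause j ∧
      clause k = (clause i).erase (x, true) ∪ (clause j).erase (x, false)
  last_empty : ∃ k : Fin size, (k : ℕ) + 1 = size ∧ clause k = ∅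

namespace Refutation

variable {V : Type} [DecidableEq V] {φ : Set (Clause V)}

/-- The edges of the proof DAG: the `i`-th clause is a premise of the inference of the `k`-th. -/
def IsPremise (π : Refutation φ) (i k : Fin π.size) : Prop :=
  ∃ x j, π.step k = some (x, i, j) ∨ π.step k = some (x, j, i)

/-- A refutation is regular if no two inferences on a common path of its DAG resolve on the same
variable. -/
def Regular (π : Refutation φ) : Prop :=
  ∀ i k, Relation.TransGen π.IsPremise i k →
    ∀ x a b a' b', π.step i = some (x, a, b) → π.step k ≠ some (x, a', b')

end Refutation

/-! ### Ring identities -/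

/-- Ring expressions in variables `0, 1, 2, …`. -/
inductive RingExpr : Type
  | var (k : ℕ)
  | zero
  | one
  | add (a b : RingExpr)
  | mul (a b : RingExpr)

namespace RingExpr

/-- The degree of an expression. -/
def degree : RingExpr → ℕ
  | var _ => 1
  | zero => 0
  | one => 0
  | add a b => max a.degree b.degree
  | mul a b => a.degree + b.degree

/-- `L = R` is a ring identity: `L` can be transformed into `R` by commutativity, associativity,
distributivity and the laws of the constants `0` and `1`, applied to subexpressions. -/
inductive Identity : RingExpr → RingExpr → Prop
  | refl (a) : Identity a a
  | symm {a b} : Identity a b → Identity b a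
  | trans {a b c} : Identity a b → Identity b c → Identity a c
  | add_congr {a a' b b'} : Identity a a' → Identity b b' → Identity (add a b) (add a' b')
  | mul_congr {a a' b b'} : Identity a a' → Identity b b' → Identity (mul a b) (mul a' b')
  | add_comm (a b) : Identity (add a b) (add b a)
  | add_assoc (a b c) : Identity (add (add a b) c) (add a (add b c))
  | mul_comm (a b) : Identity (mul a b) (mul b a)
  | mul_assoc (a b c) : Identity (mul (mul a b) c) (mul a (mul b c))
  | mul_add (a b c) : Identity (mul a (add b c)) (add (mul a b) (mul a c))
  | zero_add (a) : Identity (add zero a) a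
  | zero_mul (a) : Identity (mul zero a) zero
  | one_mul (a) : Identity (mul one a) a

end RingExpr

/-! ### Variables and gates -/

/-- The variables that are local to one adder or multiplier. -/
inductive LocalVar : Type
  /-- sum-bit (output bit) `o_i` of a ripple-carry adder -/
  | rcSum (i : ℕ)
  /-- carry-bit `c_i` of a ripple-carry adder -/
  | rcCarry (i : ℕ)
  /-- the partial product `x_{i-j} ∧ y_j` in column `i` and row `j` -/
  | partialProduct (i j : ℕ)
  /-- sum-bit of the `j`-th adder in column `i` of layer `l` of a Wallace tree -/
  | treeSum (l i j : ℕ)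
  /-- carry-bit of the `j`-th adder in column `i` of layer `l` of a Wallace tree -/
  | treeCarry (l i j : ℕ)
  /-- generate bit, at layer `l` of a carry-lookahead adder, of the `q`-th block of `4 ^ l` bits -/
  | claGen (l q : ℕ)
  /-- propagate bit, at layer `l` of a carry-lookahead adder, of the `q`-th block of `4 ^ l` bits -/
  | claProp (l q : ℕ)
  /-- carry into the `i`-th digit of a carry-lookahead adder -/
  | claCarry (i : ℕ)
  /-- output bit `o_i` of a carry-lookahead adder -/
  | claOut (i : ℕ)
  deriving DecidableEq

/-- The variables of an instance: constants, input bits, the variables of the subcircuit at the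
node with address `p` of the pair of expressions, and the comparison bits `e_i`. -/
inductive Var : Type
  | const (b : Bool)
  | input (k i : ℕ)
  | node (p : List Bool) (v : LocalVar)
  | neq (i : ℕ)
  deriving DecidableEq

/-- The constraint `out = fn ins`. -/
structure Gate : Type where
  out : Var
  ins : List Var
  fn : List Bool → Bool

/-- A gate as a set of clauses: for every value `v` of the inputs, the clause that forbids
`ins = v, out ≠ fn v`. -/
def Gate.clauses (g : Gate) : Set (Clause Var) :=
  {C | ∃ v : List Bool, v.length = g.ins.length ∧
    C = insert (g.out, g.fn v) (List.zipWith (fun x b => (x, !b)) g.ins v).toFinset}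

def parity (v : List Bool) : Bool := v.foldl xor false

def conj (v : List Bool) : Bool := v.all id

/-- The majority of three bits. -/
def maj (v : List Bool) : Bool := decide (2 ≤ v.count true)

/-- On `[c, g₀, p₀, g₁, p₁, …]` this is the final carry of the recursion `c ↦ gᵢ ⊕ pᵢ c`, that is,
`c`, `g₀ ⊕ p₀ c`, `g₁ ⊕ g₀ p₁ ⊕ c p₀ p₁`, and so on. -/
def lookahead : List Bool → Bool
  | c :: g :: p :: v => lookahead (xor g (p && c) :: v)
  | c :: _ => c
  | [] => false

/-- An adder: `d = a₀ ⊕ a₁ ⊕ a₂` and `c = MAJ(a₀, a₁, a₂)`. -/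
def adder (d c a₀ a₁ a₂ : Var) : List Gate :=
  [⟨d, [a₀, a₁, a₂], parity⟩, ⟨c, [a₀, a₁, a₂], maj⟩]

/-! ### Ripple-carry adder -/

/-- The ripple-carry adder for two bit-vectors `x`, `y` of width `w`, with `w + 1` output bits. The
last adder, in column `w`, has two constant inputs `0`: it is a wire from the last carry. -/
def rippleCarry (p : List Bool) (w : ℕ) (x y : ℕ → Var) : List Gate :=
  (List.range (w + 1)).flatMap fun i =>
    adder (.node p (.rcSum i)) (.node p (.rcCarry i))
      (if i = 0 then .const false else .node p (.rcCarry (i - 1))) (x i) (y i)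

/-! ### Carry-lookahead adder -/

/-- The carry-lookahead adder with `m` layers, for two bit-vectors `x`, `y` of width `4 ^ m`. Blocks
of four adjacent generate/propagate pairs of layer `l` are combined into one pair of layer
`l + 1`, and a block that gets a carry computes from it the carries between its four parts. -/
def carryLookahead (p : List Bool) (m : ℕ) (x y : ℕ → Var) : List Gate :=
  let g := fun l q => Var.node p (.claGen l q)
  let r := fun l q => Var.node p (.claProp l q)
  let c := fun i => Var.node p (.claCarry i)
  [⟨c 0, [.const false], parity⟩] ++
  ((List.range (4 ^ m)).flatMap fun i =>
    [⟨g 0 i, [x i, y i], conj⟩, ⟨r 0 i, [x i, y i], parity⟩,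
      ⟨.node p (.claOut i), [c i, x i, y i], parity⟩]) ++
  ((List.range m).flatMap fun l => (List.range (4 ^ (m - l - 1))).flatMap fun q =>
    [⟨r (l + 1) q, [r l (4 * q), r l (4 * q + 1), r l (4 * q + 2), r l (4 * q + 3)], conj⟩,
      ⟨g (l + 1) q, [g l (4 * q), g l (4 * q + 1), r l (4 * q + 1),
        g l (4 * q + 2), r l (4 * q + 2), g l (4 * q + 3), r l (4 * q + 3)], lookahead⟩,
      ⟨c ((4 * q + 1) * 4 ^ l),
        [c (4 * q * 4 ^ l), g l (4 * q), r l (4 * q)], lookahead⟩,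
      ⟨c ((4 * q + 2) * 4 ^ l),
        [c (4 * q * 4 ^ l), g l (4 * q), r l (4 * q),
          g l (4 * q + 1), r l (4 * q + 1)], lookahead⟩,
      ⟨c ((4 * q + 3) * 4 ^ l),
        [c (4 * q * 4 ^ l), g l (4 * q), r l (4 * q),
          g l (4 * q + 1), r l (4 * q + 1), g l (4 * q + 2), r l (4 * q + 2)], lookahead⟩])

/-! ### Wallace tree multiplier -/

/-- The part of column `i` that layer `l` hands on to layer `l + 1`, when columns `i` and `i - 1` of
layer `l` have `a` and `b` elements. Both columns are cut into consecutive triples (the last one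
may have one or two elements), the inputs of one adder each. For `j = 0, 1, …`, column `i` of the
next layer receives the sum-bit of the `j`-th adder of column `i`, then the carry-bit of the
`j`-th adder of column `i - 1`; an adder with a single input is a wire, which has no carry. -/
def nextCol (l i a b : ℕ) : List LocalVar :=
  (List.range (max a b)).flatMap fun j =>
    (if 3 * j < a then [.treeSum l i j] else []) ++
    (if 0 < i ∧ 3 * j + 1 < b then [.treeCarry l (i - 1) j] else [])

/-- The subcolumn `Col(l, i)` of the tableau of an `N`-bit Wallace tree multiplier: the variables of
weight `2 ^ i` in layer `l`, from row `0` on. Layer `0` holds the partial products. -/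
def wallaceCol (N : ℕ) : ℕ → ℕ → List LocalVar
  | 0, i => ((List.range N).filter fun j => j ≤ i ∧ i < j + N).map fun j => .partialProduct i j
  | l + 1, i => nextCol l i (wallaceCol N l i).length (wallaceCol N l (i - 1)).length

theorem length_nextCol_le (l i a b : ℕ) : (nextCol l i a b).length ≤ (a + 2) / 3 + (b + 1) / 3 := by
  have key : ∀ M : ℕ, ((List.range M).flatMap fun j =>
        (if 3 * j < a then [LocalVar.treeSum l i j] else []) ++
        (if 0 < i ∧ 3 * j + 1 < b then [LocalVar.treeCarry l (i - 1) j] else [])).length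
        ≤ min M ((a + 2) / 3) + min M ((b + 1) / 3) := by
    intro M
    induction M with
    | zero => simp
    | succ M ih =>
      rw [List.range_succ, List.flatMap_append, List.length_append]
      have h1 : (List.flatMap (fun j => (if 3 * j < a then [LocalVar.treeSum l i j] else []) ++
          (if 0 < i ∧ 3 * j + 1 < b then [LocalVar.treeCarry l (i - 1) j] else [])) [M]).length
          ≤ (if 3 * M < a then 1 else 0) + (if 3 * M + 1 < b then 1 else 0) := by
        by_cases hP : 0 < i <;> by_cases hA : 3 * M < a <;> by_cases hB : 3 * M + 1 < b <;>
          simp [hP, hA, hB]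
      split_ifs at h1 <;> omega
  exact (key _).trans (add_le_add (min_le_right _ _) (min_le_right _ _))

theorem wallaceCol_succ_length_le (N l i H : ℕ) (hH : ∀ i, (wallaceCol N l i).length ≤ H) :
    (wallaceCol N (l + 1) i).length ≤ (2 * H + 2) / 3 := by
  have h1 := hH i
  have h2 := hH (i - 1)
  have h4 : ((wallaceCol N l i).length + 2) / 3 ≤ (H + 2) / 3 := by omega
  have h5 : ((wallaceCol N l (i - 1)).length + 1) / 3 ≤ (H + 1) / 3 := by omega
  have h6 : (H + 2) / 3 + (H + 1) / 3 ≤ (2 * H + 2) / 3 := by omega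
  rw [wallaceCol]
  exact (length_nextCol_le _ _ _ _).trans ((add_le_add h4 h5).trans h6)

theorem exists_wallaceCol_length_le_two (N : ℕ) :
    ∃ l, ∀ i < 2 * N, (wallaceCol N l i).length ≤ 2 := by
  have key : ∀ H l, (∀ i, (wallaceCol N l i).length ≤ H) →
      ∃ l', ∀ i, (wallaceCol N l' i).length ≤ 2 := by
    intro H
    induction H using Nat.strong_induction_on with
    | _ H ih =>
      intro l hl
      by_cases h : H ≤ 2
      · exact ⟨l, fun i => (hl i).trans h⟩
      · exact ih ((2 * H + 2) / 3) (by omega) (l + 1)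
          fun i => wallaceCol_succ_length_le N l i H hl
  obtain ⟨l, hl⟩ := key N 0 fun i => by
    rw [wallaceCol, List.length_map]
    exact (List.length_filter_le _ _).trans (by simp)
  exact ⟨l, fun i _ => hl i⟩

/-- The number of the first layer whose tableau has at most two rows. -/
def wallaceDepth (N : ℕ) : ℕ := Nat.find (exists_wallaceCol_length_le_two N)

/-- The variable in row `j` of the subcolumn `Col(l, i)`, or the constant `0` if there is none. -/
def wallaceBit (p : List Bool) (N l i j : ℕ) : Var :=
  ((wallaceCol N l i)[j]?).elim (.const false) (.node p)

/-- The Wallace tree multiplier for two bit-vectors `x`, `y` of width `N`, with `2 * N` output bits: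
partial products, layers of adders until two rows are left, and a carry-lookahead adder. -/
def wallaceMultiplier (p : List Bool) (N : ℕ) (x y : ℕ → Var) : List Gate :=
  ((List.range (2 * N)).flatMap fun i =>
    ((List.range N).filter fun j => j ≤ i ∧ i < j + N).map fun j =>
      ⟨.node p (.partialProduct i j), [x (i - j), y j], conj⟩) ++
  ((List.range (wallaceDepth N)).flatMap fun l => (List.range (2 * N)).flatMap fun i =>
    (List.range (((wallaceCol N l i).length + 2) / 3)).flatMap fun j =>
      adder (.node p (.treeSum l i j)) (.node p (.treeCarry l i j))
        (wallaceBit p N l i (3 * j)) (wallaceBit p N l i (3 * j + 1))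
        (wallaceBit p N l i (3 * j + 2))) ++
  carryLookahead p (Nat.clog 4 (2 * N))
    (fun i => if i < 2 * N then wallaceBit p N (wallaceDepth N) i 0 else .const false)
    (fun i => if i < 2 * N then wallaceBit p N (wallaceDepth N) i 1 else .const false)

/-! ### Circuits for expressions and the instance -/

namespace RingExpr

/-- The number of output bits of the circuit for an expression in `n`-bit variables. -/
def width (n : ℕ) : RingExpr → ℕ
  | var _ => n
  | zero => 1
  | one => 1
  | add a b => max (a.width n) (b.width n) + 1
  | mul a b => 2 * max (a.width n) (b.width n)

/-- The `i`-th output bit of the circuit for the expression at address `p`; the bit-vector is padded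
with constants `0` to the left. -/
def bit (n : ℕ) (e : RingExpr) (p : List Bool) (i : ℕ) : Var :=
  if i < e.width n then
    match e with
    | var k => .input k i
    | zero => .const false
    | one => .const true
    | add _ _ => .node p (.rcSum i)
    | mul _ _ => .node p (.claOut i)
  else .const false

/-- The circuit for an expression in `n`-bit variables, with one ripple-carry adder for each addition
and one Wallace tree multiplier for each multiplication; the shorter operand is padded. -/
def circuit (n : ℕ) : RingExpr → List Bool → List Gate
  | var _, _ => []
  | zero, _ => []
  | one, _ => []
  | add a b, p =>
    a.circuit n (false :: p) ++ b.circuit n (true :: p) ++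
      rippleCarry p (max (a.width n) (b.width n)) (a.bit n (false :: p)) (b.bit n (true :: p))
  | mul a b, p =>
    a.circuit n (false :: p) ++ b.circuit n (true :: p) ++
      wallaceMultiplier p (max (a.width n) (b.width n)) (a.bit n (false :: p))
        (b.bit n (true :: p))

end RingExpr

/-- The gates of the instance: the circuits for `L` and `R` and the comparison bits `e_i`. -/
def instanceGates (L R : RingExpr) (n : ℕ) : List Gate :=
  L.circuit n [false] ++ R.circuit n [true] ++
    (List.range (max (L.width n) (R.width n))).map fun i =>
      ⟨.neq i, [L.bit n [false] i, R.bit n [true] i], parity⟩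

/-- The CNF which says that the circuits for `L` and `R`, with adders and Wallace tree multipliers,
disagree on some output bit for some `n`-bit inputs. -/
def phiWall (L R : RingExpr) (n : ℕ) : Set (Clause Var) :=
  {C | ∃ g ∈ instanceGates L R n, C ∈ g.clauses} ∪
    {{(.const false, false)}, {(.const true, true)},
      (Finset.range (max (L.width n) (R.width n))).image fun i => (.neq i, true)}

end WallaceCNF

/-! A clause `D` is read as the partial assignment that falsifies it. `Ref φ D s` is closed under
branching on a variable (`Ref.split`), so the refutation is a decision tree whose leaves are local
contradictions, each refuted by one sweep over the bit positions.

Branching on e_0, e_1, … finds the least w with e_w = 1. As the degrees are at most 2, each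
multiplication has a factor of degree 0 or two factors of degree 1. Additions and multiplications by
constants are followed exactly in all columns up to w. Of a product of two linear expressions only a
window of columns from A = w - κ to w is used, with κ constant, together with as many lower columns
as the tree has layers. These extra columns make the last two rows of the tree correct inside the
window (`apply_wallaceBit`), and the complete rows add up to the true product (`layerSum_treeVal`,
`bitsVal_rows`). Only the output bits below A and the carry into A remain unknown, so the output is
the product modulo 2^(w+1) up to an error of 3 * 2^A (`StripRows.approx`). The errors of all
products add up to less than 2^w (for A = 0 there are none). Both sides have the same value as
natural numbers, so their outputs are congruent modulo 2^(w+1) up to less than 2^w. But outputs that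
first differ in column w differ by 2^w modulo 2^(w+1) (`false_of_disagree`).

There is one exception. If a multiplier ends inside the window, a wrong carry into column A can run
through propagate bits that are all 1 and get lost at the top. This pattern is refuted by descent
(`Ref.of_overflow`). It forces the high operand bits to be 1; since the product is then close to
2^(2N), the carry cannot have been generated in the next lower column, so the pattern extends
downwards, until both operands are 2^N - 1 and the product contradicts it. Each step uses a window
of constant width.

The contradictions are cheap because their gates have a path decomposition with bags of size O(log²
n), and eliminating variables along it is regular (`Ref.of_path_decomposition`). Position m is
visited at time min(m, w + 1 - m): a partial product x_{i-j} ∧ y_j with i near w needs the positions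
j and roughly w - j together. A bag contains what lies within distance O(log n) of the two current
positions, the adders of each layer of a tree that are aligned with the current row (in all columns
of the window), and permanently the lookahead bits of the window. In a multiplication by a constant
the variables away from its few nonzero rows are set to 0 beforehand, at polynomial cost
(`Ref.of_forced`). Altogether this gives a polynomial number of sweeps of size n^{O(1)} * 2^{O(log²
n)}. -/

namespace WallaceCNF

/-! ### Derivations with sharing -/

section Resolution

variable {V : Type} [DecidableEq V]

/-- A line of a derivation: a clause and a set of variables that contains all variables resolved on
above it. -/
abbrev Line (V : Type) : Type := Clause V × Finset V

/-- `Deriv φ H Δ`: the list `Δ` is a regular derivation from the clauses of `φ` and the lines in `H`. -/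
inductive Deriv (φ : Set (Clause V)) (H : Set (Line V)) : List (Line V) → Prop
  | nil : Deriv φ H []
  | init {Δ C} : Deriv φ H Δ → C ∈ φ → Deriv φ H (Δ ++ [(C, ∅)])
  | res {Δ C₁ U₁ C₂ U₂ x} : Deriv φ H Δ → ((C₁, U₁) ∈ H ∨ (C₁, U₁) ∈ Δ) →
      ((C₂, U₂) ∈ H ∨ (C₂, U₂) ∈ Δ) → (x, true) ∈ C₁ → (x, false) ∈ C₂ → x ∉ U₁ → x ∉ U₂ →
      Deriv φ H (Δ ++ [(C₁.erase (x, true) ∪ C₂.erase (x, false), insert x (U₁ ∪ U₂))])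

theorem Deriv.append {φ : Set (Clause V)} {H : Set (Line V)} {Δ₁ Δ₂ : List (Line V)}
    (h₁ : Deriv φ H Δ₁) (h₂ : Deriv φ H Δ₂) : Deriv φ H (Δ₁ ++ Δ₂) := by
  induction h₂ with
  | nil => simpa using h₁
  | init _ hC ih => rw [← List.append_assoc]; exact ih.init hC
  | res _ a b c d e f ih =>
    rw [← List.append_assoc]
    refine ih.res ?_ ?_ c d e f
    · exact a.imp_right fun h => List.mem_append_right _ h
    · exact b.imp_right fun h => List.mem_append_right _ h

/-- Sharing: the second list uses the lines of the first as hypotheses without copying their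
derivations. -/
theorem Deriv.append_of_hyps {φ : Set (Clause V)} {H : Set (Line V)} {Γ Δ : List (Line V)}
    (h₁ : Deriv φ H Γ) (h₂ : Deriv φ {l | l ∈ Γ} Δ) : Deriv φ H (Γ ++ Δ) := by
  induction h₂ with
  | nil => simpa using h₁
  | init _ hC ih => rw [← List.append_assoc]; exact ih.init hC
  | res _ a b c d e f ih =>
    rw [← List.append_assoc]
    refine ih.res ?_ ?_ c d e f
    · exact Or.inr (List.mem_append.2 a)
    · exact Or.inr (List.mem_append.2 b)

theorem Deriv.prefix {φ : Set (Clause V)} {H : Set (Line V)} {Γ : List (Line V)}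
    (h : Deriv φ H Γ) : ∀ {Δ Δ' : List (Line V)}, Γ = Δ ++ Δ' → Deriv φ H Δ := by
  induction h with
  | nil => intro Δ Δ' h; obtain ⟨rfl, -⟩ := List.append_eq_nil_iff.1 h.symm; exact .nil
  | @init Γ C h hC ih =>
    intro Δ Δ' he
    rcases List.eq_nil_or_concat Δ' with rfl | ⟨L, b, rfl⟩
    · rw [List.append_nil] at he; exact he ▸ h.init hC
    · rw [List.concat_eq_append, ← List.append_assoc] at he
      exact ih (List.append_inj_left' he rfl)
  | @res Γ C₁ U₁ C₂ U₂ x h a b c d e f ih =>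
    intro Δ Δ' he
    rcases List.eq_nil_or_concat Δ' with rfl | ⟨L, b', rfl⟩
    · rw [List.append_nil] at he; exact he ▸ h.res a b c d e f
    · rw [List.concat_eq_append, ← List.append_assoc] at he
      exact ih (List.append_inj_left' he rfl)

theorem Deriv.justified {φ : Set (Clause V)} {Γ : List (Line V)} (h : Deriv φ ∅ Γ) :
    ∀ k (hk : k < Γ.length), (Γ[k]).1 ∈ φ ∨
      ∃ x i j, ∃ (hi : i < k) (hj : j < k), (x, true) ∈ (Γ[i]).1 ∧ (x, false) ∈ (Γ[j]).1 ∧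
        (Γ[k]).1 = (Γ[i]).1.erase (x, true) ∪ (Γ[j]).1.erase (x, false) ∧
        x ∉ (Γ[i]).2 ∧ x ∉ (Γ[j]).2 ∧ (Γ[k]).2 = insert x ((Γ[i]).2 ∪ (Γ[j]).2) := by
  induction h with
  | nil => intro k hk; simp at hk
  | @init Γ C h hC ih =>
    intro k hk
    rcases Nat.lt_or_ge k Γ.length with hk' | hk'
    · rcases ih k hk' with h | ⟨x, i, j, hi, hj, h⟩
      · left; rwa [List.getElem_append_left hk']
      · right
        refine ⟨x, i, j, hi, hj, ?_⟩
        rw [List.getElem_append_left hk', List.getElem_append_left (hi.trans hk'),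
          List.getElem_append_left (hj.trans hk')]
        exact h
    · left
      rw [List.getElem_append_right hk']
      simpa using hC
  | @res Γ C₁ U₁ C₂ U₂ x h a b c d e f ih =>
    intro k hk
    rcases Nat.lt_or_ge k Γ.length with hk' | hk'
    · rcases ih k hk' with h | ⟨x, i, j, hi, hj, h⟩
      · left; rwa [List.getElem_append_left hk']
      · right
        refine ⟨x, i, j, hi, hj, ?_⟩
        rw [List.getElem_append_left hk', List.getElem_append_left (hi.trans hk'),
          List.getElem_append_left (hj.trans hk')]
        exact h
    · right
      obtain ⟨i, hi, hi'⟩ := List.mem_iff_getElem.1 (a.resolve_left (Set.notMem_empty _))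
      obtain ⟨j, hj, hj'⟩ := List.mem_iff_getElem.1 (b.resolve_left (Set.notMem_empty _))
      refine ⟨x, i, j, hi.trans_le hk', hj.trans_le hk', ?_⟩
      rw [List.getElem_append_right hk', List.getElem_append_left hi, List.getElem_append_left hj,
        hi', hj']
      simp [c, d, e, f]

/-- Along the edges of the DAG the second components only grow, and a premise never contains the
variable on which it is resolved. So no variable is resolved on twice along a path. -/
theorem exists_regular_refutation {φ : Set (Clause V)} {Γ : List (Line V)} (hd : Deriv φ ∅ Γ)
    (hlast : ∃ k : Fin Γ.length, (k : ℕ) + 1 = Γ.length ∧ (Γ[k]).1 = ∅) :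
    ∃ π : Refutation φ, π.Regular ∧ π.size = Γ.length := by
  classical
  have key : ∀ k : Fin Γ.length, ∃ o : Option (V × Fin Γ.length × Fin Γ.length),
      (o = none → (Γ[k]).1 ∈ φ) ∧ ∀ x i j, o = some (x, i, j) →
        i < k ∧ j < k ∧ (x, true) ∈ (Γ[i]).1 ∧ (x, false) ∈ (Γ[j]).1 ∧
        (Γ[k]).1 = (Γ[i]).1.erase (x, true) ∪ (Γ[j]).1.erase (x, false) ∧
        x ∉ (Γ[i]).2 ∧ x ∉ (Γ[j]).2 ∧ (Γ[k]).2 = insert x ((Γ[i]).2 ∪ (Γ[j]).2) := by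
    intro k
    rcases hd.justified k k.2 with h | ⟨x, i, j, hi, hj, h⟩
    · exact ⟨none, fun _ => h, fun _ _ _ h => nomatch h⟩
    · refine ⟨some (x, ⟨i, hi.trans k.2⟩, ⟨j, hj.trans k.2⟩), nofun, ?_⟩
      rintro x' i' j' he
      obtain ⟨rfl, rfl, rfl⟩ : x = x' ∧ _ = i' ∧ _ = j' := by simpa using he
      exact ⟨hi, hj, h⟩
  choose step hnone hsome using key
  let π : Refutation φ :=
    { size := Γ.length
      clause := fun k => (Γ[k]).1
      step := step
      initial := hnone
      resolvent := fun k x i j h =>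
        let ⟨a, b, c, d, e, _⟩ := hsome k x i j h
        ⟨a, b, c, d, e⟩
      last_empty := hlast }
  refine ⟨π, ?_, rfl⟩
  have hprem : ∀ i k : Fin Γ.length, π.IsPremise i k → (Γ[i]).2 ⊆ (Γ[k]).2 ∧
      ∀ x a b, step k = some (x, a, b) → x ∉ (Γ[i]).2 := by
    rintro i k ⟨x, j, h | h⟩
    all_goals
      obtain ⟨-, -, -, -, -, h1, h2, h3⟩ := hsome k _ _ _ h
      refine ⟨fun y hy => ?_, fun x' a b h' => ?_⟩
      · have h3' : (Γ[k]).2 = insert x (_ ∪ _) := h3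
        rw [h3']; simp only [Finset.mem_insert, Finset.mem_union]; tauto
      · replace h' := h.symm.trans h'
        simp only [Option.some.injEq, Prod.mk.injEq] at h'
        rw [← h'.1]; assumption
  intro i k hik x a b a' b' hi hk
  have hx : x ∈ (Γ[i]).2 := by
    obtain ⟨-, -, -, -, -, -, -, h3⟩ := hsome i _ _ _ hi
    rw [h3]; simp
  obtain ⟨j, hij, hjk⟩ := Relation.TransGen.tail'_iff.1 hik
  have hsub : (Γ[i]).2 ⊆ (Γ[j]).2 := by
    clear hjk hk hik
    induction hij with
    | refl => exact subset_rfl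
    | tail _ h ih => exact ih.trans (hprem _ _ h).1
  exact (hprem _ _ hjk).2 x _ _ hk (hsub hx)

/-! ### Refutations under a partial assignment -/

/-- The assignment `α` falsifies all literals in `D`. -/
def Falsifies (α : V → Bool) (D : Clause V) : Prop := ∀ l ∈ D, α l.1 ≠ l.2

/-- If `D` is not a tautology then a subclause of `D` has a regular derivation of size at most `s`
that does not resolve on variables of `D`. -/
def Ref (φ : Set (Clause V)) (D : Clause V) (s : ℕ) : Prop :=
  (∃ α, Falsifies α D) → ∃ Γ, Deriv φ ∅ Γ ∧ Γ.length ≤ s ∧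
    ∃ C U, (C, U) ∈ Γ ∧ C ⊆ D ∧ ∀ l ∈ D, l.1 ∉ U

theorem Ref.mono {φ : Set (Clause V)} {D : Clause V} {s t : ℕ} (h : Ref φ D s) (hst : s ≤ t) :
    Ref φ D t := fun hα =>
  let ⟨Γ, h1, h2, h3⟩ := h hα
  ⟨Γ, h1, h2.trans hst, h3⟩

theorem Ref.exists_refutation {φ : Set (Clause V)} {s : ℕ} (h : Ref φ ∅ s) :
    ∃ π : Refutation φ, π.Regular ∧ π.size ≤ s := by
  obtain ⟨Γ, h1, h2, C, U, h3, h4, -⟩ := h ⟨fun _ => true, by simp [Falsifies]⟩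
  obtain rfl := Finset.subset_empty.1 h4
  obtain ⟨Δ, Δ', rfl⟩ := List.append_of_mem h3
  obtain ⟨π, hπ, hs⟩ := exists_regular_refutation (h1.prefix (Δ := Δ ++ [(∅, U)]) (Δ' := Δ') (by simp))
    ⟨⟨Δ.length, by simp⟩, by simp, by simp⟩
  refine ⟨π, hπ, ?_⟩
  simp only [List.length_append, List.length_cons, List.length_nil] at hs h2
  omega

theorem Ref.of_mem {φ : Set (Clause V)} {C D : Clause V} (hC : C ∈ φ) (hD : C ⊆ D) : Ref φ D 1 :=
  fun _ => ⟨[(C, ∅)], by simpa using Deriv.nil.init hC, by simp, C, ∅, by simp, hD, by simp⟩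

/-- If `z` occurs in `D`, one branch is `D` itself (the other one is a tautology). Otherwise `z`
occurs in both extended clauses, so neither derivation has resolved on it and the final resolution
is regular. It is not needed if one of the derived clauses lacks its literal on `z`. -/
theorem Ref.split {φ : Set (Clause V)} {D : Clause V} {s₁ s₂ : ℕ} (z : V)
    (h₁ : Ref φ (insert (z, true) D) s₁) (h₂ : Ref φ (insert (z, false) D) s₂) :
    Ref φ D (s₁ + s₂ + 1) := by
  rintro ⟨α, hα⟩
  by_cases hz : ∃ b, (z, b) ∈ D
  · obtain ⟨b, hb⟩ := hz
    have hD : insert (z, b) D = D := Finset.insert_eq_of_mem hb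
    cases b
    · rw [hD] at h₂; exact h₂.mono (by omega) ⟨α, hα⟩
    · rw [hD] at h₁; exact h₁.mono (by omega) ⟨α, hα⟩
  have hcons : ∀ b, ∃ β, Falsifies β (insert (z, b) D) := by
    intro b
    refine ⟨Function.update α z (!b), fun l hl => ?_⟩
    rcases Finset.mem_insert.1 hl with rfl | hl
    · simp
    · have : l.1 ≠ z := fun h => hz ⟨l.2, h ▸ hl⟩
      rw [Function.update_of_ne this]; exact hα l hl
  obtain ⟨Γ₁, d₁, l₁, C₁, U₁, m₁, c₁, u₁⟩ := h₁ (hcons true)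
  obtain ⟨Γ₂, d₂, l₂, C₂, U₂, m₂, c₂, u₂⟩ := h₂ (hcons false)
  by_cases hz₁ : (z, true) ∈ C₁
  swap
  · refine ⟨Γ₁, d₁, by omega, C₁, U₁, m₁, ?_, fun l hl => u₁ l (Finset.mem_insert_of_mem hl)⟩
    exact (Finset.subset_insert_iff_of_notMem hz₁).1 c₁
  by_cases hz₂ : (z, false) ∈ C₂
  swap
  · refine ⟨Γ₂, d₂, by omega, C₂, U₂, m₂, ?_, fun l hl => u₂ l (Finset.mem_insert_of_mem hl)⟩
    exact (Finset.subset_insert_iff_of_notMem hz₂).1 c₂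
  refine ⟨_, (d₁.append d₂).res (Or.inr (List.mem_append_left _ m₁))
    (Or.inr (List.mem_append_right _ m₂)) hz₁ hz₂ (u₁ (z, true) (by simp)) (u₂ (z, false) (by simp)),
    by simp; omega, _, _, List.mem_append_right _ (List.mem_singleton_self _), ?_, ?_⟩
  · refine Finset.union_subset ?_ ?_
    · exact Finset.subset_insert_iff.1 c₁
    · exact Finset.subset_insert_iff.1 c₂
  · intro l hl
    have hlz : l.1 ≠ z := fun h => hz ⟨l.2, h ▸ hl⟩
    simp only [Finset.mem_insert, Finset.mem_union, not_or]
    exact ⟨hlz, u₁ l (Finset.mem_insert_of_mem hl), u₂ l (Finset.mem_insert_of_mem hl)⟩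

/-- A complete decision tree on `Z`, with `2 ^ Z.card` leaves of cost `s` and `2 ^ Z.card - 1` inner
nodes. -/
theorem Ref.of_forall_values {φ : Set (Clause V)} {s : ℕ} (Z : Finset V) :
    ∀ D : Clause V, (∀ D', D ⊆ D' → (∀ z ∈ Z, ∃ b, (z, b) ∈ D') → Ref φ D' s) →
      Ref φ D (2 ^ Z.card * (s + 1) - 1) := by
  induction Z using Finset.induction_on with
  | empty => intro D h; exact (h D subset_rfl (by simp)).mono (by simp)
  | insert z Z hz ih =>
    intro D h
    have hb : ∀ b, Ref φ (insert (z, b) D) (2 ^ Z.card * (s + 1) - 1) := by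
      intro b
      refine ih _ fun D' hD' hZ => h D' ((Finset.subset_insert _ _).trans hD') ?_
      intro y hy
      rcases Finset.mem_insert.1 hy with rfl | hy
      · exact ⟨b, hD' (Finset.mem_insert_self _ _)⟩
      · exact hZ y hy
    refine (Ref.split z (hb true) (hb false)).mono ?_
    rw [Finset.card_insert_of_notMem hz, pow_succ]
    have : 0 < 2 ^ Z.card * (s + 1) := by positivity
    generalize 2 ^ Z.card = a at *
    have : a * 2 * (s + 1) = 2 * (a * (s + 1)) := by ring
    omega

/-! ### Elimination of variables along a path decomposition -/

/-- The literals on variables of `xs` that are falsified by `β`. -/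
def falsifiedLits (xs : Finset V) (β : V → Bool) : Clause V := xs.image fun x => (x, !β x)

theorem mem_falsifiedLits {xs : Finset V} {β : V → Bool} {l : V × Bool} :
    l ∈ falsifiedLits xs β ↔ l.1 ∈ xs ∧ β l.1 ≠ l.2 := by
  rcases l with ⟨x, b⟩
  simp only [falsifiedLits, Finset.mem_image, Prod.mk.injEq]
  constructor
  · rintro ⟨y, hy, rfl, rfl⟩; exact ⟨hy, by simp⟩
  · rintro ⟨h, hb⟩; exact ⟨x, h, rfl, by cases b <;> simp_all⟩

/-- Resolving away the variables of `xs` by a complete binary tree. -/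
theorem exists_deriv_of_tree {φ : Set (Clause V)} {H : Set (Line V)} (xs : Finset V) :
    ∀ (W : Finset V) (E : Clause V),
    (∀ β : V → Bool, (∃ C ∈ φ, C ⊆ E ∪ falsifiedLits xs β) ∨
      ∃ C U, (C, U) ∈ H ∧ C ⊆ E ∪ falsifiedLits xs β ∧ Disjoint U xs ∧ U ⊆ W) →
    ∃ Δ, Deriv φ H Δ ∧ Δ.length + 1 ≤ 2 ^ (xs.card + 1) ∧
      ∃ C U, ((C, U) ∈ H ∨ (C, U) ∈ Δ) ∧ C ⊆ E ∧ U ⊆ W ∪ xs := by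
  induction xs using Finset.induction_on with
  | empty =>
    intro W E h
    rcases h fun _ => true with ⟨C, hC, hs⟩ | ⟨C, U, hC, hs, -, hW⟩
    · exact ⟨[(C, ∅)], by simpa using Deriv.nil.init hC, by simp, C, ∅, by simp,
        by simpa [falsifiedLits] using hs, by simp⟩
    · exact ⟨[], .nil, by simp, C, U, Or.inl hC, by simpa [falsifiedLits] using hs, by simpa using hW⟩
  | insert x xs hx ih =>
    intro W E h
    have hb : ∀ b, ∃ Δ, Deriv φ H Δ ∧ Δ.length + 1 ≤ 2 ^ (xs.card + 1) ∧
        ∃ C U, ((C, U) ∈ H ∨ (C, U) ∈ Δ) ∧ C ⊆ insert (x, b) E ∧ U ⊆ W ∪ xs ∧ x ∉ U := by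
      intro b
      -- With `x` erased from `W`, nothing in this subtree has resolved on `x`, so the resolution at
      -- the root is regular.
      obtain ⟨Δ, h1, h2, C, U, h3, h4, h5⟩ := ih (W.erase x) (insert (x, b) E) (by
        intro β
        have hl : E ∪ falsifiedLits (insert x xs) (Function.update β x !b) ⊆
            insert (x, b) E ∪ falsifiedLits xs β := by
          intro l hl
          simp only [Finset.mem_union, mem_falsifiedLits, Finset.mem_insert] at hl ⊢
          rcases hl with hl | ⟨hl | hl, hne⟩
          · exact Or.inl (Or.inr hl)
          · left; left
            rcases l with ⟨y, c⟩
            obtain rfl : y = x := hl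
            simp only [Function.update_self] at hne
            cases b <;> cases c <;> simp_all
          · right
            have : l.1 ≠ x := fun h => hx (h ▸ hl)
            rw [Function.update_of_ne this] at hne
            exact ⟨hl, hne⟩
        rcases h (Function.update β x !b) with ⟨C, hC, hs⟩ | ⟨C, U, hC, hs, hd, hW⟩
        · exact Or.inl ⟨C, hC, hs.trans hl⟩
        · rw [Finset.disjoint_insert_right] at hd
          exact Or.inr ⟨C, U, hC, hs.trans hl, hd.2, fun y hy =>
            Finset.mem_erase.2 ⟨fun h => hd.1 (h ▸ hy), hW hy⟩⟩)
      refine ⟨Δ, h1, h2, C, U, h3, h4,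
        h5.trans (Finset.union_subset_union (Finset.erase_subset _ _) subset_rfl), fun hU => ?_⟩
      have := h5 hU
      simp [hx] at this
    obtain ⟨Δ₁, d₁, l₁, C₁, U₁, m₁, c₁, u₁, x₁⟩ := hb true
    obtain ⟨Δ₂, d₂, l₂, C₂, U₂, m₂, c₂, u₂, x₂⟩ := hb false
    have hlen : 2 ^ ((insert x xs).card + 1) = 2 ^ (xs.card + 1) + 2 ^ (xs.card + 1) := by
      rw [Finset.card_insert_of_notMem hx, pow_succ]; ring
    have hWs : W ∪ xs ⊆ W ∪ insert x xs :=
      Finset.union_subset_union subset_rfl (Finset.subset_insert _ _)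
    by_cases hz₁ : (x, true) ∈ C₁
    swap
    · exact ⟨Δ₁, d₁, by omega, C₁, U₁, m₁, (Finset.subset_insert_iff_of_notMem hz₁).1 c₁,
        u₁.trans hWs⟩
    by_cases hz₂ : (x, false) ∈ C₂
    swap
    · exact ⟨Δ₂, d₂, by omega, C₂, U₂, m₂, (Finset.subset_insert_iff_of_notMem hz₂).1 c₂,
        u₂.trans hWs⟩
    refine ⟨_, (d₁.append d₂).res (m₁.imp_right (List.mem_append_left _))
      (m₂.imp_right (List.mem_append_right _)) hz₁ hz₂ x₁ x₂, by simp; omega, _, _,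
      Or.inr (List.mem_append_right _ (List.mem_singleton_self _)), ?_, ?_⟩
    · exact Finset.union_subset (Finset.subset_insert_iff.1 c₁) (Finset.subset_insert_iff.1 c₂)
    · refine Finset.insert_subset (by simp) (Finset.union_subset (u₁.trans hWs) (u₂.trans hWs))

theorem exists_deriv_forall {ι : Type} {φ : Set (Clause V)} {H : Set (Line V)} {c : ℕ}
    {P : ι → Line V → Prop} (F : Finset ι)
    (h : ∀ i ∈ F, ∃ Δ, Deriv φ H Δ ∧ Δ.length ≤ c ∧ ∃ l, (l ∈ H ∨ l ∈ Δ) ∧ P i l) :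
    ∃ Δ, Deriv φ H Δ ∧ Δ.length ≤ F.card * c ∧ ∀ i ∈ F, ∃ l, (l ∈ H ∨ l ∈ Δ) ∧ P i l := by
  classical
  induction F using Finset.induction_on with
  | empty => exact ⟨[], .nil, by simp, by simp⟩
  | insert i F hi ih =>
    obtain ⟨Δ, h1, h2, h3⟩ := ih fun j hj => h j (Finset.mem_insert_of_mem hj)
    obtain ⟨Δ', h1', h2', l, hl, hP⟩ := h i (Finset.mem_insert_self _ _)
    refine ⟨Δ ++ Δ', h1.append h1', ?_, ?_⟩
    · rw [Finset.card_insert_of_notMem hi, List.length_append, add_mul]; omega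
    · intro j hj
      rcases Finset.mem_insert.1 hj with rfl | hj
      · exact ⟨l, hl.imp_right (List.mem_append_right _), hP⟩
      · obtain ⟨l, hl, hP⟩ := h3 j hj
        exact ⟨l, hl.imp_right (List.mem_append_left _), hP⟩

set_option maxHeartbeats 1000000 in
/-- Eliminating variables along a path decomposition: the bags are `bag t` for `t < T`, and the
clauses whose variables occur in a common bag or in `D` are not satisfied by any assignment that
falsifies `D`. -/
theorem Ref.of_path_decomposition {φ : Set (Clause V)} {D : Clause V} {T s : ℕ}
    (bag : ℕ → Finset V)
    (hconv : ∀ v i j k, i ≤ j → j ≤ k → k < T → v ∈ bag i → v ∈ bag k → v ∈ bag j)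
    (hcard : ∀ t < T, (bag t).card ≤ s)
    (h : ∀ α, Falsifies α D → ∃ t < T, ∃ C ∈ φ, Falsifies α C ∧
      ∀ l ∈ C, l.1 ∈ bag t ∨ ∃ b, (l.1, b) ∈ D) :
    Ref φ D (T * 2 ^ (s + 1)) := by
  classical
  rintro ⟨α₀, hα₀⟩
  let Dv := D.image Prod.fst
  have hDv : ∀ v, v ∈ Dv ↔ ∃ b, (v, b) ∈ D := by simp [Dv]
  -- Variables of `D` are already assigned and leave the bags. The empty bags from `T` on make the
  -- last separator empty.
  let b : ℕ → Finset V := fun t => if t < T then bag t \ Dv else ∅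
  have hb : ∀ v t, v ∈ b t ↔ t < T ∧ v ∈ bag t ∧ v ∉ Dv := by
    intro v t
    by_cases ht : t < T <;> simp [b, ht]
  have hbconv : ∀ v i j k, i ≤ j → j ≤ k → v ∈ b i → v ∈ b k → v ∈ b j := by
    intro v i j k hij hjk hi hk
    rw [hb] at hi hk ⊢
    exact ⟨by omega, hconv v i j k hij hjk hk.1 hi.2.1 hk.2.1, hk.2.2⟩
  let S : ℕ → Finset V := fun t => b t ∩ b (t + 1)
  -- An assignment of the separator is good if it extends to one that falsifies `D` and satisfies
  -- all clauses that fit into the bags up to `t`. For every other `β` the clause that excludes it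
  -- is derived.
  let Good : ℕ → (V → Bool) → Prop := fun t β => ∃ α, Falsifies α D ∧ (∀ v ∈ S t, α v = β v) ∧
    ∀ i ≤ t, ∀ C ∈ φ, (∀ l ∈ C, l.1 ∈ b i ∨ l.1 ∈ Dv) → ¬ Falsifies α C
  -- The variables resolved on so far have left the bags, and by convexity they never come back;
  -- this is what gives regularity.
  let Der : ℕ → (V → Bool) → Line V → Prop := fun t β l => l.1 ⊆ D ∪ falsifiedLits (S t) β ∧
    ∀ v ∈ l.2, (∃ i ≤ t, v ∈ b i) ∧ v ∉ b (t + 1)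
  have hext : ∀ t β β', (∀ v ∈ S t, β v = β' v) →
      falsifiedLits (S t) β = falsifiedLits (S t) β' ∧ (Good t β ↔ Good t β') := by
    intro t β β' he
    refine ⟨?_, ?_⟩
    · exact Finset.image_congr fun v hv => by simp [he v hv]
    · refine exists_congr fun α => and_congr_right fun _ => and_congr_left fun _ =>
        forall_congr' fun v => forall_congr' fun hv => by rw [he v hv]
  have step : ∀ (H : Set (Line V)) t, t < T →
      (∀ i < t, i + 1 = t → ∀ β, ¬ Good i β → ∃ l ∈ H, Der i β l) →
      ∃ Δ, Deriv φ H Δ ∧ Δ.length ≤ 2 ^ (s + 1) ∧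
        ∀ β, ¬ Good t β → ∃ l, (l ∈ H ∨ l ∈ Δ) ∧ Der t β l := by
    intro H t ht hH
    have tree : ∀ β, ¬ Good t β → ∃ Δ, Deriv φ H Δ ∧
        Δ.length ≤ 2 ^ ((b t \ b (t + 1)).card + 1) ∧ ∃ l, (l ∈ H ∨ l ∈ Δ) ∧ Der t β l := by
      intro β hβ
      obtain ⟨Δ, h1, h2, C, U, h3, h4, h5⟩ := exists_deriv_of_tree (φ := φ) (H := H)
        (b t \ b (t + 1)) ((Finset.range (t + 1)).biUnion b \ b (t + 1))
        (D ∪ falsifiedLits (S t) β) (by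
          intro γ
          -- At the leaf `γ` of the tree, the current bag has the values of `β` on the separator and
          -- of `γ` elsewhere, and `D` is falsified as by `α₀`.
          let δ : V → Bool := fun v => if v ∈ Dv then α₀ v else if v ∈ S t then β v else γ v
          have hδD : ∀ v ∈ Dv, δ v = α₀ v := fun v hv => by simp [δ, hv]
          have hδS : ∀ v ∈ S t, δ v = β v := fun v hv => by
            have : v ∉ Dv := ((hb v t).1 (Finset.mem_inter.1 hv).1).2.2
            simp [δ, hv, this]
          have hlit : ∀ l : V × Bool, l.1 ∈ b t ∨ l.1 ∈ Dv → δ l.1 ≠ l.2 →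
              l ∈ D ∪ falsifiedLits (S t) β ∪ falsifiedLits (b t \ b (t + 1)) γ := by
            intro l hl hne
            by_cases hD : l.1 ∈ Dv
            · obtain ⟨c, hc⟩ := (hDv _).1 hD
              have h1 := hα₀ _ hc
              rw [hδD _ hD] at hne
              have : c = l.2 := by
                revert h1 hne; dsimp only
                cases α₀ l.1 <;> cases c <;> cases l.2 <;> simp
              rw [this] at hc
              exact Finset.mem_union_left _ (Finset.mem_union_left _ hc)
            · have hl := hl.resolve_right hD
              by_cases hn : l.1 ∈ b (t + 1)
              · have hS : l.1 ∈ S t := Finset.mem_inter.2 ⟨hl, hn⟩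
                rw [hδS _ hS] at hne
                exact Finset.mem_union_left _ (Finset.mem_union_right _
                  (mem_falsifiedLits.2 ⟨hS, hne⟩))
              · refine Finset.mem_union_right _ (mem_falsifiedLits.2
                  ⟨Finset.mem_sdiff.2 ⟨hl, hn⟩, ?_⟩)
                simpa [δ, hD, S, hn] using hne
          by_cases hC : ∃ C ∈ φ, (∀ l ∈ C, l.1 ∈ b t ∨ l.1 ∈ Dv) ∧ Falsifies δ C
          · obtain ⟨C, hC, hf, hδ⟩ := hC
            exact Or.inl ⟨C, hC, fun l hl => hlit l (hf l hl) (hδ l hl)⟩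
          right
          -- No clause of the current bag fails at this leaf. If the values on the previous
          -- separator were good, the witness could be overwritten by `δ` on the current bag and
          -- would show that `β` is good. So the previous separator supplies a derived clause.
          have glue : ∀ α, Falsifies α D → (∀ i < t, ∀ v ∈ b i, v ∈ b t → α v = δ v) →
              (∀ i < t, ∀ C ∈ φ, (∀ l ∈ C, l.1 ∈ b i ∨ l.1 ∈ Dv) → ¬ Falsifies α C) → False := by
            intro α hα hag hsat
            have hαDv : ∀ v ∈ Dv, α v = α₀ v := by
              intro v hv
              obtain ⟨c, hc⟩ := (hDv _).1 hv
              have h1 := hα₀ _ hc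
              have h2 := hα _ hc
              revert h1 h2; dsimp only
              cases α v <;> cases α₀ v <;> cases c <;> simp
            refine hβ ⟨fun v => if v ∈ b t then δ v else α v, ?_, ?_, ?_⟩
            · intro l hl
              have : l.1 ∉ b t := fun h => ((hb _ _).1 h).2.2 ((hDv _).2 ⟨l.2, hl⟩)
              simpa [this] using hα l hl
            · intro v hv
              simpa [(Finset.mem_inter.1 hv).1] using hδS v hv
            · intro i hi C hCφ hfit hfal
              rcases Nat.lt_or_eq_of_le hi with hi | rfl
              · refine hsat i hi C hCφ hfit fun l hl => ?_
                have h1 := hfal l hl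
                by_cases hbt : l.1 ∈ b t
                · rcases hfit l hl with h | h
                  · rw [hag i hi _ h hbt]; simpa [hbt] using h1
                  · exact absurd h ((hb _ _).1 hbt).2.2
                · simpa [hbt] using h1
              · refine hC ⟨C, hCφ, hfit, fun l hl => ?_⟩
                have h1 := hfal l hl
                by_cases hbt : l.1 ∈ b i
                · simpa [hbt] using h1
                · have hD := (hfit l hl).resolve_left hbt
                  rw [hδD _ hD, ← hαDv _ hD]; simpa [hbt] using h1
          rcases Nat.eq_zero_or_pos t with rfl | hpos
          · exact (glue α₀ hα₀ (by simp) (by simp)).elim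
          obtain ⟨i, rfl⟩ : ∃ i, t = i + 1 := ⟨t - 1, by omega⟩
          by_cases hG : Good i δ
          · obtain ⟨α, hα, hag, hsat⟩ := hG
            refine (glue α hα ?_ fun j hj => hsat j (by omega)).elim
            intro j hj v hv hv'
            exact hag v (Finset.mem_inter.2 ⟨hbconv v j i (i + 1) (by omega) (by omega) hv hv', hv'⟩)
          · obtain ⟨⟨C, U⟩, hl, hC', hU⟩ := hH i (by omega) rfl δ hG
            refine ⟨C, U, hl, fun l hl => ?_, ?_, ?_⟩
            · rcases Finset.mem_union.1 (hC' hl) with h | h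
              · exact Finset.mem_union_left _ (Finset.mem_union_left _ h)
              · rw [mem_falsifiedLits] at h
                exact hlit l (Or.inl (Finset.mem_inter.1 h.1).2) h.2
            · rw [Finset.disjoint_left]
              exact fun v hv hv' => (hU v hv).2 (Finset.mem_sdiff.1 hv').1
            · intro v hv
              obtain ⟨⟨j, hj, hjv⟩, hn⟩ := hU v hv
              refine Finset.mem_sdiff.2 ⟨Finset.mem_biUnion.2 ⟨j, by simp; omega, hjv⟩, fun h => ?_⟩
              exact hn (hbconv v j (i + 1) (i + 1 + 1) (by omega) (by omega) hjv h))
      refine ⟨Δ, h1, by omega, (C, U), h3, h4, fun v hv => ?_⟩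
      have := h5 hv
      simp only [Finset.mem_union, Finset.mem_sdiff, Finset.mem_biUnion, Finset.mem_range] at this
      rcases this with ⟨⟨i, hi, hv⟩, hn⟩ | ⟨hv, hn⟩
      · exact ⟨⟨i, by omega, hv⟩, hn⟩
      · exact ⟨⟨t, le_rfl, hv⟩, hn⟩
    -- Only the values on `S t` matter, so one tree for each subset of `S t` suffices. The number of
    -- trees times the size of a tree is `2 ^ ((b t).card + 1)`.
    obtain ⟨Δ, h1, h2, h3⟩ := exists_deriv_forall (φ := φ) (H := H)
      (P := fun P l => Der t (fun v => decide (v ∈ P)) l)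
      ((S t).powerset.filter fun P => ¬ Good t fun v => decide (v ∈ P))
      fun P hP => tree _ (Finset.mem_filter.1 hP).2
    refine ⟨Δ, h1, h2.trans ?_, fun β hβ => ?_⟩
    · calc _ ≤ 2 ^ (S t).card * 2 ^ ((b t \ b (t + 1)).card + 1) := by
            gcongr
            exact (Finset.card_filter_le _ _).trans (Finset.card_powerset _).le
        _ = 2 ^ ((b t).card + 1) := by
            rw [← pow_add, ← add_assoc, Finset.card_inter_add_card_sdiff]
        _ ≤ 2 ^ (s + 1) := by
            have : b t ⊆ bag t := fun v hv => ((hb v t).1 hv).2.1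
            have := (Finset.card_le_card this).trans (hcard t ht)
            gcongr; norm_num
    · have he : ∀ v ∈ S t, β v = decide (v ∈ (S t).filter fun v => β v = true) := by
        intro v hv
        cases hβ : β v <;> simp [hv, hβ]
      obtain ⟨h4, h5⟩ := hext t _ _ he
      obtain ⟨l, hl, hD⟩ := h3 ((S t).filter fun v => β v = true)
        (Finset.mem_filter.2 ⟨by simp, fun h => hβ (h5.2 h)⟩)
      refine ⟨l, hl, ?_⟩
      simp only [Der] at hD ⊢
      rwa [h4]
  have all : ∀ t < T, ∃ Γ, Deriv φ ∅ Γ ∧ Γ.length ≤ (t + 1) * 2 ^ (s + 1) ∧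
      ∀ β, ¬ Good t β → ∃ l ∈ Γ, Der t β l := by
    intro t
    induction t with
    | zero =>
      intro ht
      obtain ⟨Δ, h1, h2, h3⟩ := step ∅ 0 ht (by simp)
      exact ⟨Δ, h1, by omega, fun β hβ => by simpa using h3 β hβ⟩
    | succ t ih =>
      intro ht
      obtain ⟨Γ, h1, h2, h3⟩ := ih (by omega)
      obtain ⟨Δ, h1', h2', h3'⟩ := step {l | l ∈ Γ} (t + 1) ht fun i hi he β hβ => by
        obtain rfl : i = t := by omega
        exact h3 β hβ
      refine ⟨Γ ++ Δ, h1.append_of_hyps h1', ?_, fun β hβ => ?_⟩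
      · rw [List.length_append, add_mul _ 1]; omega
      · obtain ⟨l, hl, hD⟩ := h3' β hβ
        exact ⟨l, List.mem_append.2 hl, hD⟩
  obtain ⟨t, ht, -⟩ := h α₀ hα₀
  obtain ⟨Γ, h1, h2, h3⟩ := all (T - 1) (by omega)
  rw [Nat.sub_add_cancel (by omega : 1 ≤ T)] at h2
  have hbT : b T = ∅ := by simp [b]
  obtain ⟨⟨C, U⟩, hl, hC, hU⟩ := h3 α₀ (by
    rintro ⟨α, hα, -, hs⟩
    obtain ⟨t, ht, C, hC, hf, hfit⟩ := h α hα
    refine hs t (by omega) C hC (fun l hl => ?_) hf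
    rw [hDv, hb]
    rcases hfit l hl with h | h
    · by_cases hD : l.1 ∈ Dv
      · exact Or.inr ((hDv _).1 hD)
      · exact Or.inl ⟨ht, h, hD⟩
    · exact Or.inr h)
  refine ⟨Γ, h1, h2, C, U, hl, ?_, ?_⟩
  · have : S (T - 1) = ∅ := by simp [S, Nat.sub_add_cancel (by omega : 1 ≤ T), hbT]
    simpa [this, falsifiedLits] using hC
  · intro l hl hlU
    obtain ⟨⟨i, -, hi⟩, -⟩ := hU _ hlU
    exact ((hb _ _).1 hi).2.2 ((hDv _).2 ⟨l.2, hl⟩)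

/-- Variables `K` that are forced to be false, in the order of `rank`, may be assumed to be false. -/
theorem Ref.of_forced {φ : Set (Clause V)} {c s : ℕ} {D₀ : Clause V} (K : Finset V) (rank : V → ℕ)
    (h : ∀ z ∈ K, ∀ D, D₀ ⊆ D → (∀ y ∈ K, rank y < rank z → (y, true) ∈ D) → (z, false) ∈ D →
      Ref φ D c)
    (hs : ∀ D, D₀ ⊆ D → (∀ z ∈ K, (z, true) ∈ D) → Ref φ D s) :
    Ref φ D₀ (s + K.card * (c + 1)) := by
  suffices ∀ n D, D₀ ⊆ D → (K.filter fun z => (z, true) ∉ D).card = n →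
      Ref φ D (s + n * (c + 1)) from
    (this _ D₀ subset_rfl rfl).mono (by gcongr; exact Finset.filter_subset _ _)
  intro n
  induction n with
  | zero =>
    intro D hD hn
    rw [Finset.card_eq_zero, Finset.filter_eq_empty_iff] at hn
    simpa using hs D hD fun z hz => not_not.1 (hn hz)
  | succ n ih =>
    intro D hD hn
    -- By the choice of the least rank, all variables of smaller rank are already set to false.
    obtain ⟨z, hz, hmin⟩ := Finset.exists_min_image (K.filter fun z => (z, true) ∉ D) rank
      (Finset.card_pos.1 (by omega))
    rw [Finset.mem_filter] at hz
    refine (Ref.split z (ih (insert (z, true) D) (hD.trans (Finset.subset_insert _ _)) ?_)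
      (h z hz.1 (insert (z, false) D) (hD.trans (Finset.subset_insert _ _)) ?_
        (Finset.mem_insert_self _ _))).mono (by ring_nf; omega)
    · have : (K.filter fun y => (y, true) ∉ insert (z, true) D) =
          (K.filter fun y => (y, true) ∉ D).erase z := by
        ext y
        simp only [Finset.mem_filter, Finset.mem_insert, Prod.mk.injEq, and_true, Finset.mem_erase,
          not_or]
        tauto
      rw [this, Finset.card_erase_of_mem (Finset.mem_filter.2 hz), hn, Nat.add_sub_cancel]
    · intro y hy hlt
      by_contra hn
      have := hmin y (Finset.mem_filter.2 ⟨hy, fun h => hn (Finset.mem_insert_of_mem h)⟩)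
      omega

end Resolution

/-! ### Clauses of violated gates -/

theorem Gate.exists_clause (g : Gate) (α : Var → Bool) (h : α g.out ≠ g.fn (g.ins.map α)) :
    ∃ C ∈ g.clauses, Falsifies α C ∧ ∀ l ∈ C, l.1 = g.out ∨ l.1 ∈ g.ins := by
  have hz : ∀ xs : List Var, List.zipWith (fun x b => (x, !b)) xs (xs.map α) =
      xs.map fun x => (x, !α x) := by
    intro xs
    induction xs <;> simp_all
  refine ⟨_, ⟨g.ins.map α, by simp, rfl⟩, ?_, ?_⟩
  · intro l hl
    rw [hz] at hl
    rcases Finset.mem_insert.1 hl with rfl | hl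
    · exact h
    · obtain ⟨x, -, rfl⟩ := List.mem_map.1 (List.mem_toFinset.1 hl)
      simp
  · intro l hl
    rw [hz] at hl
    rcases Finset.mem_insert.1 hl with rfl | hl
    · exact Or.inl rfl
    · obtain ⟨x, hx, rfl⟩ := List.mem_map.1 (List.mem_toFinset.1 hl)
      exact Or.inr hx

/-- The assignment `α` satisfies the constraint `g`. -/
def Gate.Holds (g : Gate) (α : Var → Bool) : Prop := α g.out = g.fn (g.ins.map α)

/-- The semantic interface of the elimination: in search of a contradiction, an assignment may be
assumed to satisfy each gate whose variables all lie in one bag or in `D`, since a violated gate has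
a falsified clause. -/
theorem Ref.of_gates {φ : Set (Clause Var)} {D : Clause Var} {T s : ℕ} {G : Set Gate}
    (hG : ∀ g ∈ G, g.clauses ⊆ φ) (bag : ℕ → Finset Var)
    (hconv : ∀ v i j k, i ≤ j → j ≤ k → k < T → v ∈ bag i → v ∈ bag k → v ∈ bag j)
    (hcard : ∀ t < T, (bag t).card ≤ s)
    (h : ∀ α, Falsifies α D → (∀ g ∈ G, (∃ t < T, ∀ v, v = g.out ∨ v ∈ g.ins →
      v ∈ bag t ∨ ∃ b, (v, b) ∈ D) → g.Holds α) → False) :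
    Ref φ D (T * 2 ^ (s + 1)) := by
  refine Ref.of_path_decomposition bag hconv hcard fun α hα => ?_
  by_contra hn
  refine h α hα fun g hg ⟨t, ht, hfit⟩ => by_contra fun hne => hn ?_
  obtain ⟨C, hC, hf, hl⟩ := g.exists_clause α hne
  exact ⟨t, ht, C, hG g hg hC, hf, fun l hlC => hfit _ (hl l hlC)⟩

/-! ### The columns of a Wallace tree -/

theorem filter_range_eq_range' (n lo hi : ℕ) :
    ((List.range n).filter fun j => decide (lo ≤ j ∧ j < hi)) =
      List.range' lo (min n hi - lo) := by
  induction n with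
  | zero => simp
  | succ n ih =>
    rw [List.range_succ, List.filter_append, ih]
    by_cases h : lo ≤ n ∧ n < hi
    · rw [List.filter_singleton, decide_eq_true h, cond_true,
        show min (n + 1) hi - lo = min n hi - lo + 1 by omega, List.range'_1_concat,
        show lo + (min n hi - lo) = n by omega]
    · rw [List.filter_singleton, decide_eq_false h, cond_false, List.append_nil]
      congr 1
      omega

theorem wallaceCol_zero (N i : ℕ) : wallaceCol N 0 i =
    (List.range' (i + 1 - N) (min N (i + 1) - (i + 1 - N))).map fun j => .partialProduct i j := by
  rw [wallaceCol, ← filter_range_eq_range']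
  congr 1
  refine List.filter_congr fun j _ => ?_
  rw [decide_eq_decide]
  omega

theorem getElem?_wallaceCol_zero {N i p : ℕ} {v : LocalVar} (h : (wallaceCol N 0 i)[p]? = some v) :
    v = .partialProduct i (p + (i + 1 - N)) ∧ p + (i + 1 - N) < N ∧ p + (i + 1 - N) ≤ i := by
  rw [wallaceCol_zero, List.getElem?_map, Option.map_eq_some_iff] at h
  obtain ⟨j, hj, rfl⟩ := h
  obtain ⟨hp, hj⟩ := List.getElem?_eq_some_iff.1 hj
  rw [List.length_range'] at hp
  rw [List.getElem_range'] at hj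
  exact ⟨by congr 1; omega, by omega, by omega⟩

/-- The part of `nextCol` that the first `M` adders of both columns contribute. -/
def nextColPrefix (l i a b M : ℕ) : List LocalVar :=
  (List.range M).flatMap fun j =>
    (if 3 * j < a then [.treeSum l i j] else []) ++
    (if 0 < i ∧ 3 * j + 1 < b then [.treeCarry l (i - 1) j] else [])

theorem nextColPrefix_succ (l i a b M : ℕ) : nextColPrefix l i a b (M + 1) =
    nextColPrefix l i a b M ++ ((if 3 * M < a then [.treeSum l i M] else []) ++
      (if 0 < i ∧ 3 * M + 1 < b then [.treeCarry l (i - 1) M] else [])) := by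
  simp [nextColPrefix, List.range_succ, List.flatMap_append]

theorem length_nextColPrefix (l i a b M : ℕ) : (nextColPrefix l i a b M).length =
    min M ((a + 2) / 3) + min M (if 0 < i then (b + 1) / 3 else 0) := by
  induction M with
  | zero => simp [nextColPrefix]
  | succ M ih =>
    rw [nextColPrefix_succ, List.length_append, ih, List.length_append]
    by_cases hi : 0 < i <;> by_cases h1 : 3 * M < a <;> by_cases h2 : 3 * M + 1 < b <;>
      simp only [hi, h1, h2, if_true, if_false, and_self, and_true, and_false, List.length_cons,
        List.length_nil] <;> omega

theorem length_nextCol (l i a b : ℕ) : (nextCol l i a b).length =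
    (a + 2) / 3 + if 0 < i then (b + 1) / 3 else 0 := by
  refine (length_nextColPrefix l i a b (max a b)).trans ?_
  split_ifs <;> omega

/-- Since the two columns differ in height by at most 2, sums and carries alternate until only one
more entry can follow. So the outputs of the `j`-th adders land in rows `2 * j` and `2 * j + 1`,
which aligns the rows of different layers. -/
theorem getElem?_nextColPrefix {l i a b M p : ℕ} {v : LocalVar} (hab : 0 < i → a ≤ b + 2 ∧ b ≤ a + 2)
    (h0 : i = 0 → a ≤ 1) (h : (nextColPrefix l i a b M)[p]? = some v) :
    (∃ j, v = .treeSum l i j ∧ p = 2 * j ∧ 3 * j < a) ∨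
      ∃ j, v = .treeCarry l (i - 1) j ∧ 0 < i ∧ (p = 2 * j ∨ p = 2 * j + 1) ∧ 3 * j + 1 < b := by
  induction M with
  | zero => simp [nextColPrefix] at h
  | succ M ih =>
    have hl := length_nextColPrefix l i a b M
    rw [nextColPrefix_succ, List.getElem?_append] at h
    split_ifs at h hl with h1 h2 h3 h4
    all_goals first | exact ih h | skip
    all_goals simp only [List.append_nil, List.nil_append, List.cons_append] at h
    all_goals
      obtain ⟨q, hq⟩ : ∃ q, p = (nextColPrefix l i a b M).length + q := ⟨_, (Nat.add_sub_of_le (not_lt.1 h1)).symm⟩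
      rw [hq, Nat.add_sub_cancel_left] at h
      rcases q with _ | _ | q <;> simp at h
    all_goals subst h
    all_goals first
      | exact Or.inl ⟨M, rfl, by omega, by omega⟩
      | exact Or.inr ⟨M, rfl, by omega, by omega, by omega⟩

/-- A new height is a sum of two rounded thirds of adjacent heights. If the heights differ by at
most 2, each rounded third changes by at most 1 from one column to the next, so the new heights
differ by at most 2 again. -/
theorem length_wallaceCol_adjacent (N l : ℕ) :
    (wallaceCol N l 0).length ≤ 1 ∧ ∀ i,
      (wallaceCol N l (i + 1)).length ≤ (wallaceCol N l i).length + 2 ∧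
      (wallaceCol N l i).length ≤ (wallaceCol N l (i + 1)).length + 2 := by
  induction l with
  | zero =>
    simp only [wallaceCol_zero, List.length_map, List.length_range']
    exact ⟨by omega, fun i => by omega⟩
  | succ l ih =>
    simp only [wallaceCol, length_nextCol]
    obtain ⟨h0, h⟩ := ih
    refine ⟨by simp; omega, fun i => ?_⟩
    rcases i with _ | i
    · have := h 0
      simp only [Nat.zero_add, Nat.sub_self, lt_irrefl, if_false, Nat.zero_lt_one, if_true] at *
      omega
    · have h1 := h i
      have h2 := h (i + 1)
      simp only [Nat.add_sub_cancel, Nat.zero_lt_succ, if_true]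
      omega

theorem getElem?_wallaceCol_succ {N l i p : ℕ} {v : LocalVar}
    (h : (wallaceCol N (l + 1) i)[p]? = some v) :
    (∃ j, v = .treeSum l i j ∧ p = 2 * j ∧ 3 * j < (wallaceCol N l i).length) ∨
      ∃ j, v = .treeCarry l (i - 1) j ∧ 0 < i ∧ (p = 2 * j ∨ p = 2 * j + 1) ∧
        3 * j + 1 < (wallaceCol N l (i - 1)).length := by
  obtain ⟨h0, hl⟩ := length_wallaceCol_adjacent N l
  refine getElem?_nextColPrefix (M := max _ _) (fun hi => ?_) (fun hi => ?_) h
  · obtain ⟨i, rfl⟩ : ∃ k, i = k + 1 := ⟨i - 1, by omega⟩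
    exact hl i
  · subst hi; exact h0

theorem length_wallaceCol_le (N l i : ℕ) : (wallaceCol N l i).length ≤ N := by
  induction l generalizing i with
  | zero => rw [wallaceCol_zero, List.length_map, List.length_range']; omega
  | succ l ih =>
    rw [wallaceCol, length_nextCol]
    have h1 := ih i
    have h2 := ih (i - 1)
    obtain ⟨h0, hl⟩ := length_wallaceCol_adjacent N l
    rcases i with _ | i
    · simp; omega
    have := hl i
    simp only [Nat.add_sub_cancel, Nat.zero_lt_succ, if_true] at *
    omega

theorem length_wallaceCol_wallaceDepth (N i : ℕ) (hi : i < 2 * N) :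
    (wallaceCol N (wallaceDepth N) i).length ≤ 2 :=
  Nat.find_spec (exists_wallaceCol_length_le_two N) i hi

/-- Two layers shrink the height by about 4/9, and rounding still leaves `H + 2` at most `H / 2 +
2`. -/
theorem wallaceDepth_le (N : ℕ) : wallaceDepth N ≤ 2 * (Nat.log 2 N + 1) := by
  have key : ∀ q i, (wallaceCol N (2 * q) i).length ≤ N / 2 ^ q + 2 := by
    intro q
    induction q with
    | zero => intro i; simpa using (length_wallaceCol_le N 0 i).trans (by omega)
    | succ q ih =>
      intro i
      have h1 := fun i => wallaceCol_succ_length_le N (2 * q) i _ ih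
      have h2 := wallaceCol_succ_length_le N (2 * q + 1) i _ h1
      refine h2.trans ?_
      rw [pow_succ, ← Nat.div_div_eq_div_mul]
      omega
  refine Nat.find_min' _ fun i _ => (key _ i).trans ?_
  rw [Nat.div_eq_of_lt (Nat.lt_pow_succ_log_self (by norm_num) N)]

/-! ### The true values of the tree -/

/-- The bit in row `p` of column `i` of layer `l` under the valuation `f`, or `false`. -/
def rowBit (f : LocalVar → Bool) (N l i p : ℕ) : Bool := ((wallaceCol N l i)[p]?).elim false f

/-- The values of the variables in layer `l` of the tableau for bit-vectors `x` and `y`. -/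
def treeVal (N : ℕ) (x y : ℕ → Bool) : ℕ → LocalVar → Bool
  | 0, .partialProduct i j => x (i - j) && y j
  | l + 1, .treeSum _ i j => parity [rowBit (treeVal N x y l) N l i (3 * j),
      rowBit (treeVal N x y l) N l i (3 * j + 1), rowBit (treeVal N x y l) N l i (3 * j + 2)]
  | l + 1, .treeCarry _ i j => maj [rowBit (treeVal N x y l) N l i (3 * j),
      rowBit (treeVal N x y l) N l i (3 * j + 1), rowBit (treeVal N x y l) N l i (3 * j + 2)]
  | _, _ => false

theorem adder_sum (a b c : Bool) : (parity [a, b, c]).toNat + 2 * (maj [a, b, c]).toNat =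
    a.toNat + b.toNat + c.toNat := by
  revert a b c; decide

/-- The number of true bits in a column. -/
def colSum (f : LocalVar → Bool) (N l i : ℕ) : ℕ :=
  ((wallaceCol N l i).map fun v => (f v).toNat).sum

theorem sum_map_eq_sum_range {A : Type} (f : A → Bool) (L : List A) :
    ∀ P, L.length ≤ P →
    (L.map fun v => (f v).toNat).sum = ∑ p ∈ Finset.range P, ((L[p]?).elim false f).toNat := by
  induction L with
  | nil => simp
  | cons a L ih =>
    intro P hP
    obtain ⟨P, rfl⟩ : ∃ Q, P = Q + 1 := ⟨P - 1, by simp at hP; omega⟩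
    rw [Finset.sum_range_succ']
    simp only [List.map_cons, List.sum_cons, List.getElem?_cons_succ, List.getElem?_cons_zero,
      Option.elim_some]
    rw [← ih P (by simpa using hP), add_comm]

theorem colSum_eq (f : LocalVar → Bool) {N l i P : ℕ} (hP : (wallaceCol N l i).length ≤ P) :
    colSum f N l i = ∑ p ∈ Finset.range P, (rowBit f N l i p).toNat :=
  sum_map_eq_sum_range _ _ _ hP

theorem rowBit_eq_false (f : LocalVar → Bool) {N l i p : ℕ} (hp : (wallaceCol N l i).length ≤ p) :
    rowBit f N l i p = false := by
  simp [rowBit, List.getElem?_eq_none hp]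

theorem sum_range_three_mul (f : ℕ → ℕ) (J : ℕ) : ∑ p ∈ Finset.range (3 * J), f p =
    ∑ j ∈ Finset.range J, (f (3 * j) + f (3 * j + 1) + f (3 * j + 2)) := by
  induction J with
  | zero => simp
  | succ J ih =>
    rw [Finset.sum_range_succ, ← ih, show 3 * (J + 1) = 3 * J + 1 + 1 + 1 by ring,
      Finset.sum_range_succ, Finset.sum_range_succ, Finset.sum_range_succ]
    ring

theorem colSum_treeVal (N : ℕ) (x y : ℕ → Bool) (l i : ℕ) :
    colSum (treeVal N x y l) N l i = ∑ j ∈ Finset.range N,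
      ((treeVal N x y (l + 1) (.treeSum l i j)).toNat +
        2 * (treeVal N x y (l + 1) (.treeCarry l i j)).toNat) := by
  rw [colSum_eq _ (P := 3 * N) ((length_wallaceCol_le N l i).trans (by omega)), sum_range_three_mul]
  refine Finset.sum_congr rfl fun j _ => ?_
  simp only [treeVal]
  rw [adder_sum]

/-- Adders without inputs have output 0 and adders with one input have carry 0. So the outputs
absent from the next layer do not count, and the sum may run over all `j < N`. -/
theorem colSum_treeVal_succ (N : ℕ) (x y : ℕ → Bool) (l i : ℕ) :
    colSum (treeVal N x y (l + 1)) N (l + 1) i = ∑ j ∈ Finset.range N,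
      ((treeVal N x y (l + 1) (.treeSum l i j)).toNat +
        if 0 < i then (treeVal N x y (l + 1) (.treeCarry l (i - 1) j)).toNat else 0) := by
  have key : ∀ M, ((nextColPrefix l i (wallaceCol N l i).length (wallaceCol N l (i - 1)).length M).map
      fun v => (treeVal N x y (l + 1) v).toNat).sum = ∑ j ∈ Finset.range M,
      ((treeVal N x y (l + 1) (.treeSum l i j)).toNat +
        if 0 < i then (treeVal N x y (l + 1) (.treeCarry l (i - 1) j)).toNat else 0) := by
    intro M
    induction M with
    | zero => simp [nextColPrefix]
    | succ M ih =>
      rw [nextColPrefix_succ, List.map_append, List.sum_append, ih, Finset.sum_range_succ]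
      congr 1
      have hs : ¬ 3 * M < (wallaceCol N l i).length →
          treeVal N x y (l + 1) (.treeSum l i M) = false := fun h => by
        simp only [treeVal]
        rw [rowBit_eq_false, rowBit_eq_false, rowBit_eq_false] <;> first | rfl | omega
      have hc : ¬ 3 * M + 1 < (wallaceCol N l (i - 1)).length →
          treeVal N x y (l + 1) (.treeCarry l (i - 1) M) = false := fun h => by
        simp only [treeVal]
        rw [rowBit_eq_false _ (p := 3 * M + 1), rowBit_eq_false _ (p := 3 * M + 2)]
        · cases rowBit (treeVal N x y l) N l (i - 1) (3 * M) <;> rfl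
        all_goals omega
      by_cases hi : 0 < i <;> by_cases h1 : 3 * M < (wallaceCol N l i).length <;>
        by_cases h2 : 3 * M + 1 < (wallaceCol N l (i - 1)).length <;>
        simp [hi, h1, h2, hs, hc]
  have h1 := length_wallaceCol_le N l i
  have h2 := length_wallaceCol_le N l (i - 1)
  have e : colSum (treeVal N x y (l + 1)) N (l + 1) i = _ := key (max _ _)
  rw [e]
  have hsub : Finset.range (max (wallaceCol N l i).length (wallaceCol N l (i - 1)).length) ⊆
      Finset.range N := Finset.range_subset_range.2 (by omega)
  refine Finset.sum_subset hsub fun j _ hj => ?_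
  have hj : max (wallaceCol N l i).length (wallaceCol N l (i - 1)).length ≤ j := by simpa using hj
  have e1 : treeVal N x y (l + 1) (.treeSum l i j) = false := by
    simp only [treeVal]
    rw [rowBit_eq_false, rowBit_eq_false, rowBit_eq_false] <;> first | rfl | omega
  have e2 : treeVal N x y (l + 1) (.treeCarry l (i - 1) j) = false := by
    simp only [treeVal]
    rw [rowBit_eq_false, rowBit_eq_false, rowBit_eq_false] <;> first | rfl | omega
  simp [e1, e2]

/-- The number with binary digits `x i`, for `i < n`. -/
def bitsVal (x : ℕ → Bool) (n : ℕ) : ℕ := ∑ i ∈ Finset.range n, 2 ^ i * (x i).toNat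

/-- The weighted number of true bits in the columns below `2 * N` of a layer. -/
def layerSum (f : LocalVar → Bool) (N l : ℕ) : ℕ :=
  ∑ i ∈ Finset.range (2 * N), 2 ^ i * colSum f N l i

theorem bitsVal_lt (x : ℕ → Bool) (n : ℕ) : bitsVal x n < 2 ^ n := by
  induction n with
  | zero => simp [bitsVal]
  | succ n ih =>
    rw [bitsVal, Finset.sum_range_succ, ← bitsVal, pow_succ]
    have : (x n).toNat ≤ 1 := Bool.toNat_le _
    nlinarith

theorem sum_map_filter_range (p : ℕ → Prop) [DecidablePred p] (g : ℕ → ℕ) (n : ℕ) :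
    (((List.range n).filter fun j => decide (p j)).map g).sum =
      ∑ j ∈ Finset.range n, if p j then g j else 0 := by
  induction n with
  | zero => simp
  | succ n ih =>
    rw [List.range_succ, List.filter_append, List.map_append, List.sum_append, ih,
      Finset.sum_range_succ, List.filter_singleton]
    by_cases h : p n <;> simp [h]

theorem layerSum_zero (N : ℕ) (x y : ℕ → Bool) :
    layerSum (treeVal N x y 0) N 0 = bitsVal x N * bitsVal y N := by
  have h : ∀ i, colSum (treeVal N x y 0) N 0 i = ∑ j ∈ Finset.range N,
      if j ≤ i ∧ i < j + N then (x (i - j)).toNat * (y j).toNat else 0 := by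
    intro i
    rw [colSum, wallaceCol, List.map_map, sum_map_filter_range]
    refine Finset.sum_congr rfl fun j _ => if_congr Iff.rfl ?_ rfl
    simp only [Function.comp, treeVal]
    cases x (i - j) <;> cases y j <;> rfl
  simp only [layerSum, h, Finset.mul_sum]
  rw [Finset.sum_comm, bitsVal, bitsVal, Finset.mul_sum]
  refine Finset.sum_congr rfl fun j hj => ?_
  rw [Finset.mem_range] at hj
  have hs : Finset.Ico j (j + N) ⊆ Finset.range (2 * N) := fun i hi => by
    simp only [Finset.mem_Ico, Finset.mem_range] at hi ⊢
    omega
  rw [← Finset.sum_subset hs fun i _ hi => by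
    rw [Finset.mem_Ico] at hi
    rw [if_neg hi, mul_zero], Finset.sum_Ico_eq_sum_range, Finset.sum_mul]
  rw [Nat.add_sub_cancel_left]
  refine Finset.sum_congr rfl fun m hm => ?_
  rw [Finset.mem_range] at hm
  rw [if_pos ⟨by omega, by omega⟩, Nat.add_sub_cancel_left, pow_add]
  ring

/-- An adder preserves weight, and each carry reappears one column higher. Only the carries out of
column `2 * N - 1` have no column to go to. -/
theorem layerSum_succ (N : ℕ) (x y : ℕ → Bool) (l : ℕ) :
    layerSum (treeVal N x y l) N l = layerSum (treeVal N x y (l + 1)) N (l + 1) +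
      2 ^ (2 * N) * (if 0 < N then ∑ j ∈ Finset.range N,
        (treeVal N x y (l + 1) (.treeCarry l (2 * N - 1) j)).toNat else 0) := by
  let S : ℕ → ℕ := fun i => ∑ j ∈ Finset.range N,
    (treeVal N x y (l + 1) (.treeSum l i j)).toNat
  let C : ℕ → ℕ := fun i => ∑ j ∈ Finset.range N,
    (treeVal N x y (l + 1) (.treeCarry l i j)).toNat
  have key : ∀ n, ∑ i ∈ Finset.range n, 2 ^ i * (S i + 2 * C i) =
      ∑ i ∈ Finset.range n, 2 ^ i * (S i + if 0 < i then C (i - 1) else 0) +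
        2 ^ n * (if 0 < n then C (n - 1) else 0) := by
    intro n
    induction n with
    | zero => simp
    | succ n ih =>
      rw [Finset.sum_range_succ, Finset.sum_range_succ, ih, if_pos (Nat.succ_pos n),
        Nat.add_sub_cancel]
      rw [pow_succ]
      ring
  have e1 : ∀ i, colSum (treeVal N x y l) N l i = S i + 2 * C i := fun i => by
    rw [colSum_treeVal, Finset.sum_add_distrib, ← Finset.mul_sum]
  have e2 : ∀ i, colSum (treeVal N x y (l + 1)) N (l + 1) i =
      S i + if 0 < i then C (i - 1) else 0 := fun i => by
    rw [colSum_treeVal_succ, Finset.sum_add_distrib]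
    split_ifs <;> simp [S, C]
  have := key (2 * N)
  have hN : (0 < 2 * N) = (0 < N) := by rw [eq_iff_iff]; omega
  simp only [hN] at this
  simpa only [layerSum, e1, e2] using this

/-- The tree adds up to the product without overflow. -/
theorem layerSum_treeVal (N : ℕ) (x y : ℕ → Bool) (l : ℕ) :
    layerSum (treeVal N x y l) N l = bitsVal x N * bitsVal y N := by
  induction l with
  | zero => exact layerSum_zero N x y
  | succ l ih =>
    have h := layerSum_succ N x y l
    have hlt : bitsVal x N * bitsVal y N < 2 ^ (2 * N) := by
      rw [two_mul, pow_add]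
      exact Nat.mul_lt_mul'' (bitsVal_lt _ _) (bitsVal_lt _ _)
    rw [ih] at h
    -- A single lost carry would weigh `2 ^ (2 * N)`, more than the product.
    generalize (if 0 < N then ∑ j ∈ Finset.range N,
      (treeVal N x y (l + 1) (.treeCarry l (2 * N - 1) j)).toNat else 0) = c at h
    rcases Nat.eq_zero_or_pos c with rfl | hc
    · simpa using h.symm
    · nlinarith [Nat.mul_le_mul_left (2 ^ (2 * N)) hc]

theorem bitsVal_rows (N : ℕ) (x y : ℕ → Bool) :
    bitsVal (fun i => rowBit (treeVal N x y (wallaceDepth N)) N (wallaceDepth N) i 0) (2 * N) +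
      bitsVal (fun i => rowBit (treeVal N x y (wallaceDepth N)) N (wallaceDepth N) i 1) (2 * N) =
      bitsVal x N * bitsVal y N := by
  rw [← layerSum_treeVal N x y (wallaceDepth N), layerSum, bitsVal, bitsVal,
    ← Finset.sum_add_distrib]
  refine Finset.sum_congr rfl fun i hi => ?_
  rw [colSum_eq _ (length_wallaceCol_wallaceDepth N i (Finset.mem_range.1 hi)),
    Finset.sum_range_succ, Finset.sum_range_one, mul_add]

/-! ### The window of a multiplier -/

/-- The gates of layer `l + 1` of a carry-lookahead adder that belong to its `q`-th block. -/
def blockGates (p : List Bool) (l q : ℕ) : List Gate :=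
  let g := fun l q => Var.node p (.claGen l q)
  let r := fun l q => Var.node p (.claProp l q)
  let c := fun i => Var.node p (.claCarry i)
  [⟨r (l + 1) q, [r l (4 * q), r l (4 * q + 1), r l (4 * q + 2), r l (4 * q + 3)], conj⟩,
    ⟨g (l + 1) q, [g l (4 * q), g l (4 * q + 1), r l (4 * q + 1),
      g l (4 * q + 2), r l (4 * q + 2), g l (4 * q + 3), r l (4 * q + 3)], lookahead⟩,
    ⟨c ((4 * q + 1) * 4 ^ l),
      [c (4 * q * 4 ^ l), g l (4 * q), r l (4 * q)], lookahead⟩,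
    ⟨c ((4 * q + 2) * 4 ^ l),
      [c (4 * q * 4 ^ l), g l (4 * q), r l (4 * q),
        g l (4 * q + 1), r l (4 * q + 1)], lookahead⟩,
    ⟨c ((4 * q + 3) * 4 ^ l),
      [c (4 * q * 4 ^ l), g l (4 * q), r l (4 * q),
        g l (4 * q + 1), r l (4 * q + 1), g l (4 * q + 2), r l (4 * q + 2)], lookahead⟩]

/-- The gates of a multiplier that determine its output bits in the columns `A ≤ i ≤ w` up to the
carry into column `A`. -/
inductive StripGate (p : List Bool) (N : ℕ) (x y : ℕ → Var) (A w : ℕ) : Gate → Prop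
  | pp (i j : ℕ) : A ≤ i + wallaceDepth N → i ≤ w → i < 2 * N → j < N → j ≤ i → i < j + N →
      StripGate p N x y A w ⟨.node p (.partialProduct i j), [x (i - j), y j], conj⟩
  -- A layer takes carries from one column lower in the layer before it. So layer `l` has to be
  -- included from `wallaceDepth N - l` columns below `A`.
  | sum (l i j : ℕ) : l < wallaceDepth N → A + l ≤ i + wallaceDepth N → i ≤ w → i < 2 * N →
      3 * j < (wallaceCol N l i).length →
      StripGate p N x y A w ⟨.node p (.treeSum l i j), [wallaceBit p N l i (3 * j),
        wallaceBit p N l i (3 * j + 1), wallaceBit p N l i (3 * j + 2)], parity⟩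
  | carry (l i j : ℕ) : l < wallaceDepth N → A + l ≤ i + wallaceDepth N → i ≤ w → i < 2 * N →
      3 * j < (wallaceCol N l i).length →
      StripGate p N x y A w ⟨.node p (.treeCarry l i j), [wallaceBit p N l i (3 * j),
        wallaceBit p N l i (3 * j + 1), wallaceBit p N l i (3 * j + 2)], maj⟩
  | carryIn : StripGate p N x y A w ⟨.node p (.claCarry 0), [.const false], parity⟩
  | gen (i : ℕ) : A ≤ i → i ≤ w → i < 2 * N →
      StripGate p N x y A w ⟨.node p (.claGen 0 i), [wallaceBit p N (wallaceDepth N) i 0,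
        wallaceBit p N (wallaceDepth N) i 1], conj⟩
  | prop (i : ℕ) : A ≤ i → i ≤ w → i < 2 * N →
      StripGate p N x y A w ⟨.node p (.claProp 0 i), [wallaceBit p N (wallaceDepth N) i 0,
        wallaceBit p N (wallaceDepth N) i 1], parity⟩
  | out (i : ℕ) : A ≤ i → i ≤ w → i < 2 * N →
      StripGate p N x y A w ⟨.node p (.claOut i), [.node p (.claCarry i),
        wallaceBit p N (wallaceDepth N) i 0, wallaceBit p N (wallaceDepth N) i 1], parity⟩
  | block (l i : ℕ) (g : Gate) : l < Nat.clog 4 (2 * N) → A ≤ i → i ≤ w → i < 2 * N →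
      g ∈ blockGates p l (i / 4 ^ (l + 1)) → StripGate p N x y A w g

theorem parity_three (a b c : Bool) : parity [a, b, c] = xor a (xor b c) := by
  revert a b c; decide

theorem parity_two (a b : Bool) : parity [a, b] = xor a b := by
  revert a b; decide

theorem conj_two (a b : Bool) : conj [a, b] = (a && b) := by
  revert a b; decide

theorem conj_four (a b c d : Bool) : conj [a, b, c, d] = (a && b && c && d) := by
  revert a b c d; decide

section Carry

variable {α : Var → Bool} {p : List Bool}

/-- The carry out of column `i` of a carry-lookahead adder. -/
def carryOut (α : Var → Bool) (p : List Bool) (i : ℕ) : Bool :=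
  xor (α (.node p (.claGen 0 i))) (α (.node p (.claProp 0 i)) && α (.node p (.claCarry i)))

/-- A lookahead unit computes its carries from the carry into its block, which may be far below `i`.
Comparing the units of the nested blocks that contain `i` recovers the ripple recursion from `i` to
`i + 1`, so the lookahead adder can be analysed inside a window. The second claim covers the case
that `i` is the last column of the block. -/
theorem carry_succ_of_block (l : ℕ) : ∀ q i, i / 4 ^ l = q →
    (∀ l' < l, ∀ g ∈ blockGates p l' (i / 4 ^ (l' + 1)), g.Holds α) →
    (i + 1 < (q + 1) * 4 ^ l → α (.node p (.claCarry (i + 1))) = carryOut α p i) ∧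
    (i + 1 = (q + 1) * 4 ^ l → lookahead [α (.node p (.claCarry (q * 4 ^ l))),
      α (.node p (.claGen l q)), α (.node p (.claProp l q))] = carryOut α p i) := by
  induction l with
  | zero =>
    rintro q i rfl -
    simp only [pow_zero, Nat.div_one, mul_one]
    exact ⟨fun h => absurd h (lt_irrefl _), fun _ => by simp [lookahead, carryOut]⟩
  | succ l ih =>
    intro q i hq hg
    obtain ⟨ih1, ih2⟩ := ih (i / 4 ^ l) i rfl fun l' hl' => hg l' (by omega)
    have hb := hg l (by omega)
    rw [hq] at hb
    have hdiv : i / 4 ^ l / 4 = q := by rw [Nat.div_div_eq_div_mul, ← pow_succ, hq]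
    have hpos : 0 < 4 ^ l := by positivity
    have hlt : i < (i / 4 ^ l + 1) * 4 ^ l := by
      have := Nat.lt_div_mul_add (a := i) hpos
      rw [add_mul, one_mul]; exact this
    generalize i / 4 ^ l = q' at *
    obtain ⟨s, hs, rfl⟩ : ∃ s < 4, q' = 4 * q + s := ⟨q' - 4 * q, by omega, by omega⟩
    simp only [blockGates, List.forall_mem_cons, Gate.Holds, List.map_cons, List.map_nil] at hb
    obtain ⟨hr, hgen, h1, h2, h3, -⟩ := hb
    rw [pow_succ]
    generalize 4 ^ l = P at *
    have e0 : q * (P * 4) = 4 * q * P := by ring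
    rw [e0]
    constructor
    · intro hi
      rcases Nat.lt_or_eq_of_le hlt with h | h
      · exact ih1 h
      · have h' : i + 1 = (4 * q + s + 1) * P := h
        have ih2 := ih2 h'
        rw [h', ← ih2]
        interval_cases s
        · rw [h1]; simp
        · rw [show 4 * q + 1 + 1 = 4 * q + 2 by ring, h2, h1]; simp [lookahead]
        · rw [show 4 * q + 2 + 1 = 4 * q + 3 by ring, h3, h2]; simp [lookahead]
        · exfalso
          rw [h'] at hi
          have : (4 * q + 3 + 1) * P = (q + 1) * (P * 4) := by ring
          omega
    · intro hi
      have h' : i + 1 = (4 * q + s + 1) * P := by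
        have h1 : i + 1 ≤ (4 * q + s + 1) * P := hlt
        have h2 : (4 * q + s + 1) * P ≤ (4 * q + 4) * P :=
          Nat.mul_le_mul_right _ (by omega)
        have h3 : (4 * q + 4) * P = (q + 1) * (P * 4) := by ring
        omega
      obtain rfl : s = 3 := by
        have h3 : (4 * q + 4) * P = (q + 1) * (P * 4) := by ring
        have : (4 * q + s + 1) * P = (4 * q + 4) * P := by omega
        have := Nat.eq_of_mul_eq_mul_right hpos this
        omega
      rw [← ih2 h', hr, hgen, h3]
      generalize α (.node p (.claCarry (4 * q * P))) = c
      generalize α (.node p (.claGen l (4 * q))) = g0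
      generalize α (.node p (.claProp l (4 * q))) = r0
      generalize α (.node p (.claGen l (4 * q + 1))) = g1
      generalize α (.node p (.claProp l (4 * q + 1))) = r1
      generalize α (.node p (.claGen l (4 * q + 2))) = g2
      generalize α (.node p (.claProp l (4 * q + 2))) = r2
      generalize α (.node p (.claGen l (4 * q + 3))) = g3
      generalize α (.node p (.claProp l (4 * q + 3))) = r3
      simp only [lookahead, conj_four]
      cases r0 <;> cases r1 <;> cases r2 <;> cases r3 <;> simp

end Carry

section Strip

variable {α : Var → Bool} {p : List Bool} {N : ℕ} {x y : ℕ → Var} {A w : ℕ}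

/-- The `b`-th bit of column `i` of the last layer of the tree, computed from the operands. -/
def lastRow (α : Var → Bool) (N : ℕ) (x y : ℕ → Var) (b i : ℕ) : Bool :=
  rowBit (treeVal N (α ∘ x) (α ∘ y) (wallaceDepth N)) N (wallaceDepth N) i b

/-- No error arises in the tree: each layer gives up one column at the low end of the window, and
what is left has the values computed from the operands. -/
theorem apply_wallaceBit (h : ∀ g, StripGate p N x y A w g → g.Holds α)
    (h0 : α (.const false) = false) : ∀ l ≤ wallaceDepth N, ∀ i b,
    A + l ≤ i + wallaceDepth N → i ≤ w → i < 2 * N →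
    α (wallaceBit p N l i b) = rowBit (treeVal N (α ∘ x) (α ∘ y) l) N l i b := by
  intro l
  induction l with
  | zero =>
    intro _ i b hA hw hN
    rw [wallaceBit, rowBit]
    rcases hb : (wallaceCol N 0 i)[b]? with _ | v
    · exact h0
    · obtain ⟨rfl, h1, h2⟩ := getElem?_wallaceCol_zero hb
      have := h _ (.pp i _ hA hw hN h1 h2 (by omega))
      rw [Gate.Holds] at this
      simp only [Option.elim_some, this, treeVal, List.map_cons, List.map_nil, conj_two,
        Function.comp]
  | succ l ih =>
    intro hl i b hA hw hN
    have ih := ih (by omega)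
    rw [wallaceBit, rowBit]
    rcases hb : (wallaceCol N (l + 1) i)[b]? with _ | v
    · exact h0
    · rcases getElem?_wallaceCol_succ hb with ⟨j, rfl, -, hj⟩ | ⟨j, rfl, hi, -, hj⟩
      · have := h _ (.sum l i j (by omega) (by omega) hw hN hj)
        rw [Gate.Holds] at this
        simp only [Option.elim_some, this, treeVal, List.map_cons, List.map_nil]
        rw [ih i _ (by omega) hw hN, ih i _ (by omega) hw hN, ih i _ (by omega) hw hN]
      · have := h _ (.carry l (i - 1) j (by omega) (by omega) (by omega) (by omega) (by omega))
        rw [Gate.Holds] at this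
        simp only [Option.elim_some, this, treeVal, List.map_cons, List.map_nil]
        rw [ih (i - 1) _ (by omega) (by omega) (by omega),
          ih (i - 1) _ (by omega) (by omega) (by omega),
          ih (i - 1) _ (by omega) (by omega) (by omega)]

/-- What the gates of a window say about the output bits. -/
structure StripRows (α : Var → Bool) (p : List Bool) (N A w : ℕ) (ρ σ : ℕ → Bool) : Prop where
  prop : ∀ i, A ≤ i → i ≤ w → i < 2 * N → α (.node p (.claProp 0 i)) = xor (ρ i) (σ i)
  out : ∀ i, A ≤ i → i ≤ w → i < 2 * N →
    α (.node p (.claOut i)) = xor (α (.node p (.claCarry i))) (xor (ρ i) (σ i))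
  carry : ∀ i, A ≤ i → i ≤ w → i + 1 < 2 * N →
    α (.node p (.claCarry (i + 1))) = xor (ρ i && σ i) (xor (ρ i) (σ i) && α (.node p (.claCarry i)))
  carryIn : α (.node p (.claCarry 0)) = false

theorem stripRows (h : ∀ g, StripGate p N x y A w g → g.Holds α) (h0 : α (.const false) = false) :
    StripRows α p N A w (lastRow α N x y 0) (lastRow α N x y 1) := by
  have hb := apply_wallaceBit h h0 _ le_rfl
  have hgen : ∀ i, A ≤ i → i ≤ w → i < 2 * N →
      α (.node p (.claGen 0 i)) = (lastRow α N x y 0 i && lastRow α N x y 1 i) := by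
    intro i h1 h2 h3
    have := h _ (.gen i h1 h2 h3)
    simp only [Gate.Holds, List.map_cons, List.map_nil, conj_two] at this
    rw [this, hb i _ (by omega) h2 h3, hb i _ (by omega) h2 h3]; rfl
  have hprop : ∀ i, A ≤ i → i ≤ w → i < 2 * N →
      α (.node p (.claProp 0 i)) = xor (lastRow α N x y 0 i) (lastRow α N x y 1 i) := by
    intro i h1 h2 h3
    have := h _ (.prop i h1 h2 h3)
    simp only [Gate.Holds, List.map_cons, List.map_nil, parity_two] at this
    rw [this, hb i _ (by omega) h2 h3, hb i _ (by omega) h2 h3]; rfl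
  refine ⟨hprop, ?_, ?_, ?_⟩
  · intro i h1 h2 h3
    have := h _ (.out i h1 h2 h3)
    simp only [Gate.Holds, List.map_cons, List.map_nil, parity_three] at this
    rw [this, hb i _ (by omega) h2 h3, hb i _ (by omega) h2 h3]; rfl
  · intro i h1 h2 h3
    have hlt : i + 1 < 4 ^ Nat.clog 4 (2 * N) :=
      h3.trans_le (Nat.le_pow_clog (by norm_num) _)
    -- The single block of the top level contains all columns, and `i` is not its last one.
    have := (carry_succ_of_block (α := α) (p := p) (Nat.clog 4 (2 * N)) 0 i
      (Nat.div_eq_of_lt (by omega)) fun l hl g hg =>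
        h g (.block l i g hl h1 h2 (by omega) hg)).1 (by omega)
    rw [this, carryOut, hgen i h1 h2 (by omega), hprop i h1 h2 (by omega)]
  · have := h _ .carryIn
    simpa [Gate.Holds, parity, h0] using this

end Strip

/-! ### Arithmetic of a window -/

theorem bitsVal_succ (x : ℕ → Bool) (n : ℕ) : bitsVal x (n + 1) = bitsVal x n + 2 ^ n * (x n).toNat :=
  Finset.sum_range_succ _ _

theorem bitsVal_split (x : ℕ → Bool) {m n : ℕ} (h : m ≤ n) :
    ∃ k, bitsVal x n = bitsVal x m + 2 ^ m * k := by
  induction n, h using Nat.le_induction with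
  | base => exact ⟨0, by simp⟩
  | succ n h ih =>
    obtain ⟨k, hk⟩ := ih
    obtain ⟨d, rfl⟩ := Nat.exists_eq_add_of_le h
    exact ⟨k + 2 ^ d * (x (m + d)).toNat, by rw [bitsVal_succ, hk, pow_add]; ring⟩

theorem eq_false_of_bitsVal_eq {x : ℕ → Bool} {m n : ℕ} (h : bitsVal x n = bitsVal x m) :
    ∀ i, m ≤ i → i < n → x i = false := by
  intro i hm hn
  obtain ⟨k, hk⟩ := bitsVal_split x hm
  obtain ⟨k', hk'⟩ := bitsVal_split x (Nat.succ_le_of_lt hn)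
  rw [bitsVal_succ] at hk'
  have : 2 ^ i * (x i).toNat = 0 := by omega
  simpa using this

theorem bitsVal_add_two_pow_le {x : ℕ → Bool} {m n : ℕ} (hm : m < n) (hx : x m = false) :
    bitsVal x n + 2 ^ m < 2 ^ n := by
  have h1 := bitsVal_succ x m
  have h2 := bitsVal_lt x m
  rw [hx] at h1
  induction n, hm using Nat.le_induction with
  | base =>
    rw [Nat.succ_eq_add_one, pow_succ, h1]
    simp
    omega
  | succ n _ ih =>
    rw [bitsVal_succ, pow_succ]
    have : (x n).toNat ≤ 1 := Bool.toNat_le _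
    nlinarith

theorem two_pow_le_bitsVal_add {x : ℕ → Bool} {m n : ℕ} (hmn : m ≤ n)
    (hx : ∀ i, m ≤ i → i < n → x i = true) : 2 ^ n ≤ bitsVal x n + 2 ^ m := by
  induction n, hmn using Nat.le_induction with
  | base => omega
  | succ n h ih =>
    rw [bitsVal_succ, hx n h (by omega), pow_succ]
    have := ih fun i h1 h2 => hx i h1 (by omega)
    simp only [Bool.toNat_true]
    omega

/-- The error unit of a window that starts in column `A`. -/
def errUnit (A : ℕ) : ℤ := if A = 0 then 0 else 2 ^ A

section Window

variable {α : Var → Bool} {p : List Bool} {N A w : ℕ} {ρ σ : ℕ → Bool}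

/-- The ripple invariant started in column `A`, with arbitrary output bits and an arbitrary carry
below. The carry is existential because the carry out of the top column `2 * N - 1` need not be a
bit of the window. -/
theorem StripRows.exists_carry (h : StripRows α p N A w ρ σ) {t : ℕ} (hA : A ≤ t) (hw : t ≤ w + 1)
    (hN : t ≤ 2 * N) : ∃ c : Bool, (t < 2 * N → c = α (.node p (.claCarry t))) ∧
      bitsVal (fun i => α (.node p (.claOut i))) t + 2 ^ t * c.toNat + bitsVal ρ A + bitsVal σ A =
        bitsVal (fun i => α (.node p (.claOut i))) A +
          2 ^ A * (α (.node p (.claCarry A))).toNat + bitsVal ρ t + bitsVal σ t := by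
  induction t, hA using Nat.le_induction with
  | base => exact ⟨_, fun _ => rfl, by ring⟩
  | succ t hA ih =>
    obtain ⟨c, hc, ih⟩ := ih (by omega) (by omega)
    refine ⟨xor (ρ t && σ t) (xor (ρ t) (σ t) && c), fun hlt => ?_, ?_⟩
    · rw [h.carry t hA (by omega) hlt, hc (by omega)]
    · rw [bitsVal_succ, bitsVal_succ, bitsVal_succ, h.out t hA (by omega) (by omega),
        ← hc (by omega), pow_succ]
      have : (xor c (xor (ρ t) (σ t))).toNat +
          2 * (xor (ρ t && σ t) (xor (ρ t) (σ t) && c)).toNat =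
          c.toNat + (ρ t).toNat + (σ t).toNat := by
        cases c <;> cases ρ t <;> cases σ t <;> rfl
      have h2 := congrArg (2 ^ t * ·) this
      simp only [mul_add] at h2
      linarith

/-- The output of a multiplier is the product modulo `2 ^ (w + 1)`, up to an error that comes from
the columns below `A`, unless a wrong carry into column `A` makes it overflow. -/
theorem StripRows.approx (h : StripRows α p N A w ρ σ) {P : ℕ} (hAw : A ≤ w)
    (hP : bitsVal ρ (2 * N) + bitsVal σ (2 * N) = P) (hlt : P < 2 ^ (2 * N))
    (hno : A = 0 ∨ w < 2 * N ∨ 2 * N ≤ A ∨ α (.node p (.claCarry A)) = false ∨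
      ∃ i, A ≤ i ∧ i < 2 * N ∧ α (.node p (.claProp 0 i)) = false) :
    ∃ Z : ℤ, |(bitsVal (fun i => α (.node p (.claOut i))) (2 * N) : ℤ) - P - 2 ^ (w + 1) * Z| ≤
      3 * errUnit A := by
  set o : ℕ → Bool := fun i => α (.node p (.claOut i)) with ho
  -- All that is unknown lies below column `A`: both the output with the carry and the sum of the
  -- two rows lie between 0 and `2 * 2 ^ A`.
  have hsmall : |(bitsVal o A : ℤ) + 2 ^ A * ((α (.node p (.claCarry A))).toNat : ℤ) - bitsVal ρ A -
      bitsVal σ A| ≤ 3 * errUnit A := by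
    by_cases hA : A = 0
    · subst hA; simp [bitsVal, errUnit, h.carryIn]
    · rw [errUnit, if_neg hA]
      have h1 : (bitsVal o A : ℤ) < 2 ^ A := mod_cast bitsVal_lt _ _
      have h2 : (bitsVal ρ A : ℤ) < 2 ^ A := mod_cast bitsVal_lt _ _
      have h3 : (bitsVal σ A : ℤ) < 2 ^ A := mod_cast bitsVal_lt _ _
      have h4 : ((α (.node p (.claCarry A))).toNat : ℤ) ≤ 1 := mod_cast Bool.toNat_le _
      have h5 : (0 : ℤ) ≤ ((α (.node p (.claCarry A))).toNat : ℤ) := by positivity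
      have h6 : (0 : ℤ) < 2 ^ A := by positivity
      rw [abs_le]
      constructor <;> nlinarith
  rcases Nat.lt_or_ge A (2 * N) with hA | hA
  swap
  · refine ⟨0, ?_⟩
    have h1 := bitsVal_lt o (2 * N)
    by_cases h0 : A = 0
    · obtain rfl : N = 0 := by omega
      simp [bitsVal] at hP
      subst hP
      simp [bitsVal, errUnit, h0]
    · rw [errUnit, if_neg h0]
      have h2 : 2 ^ (2 * N) ≤ 2 ^ A := Nat.pow_le_pow_right (by norm_num) hA
      have h3 : (bitsVal o (2 * N) : ℤ) < 2 ^ A := mod_cast h1.trans_le h2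
      have h4 : (P : ℤ) < 2 ^ A := mod_cast hlt.trans_le h2
      rw [abs_le]
      constructor <;> nlinarith
  -- If the multiplier extends beyond `w`, the higher columns and the carry out of `w` are multiples
  -- of `2 ^ (w + 1)`. Otherwise a carry out of the top is lost and has to be excluded.
  rcases Nat.lt_or_ge w (2 * N) with hw | hw
  · obtain ⟨c, -, hc⟩ := h.exists_carry (t := w + 1) (by omega) le_rfl (by omega)
    obtain ⟨k, hk⟩ := bitsVal_split o (m := w + 1) (n := 2 * N) (by omega)
    obtain ⟨k₁, hk₁⟩ := bitsVal_split ρ (m := w + 1) (n := 2 * N) (by omega)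
    obtain ⟨k₂, hk₂⟩ := bitsVal_split σ (m := w + 1) (n := 2 * N) (by omega)
    refine ⟨k - k₁ - k₂ - c.toNat, ?_⟩
    convert hsmall using 2
    have hc : ((bitsVal o (w + 1) + 2 ^ (w + 1) * c.toNat + bitsVal ρ A + bitsVal σ A : ℕ) : ℤ) =
      (bitsVal o A + 2 ^ A * (α (.node p (.claCarry A))).toNat + bitsVal ρ (w + 1) +
        bitsVal σ (w + 1) : ℕ) := congrArg _ hc
    rw [← hP, hk, hk₁, hk₂]
    push_cast at hc ⊢
    linarith
  · obtain ⟨c, -, hc⟩ := h.exists_carry (t := 2 * N) (by omega) (by omega) le_rfl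
    rw [← ho] at hc
    rcases hcv : c with _ | _
    · refine ⟨0, ?_⟩
      convert hsmall using 2
      rw [hcv] at hc
      have hc : ((bitsVal o (2 * N) + 2 ^ (2 * N) * false.toNat + bitsVal ρ A + bitsVal σ A : ℕ) : ℤ) =
        (bitsVal o A + 2 ^ A * (α (.node p (.claCarry A))).toNat + bitsVal ρ (2 * N) +
          bitsVal σ (2 * N) : ℕ) := congrArg _ hc
      rw [← hP]
      push_cast at hc ⊢
      simp at hc
      linarith
    -- The true sum is below `2 ^ (2 * N)`. So a carry out of the top requires the carry 1 into `A`
    -- and output bits 0 from `A` on, and then, column by column, every column propagates.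
    · exfalso
      obtain ⟨k, hk⟩ := bitsVal_split o hA.le
      obtain ⟨k₁, hk₁⟩ := bitsVal_split ρ hA.le
      obtain ⟨k₂, hk₂⟩ := bitsVal_split σ hA.le
      obtain ⟨d, hd⟩ := Nat.exists_eq_add_of_le hA.le
      have hpow : 2 ^ (2 * N) = 2 ^ A * 2 ^ d := by rw [hd, pow_add]
      have hpos : 0 < 2 ^ A := by positivity
      rw [hcv, hk, hk₁, hk₂, hpow] at hc
      simp only [Bool.toNat_true, mul_one] at hc
      have e1 : 2 ^ A * (k + 2 ^ d) = 2 ^ A * ((α (.node p (.claCarry A))).toNat + k₁ + k₂) := by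
        simp only [mul_add]; omega
      have e1 := Nat.eq_of_mul_eq_mul_left hpos e1
      have e2 : 2 ^ A * (k₁ + k₂) < 2 ^ A * 2 ^ d := by
        rw [← hpow, mul_add]; omega
      have e2 := Nat.lt_of_mul_lt_mul_left e2
      have e3 : (α (.node p (.claCarry A))).toNat ≤ 1 := Bool.toNat_le _
      have hk0 : k = 0 := by omega
      have hcA : α (.node p (.claCarry A)) = true := by
        have : (α (.node p (.claCarry A))).toNat = 1 := by omega
        simpa using this
      have hout := eq_false_of_bitsVal_eq (x := o) (m := A) (n := 2 * N) (by rw [hk, hk0]; simp)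
      have hprop : ∀ i, A ≤ i → i < 2 * N → xor (ρ i) (σ i) = true ∧
          α (.node p (.claCarry i)) = true := by
        intro i hi
        induction i, hi using Nat.le_induction with
        | base =>
          intro hi
          have h1 := hout A le_rfl hi
          simp only [ho] at h1
          rw [h.out A le_rfl hAw hi, hcA] at h1
          exact ⟨by simpa using h1, hcA⟩
        | succ i hi ih =>
          intro hlt
          obtain ⟨ih1, ih2⟩ := ih (by omega)
          have h2 := h.carry i hi (by omega) hlt
          rw [ih1, ih2] at h2
          have h3 : (ρ i && σ i) = false := by revert ih1; cases ρ i <;> cases σ i <;> simp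
          rw [h3] at h2
          have h1 := hout (i + 1) (by omega) hlt
          simp only [ho] at h1
          rw [h.out (i + 1) (by omega) (by omega) hlt, h2] at h1
          exact ⟨by simpa using h1, by simpa using h2⟩
      rcases hno with h0 | h0 | h0 | h0 | ⟨i, h1, h2, h3⟩
      · subst h0; rw [h.carryIn] at hcA; exact absurd hcA (by simp)
      · omega
      · omega
      · rw [hcA] at h0; exact absurd h0 (by simp)
      · rw [h.prop i h1 (by omega) h2, (hprop i h1 h2).1] at h3; exact absurd h3 (by simp)

theorem bitsVal_add_of_xor {m t : ℕ} (hmt : m ≤ t) (h : ∀ i, m ≤ i → i < t → xor (ρ i) (σ i) = true) :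
    bitsVal ρ t + bitsVal σ t + 2 ^ m = bitsVal ρ m + bitsVal σ m + 2 ^ t := by
  induction t, hmt using Nat.le_induction with
  | base => rfl
  | succ t hm ih =>
    have ih := ih fun i h1 h2 => h i h1 (by omega)
    have : (ρ t).toNat + (σ t).toNat = 1 := by
      have := h t hm (by omega)
      revert this
      cases ρ t <;> cases σ t <;> simp
    have h2 := congrArg (2 ^ t * ·) this
    simp only [mul_add] at h2
    rw [bitsVal_succ, bitsVal_succ, pow_succ]
    omega

theorem not_multiple {a b k t : ℕ} (h : 2 ^ t * a = 2 ^ t * b + k) (h0 : 0 < k) (hk : k < 2 ^ t) :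
    False := by
  have hpos : 0 < 2 ^ t := by positivity
  have h1 : 2 ^ t * b < 2 ^ t * a := by omega
  have h1 := Nat.lt_of_mul_lt_mul_left h1
  have : 2 ^ t * (b + 1) ≤ 2 ^ t * a := Nat.mul_le_mul_left _ h1
  rw [mul_add] at this
  omega

/-- Two rows that add up to the product cannot propagate a carry in all columns of a window if the
product is not close to `2 ^ (2 * N)`. -/
theorem false_of_propagate {P E m t : ℕ} (hP : bitsVal ρ (2 * N) + bitsVal σ (2 * N) = P)
    (hE : P + E = 2 ^ (2 * N)) (hmt : m ≤ t) (htN : t ≤ 2 * N)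
    (h : ∀ i, m ≤ i → i < t → xor (ρ i) (σ i) = true) (hm : 2 ^ m < E)
    (ht : t = 2 * N ∨ E + 2 ^ m < 2 ^ t) : False := by
  have h1 := bitsVal_add_of_xor hmt h
  have h2 := bitsVal_lt ρ m
  have h3 := bitsVal_lt σ m
  obtain ⟨k₁, hk₁⟩ := bitsVal_split ρ htN
  obtain ⟨k₂, hk₂⟩ := bitsVal_split σ htN
  obtain ⟨d, hd⟩ := Nat.exists_eq_add_of_le htN
  rcases ht with ht | ht
  · subst ht; omega
  · have hpow : 2 ^ (2 * N) = 2 ^ t * 2 ^ d := by rw [hd, pow_add]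
    -- Modulo `2 ^ t` the propagating columns contribute `-2 ^ m` and the product is `-E`. So `E - 2
    -- ^ m` plus the parts of the rows below `m` is a multiple of `2 ^ t`, but it lies strictly
    -- between 0 and `E + 2 ^ m`.
    refine not_multiple (a := 2 ^ d) (b := k₁ + k₂ + 1) (t := t)
      (k := E + bitsVal ρ m + bitsVal σ m - 2 ^ m) ?_ (by omega) (by omega)
    rw [← hpow, mul_add, mul_add]
    omega

/-- Two rows that add up to a product close to `2 ^ (2 * N)` cannot generate a carry and propagate
it through a window. -/
theorem false_of_generate {P E m t : ℕ} (hP : bitsVal ρ (2 * N) + bitsVal σ (2 * N) = P)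
    (hE : P + E = 2 ^ (2 * N)) (hE0 : 0 < E) (hmt : m < t) (htN : t ≤ 2 * N)
    (hgen : (ρ m && σ m) = true) (h : ∀ i, m < i → i < t → xor (ρ i) (σ i) = true)
    (ht : t = 2 * N ∨ E + 2 ^ (m + 1) ≤ 2 ^ t) : False := by
  have h1 := bitsVal_add_of_xor (m := m + 1) hmt h
  have h2 := bitsVal_lt ρ m
  have h3 := bitsVal_lt σ m
  rw [Bool.and_eq_true] at hgen
  rw [bitsVal_succ, bitsVal_succ, hgen.1, hgen.2] at h1
  simp only [Bool.toNat_true, mul_one, pow_succ] at h1 ht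
  obtain ⟨k₁, hk₁⟩ := bitsVal_split ρ htN
  obtain ⟨k₂, hk₂⟩ := bitsVal_split σ htN
  obtain ⟨d, hd⟩ := Nat.exists_eq_add_of_le htN
  rcases ht with ht | ht
  · subst ht; omega
  · have hpow : 2 ^ (2 * N) = 2 ^ t * 2 ^ d := by rw [hd, pow_add]
    -- Here the `2 ^ (m + 1)` generated in column `m` cancels against the propagating columns above
    -- it. So `E` plus the parts of the rows below `m` is a multiple of `2 ^ t`, but it is positive
    -- and less than `E + 2 ^ (m + 1)`.
    refine not_multiple (a := 2 ^ d) (b := k₁ + k₂ + 1) (t := t)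
      (k := E + bitsVal ρ m + bitsVal σ m) ?_ (by omega) (by omega)
    rw [← hpow, mul_add, mul_add]
    omega

end Window

/-- A zero at bit `m` of a factor keeps the product at least `2 ^ (m + N)` below `2 ^ (2 * N)`.
Conversely, `two_pow_le_mul_add` bounds this gap for factors whose bits from `m` on are all 1. -/
theorem mul_add_two_pow_le {N m U V : ℕ} (hU : U + 2 ^ m < 2 ^ N) (hV : V < 2 ^ N) :
    U * V + 2 ^ (m + N) ≤ 2 ^ (2 * N) := by
  have h1 : U * V ≤ U * 2 ^ N := Nat.mul_le_mul_left _ hV.le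
  have h2 : (U + 2 ^ m) * 2 ^ N ≤ 2 ^ N * 2 ^ N := Nat.mul_le_mul_right _ hU.le
  rw [two_mul, pow_add, pow_add]
  nlinarith

theorem two_pow_le_mul_add {N m U V : ℕ} (hU : 2 ^ N ≤ U + 2 ^ m) (hV : 2 ^ N ≤ V + 2 ^ m)
    (hU' : U < 2 ^ N) (hm : m ≤ N) : 2 ^ (2 * N) ≤ U * V + 2 ^ (m + N + 1) := by
  have h0 : 2 ^ m ≤ 2 ^ N := Nat.pow_le_pow_right (by norm_num) hm
  have h1 : U * 2 ^ N ≤ U * (V + 2 ^ m) := Nat.mul_le_mul_left _ hV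
  have h2 : 2 ^ N * 2 ^ N ≤ (U + 2 ^ m) * 2 ^ N := Nat.mul_le_mul_right _ hU
  rw [two_mul, pow_add, pow_succ, pow_add]
  nlinarith

/-! ### Positions in the layers of a tree -/

/-- The row of layer `l` that corresponds to row `t` of layer `0`. -/
def tau : ℕ → ℕ → ℕ
  | 0, t => t
  | l + 1, t => 2 * (tau l t / 3)

theorem tau_mono (l : ℕ) : Monotone (tau l) := by
  induction l with
  | zero => exact fun _ _ h => h
  | succ l ih =>
    intro s t h
    have := ih h
    simp only [tau]
    omega

theorem tau_succ_le (l t : ℕ) : tau l (t + 1) ≤ tau l t + 2 := by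
  induction l with
  | zero => simp [tau]
  | succ l ih =>
    simp only [tau]
    omega

theorem tau_zero (l : ℕ) : tau l 0 = 0 := by
  induction l with
  | zero => rfl
  | succ l ih => simp [tau, ih]

/-- `tau l` starts at 0 and grows in steps of at most 2, so every row of layer `l` is close to the
image of some row of layer 0. -/
theorem exists_tau_eq (l p H : ℕ) (h : p ≤ tau l H + 3) :
    ∃ t ≤ H, tau l t ≤ p + 1 ∧ p ≤ tau l t + 3 := by
  induction H with
  | zero => exact ⟨0, le_rfl, by simp [tau_zero], h⟩
  | succ H ih =>
    by_cases h' : p ≤ tau l H + 3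
    · obtain ⟨t, ht, h⟩ := ih h'
      exact ⟨t, by omega, h⟩
    · have := tau_succ_le l H
      exact ⟨H + 1, le_rfl, by omega, h⟩

/-- The heights satisfy the recursion of `tau` up to rounding, and a slack of 4 reproduces itself
from layer to layer. -/
theorem length_wallaceCol_le_tau (N H : ℕ) : ∀ l i,
    (∀ i', i ≤ i' + l → i' ≤ i → (wallaceCol N 0 i').length ≤ H) →
    (wallaceCol N l i).length ≤ tau l H + 4 := by
  intro l
  induction l with
  | zero => intro i h; exact (h i (by omega) le_rfl).trans (by simp [tau])
  | succ l ih =>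
    intro i h
    have h1 := ih i fun i' h1 h2 => h i' (by omega) h2
    have h2 := ih (i - 1) fun i' h1 h2 => h i' (by omega) (by omega)
    rw [wallaceCol, length_nextCol, tau]
    split_ifs <;> omega

/-! ### Folded time -/

/-- The positions at distance at most `ρ` from `t` or from `W - t`. -/
def nearSet (ρ W t : ℕ) : Finset ℕ := Finset.Icc (t - ρ) (t + ρ) ∪ Finset.Icc (W - t - ρ) (W - t + ρ)

theorem mem_nearSet {ρ W t m : ℕ} (ht : t ≤ W) : m ∈ nearSet ρ W t ↔
    (m ≤ t + ρ ∧ t ≤ m + ρ) ∨ (m + t ≤ W + ρ ∧ W ≤ m + t + ρ) := by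
  simp only [nearSet, Finset.mem_union, Finset.mem_Icc]
  omega

theorem card_nearSet_le (ρ W t : ℕ) : (nearSet ρ W t).card ≤ 4 * ρ + 2 := by
  refine (Finset.card_union_le _ _).trans ?_
  simp only [Nat.card_Icc]
  omega

/-- The folded time of position `m`. -/
def foldTime (W m : ℕ) : ℕ := min m (W - m)

theorem foldTime_le (W m : ℕ) : foldTime W m ≤ W / 2 := by
  rw [foldTime]; omega

/-- Folding the line in the middle keeps intervals intact: an interval that comes near the folded
positions at times `i` and `k` also meets those at each time between. -/
theorem exists_nearSet_of_convex {P : ℕ → Prop}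
    (hP : ∀ i j k, i ≤ j → j ≤ k → P i → P k → P j) {ρ W i j k : ℕ} (hij : i ≤ j) (hjk : j ≤ k)
    (hk : k ≤ W / 2) (h₁ : ∃ m ∈ nearSet ρ W i, P m) (h₂ : ∃ m ∈ nearSet ρ W k, P m) :
    ∃ m ∈ nearSet ρ W j, P m := by
  obtain ⟨m, hm, hPm⟩ := h₁
  obtain ⟨m', hm', hPm'⟩ := h₂
  rw [mem_nearSet (by omega)] at hm hm'
  by_cases h1 : m ∈ nearSet ρ W j
  · exact ⟨m, h1, hPm⟩
  by_cases h2 : m' ∈ nearSet ρ W j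
  · exact ⟨m', h2, hPm'⟩
  rw [mem_nearSet (by omega)] at h1 h2
  by_cases h3 : (m ≤ j ∧ j ≤ m') ∨ (m' ≤ j ∧ j ≤ m)
  · refine ⟨j, (mem_nearSet (by omega)).2 (by omega), ?_⟩
    rcases h3 with h | h
    · exact hP m j m' h.1 h.2 hPm hPm'
    · exact hP m' j m h.1 h.2 hPm' hPm
  · refine ⟨W - j, (mem_nearSet (by omega)).2 (by omega), ?_⟩
    have h4 : (m ≤ W - j ∧ W - j ≤ m') ∨ (m' ≤ W - j ∧ W - j ≤ m) := by omega
    rcases h4 with h | h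
    · exact hP m _ m' h.1 h.2 hPm hPm'
    · exact hP m' _ m h.1 h.2 hPm' hPm

/-! ### The variables at a position -/

/-- The generate, propagate and carry bits of a carry-lookahead adder that belong to column `m`. -/
def claCol (K m : ℕ) : Finset LocalVar :=
  (Finset.range (K + 1)).biUnion fun l => (Finset.range 4).biUnion fun s =>
    {.claGen l (4 * (m / 4 ^ (l + 1)) + s), .claProp l (4 * (m / 4 ^ (l + 1)) + s),
      .claCarry ((4 * (m / 4 ^ (l + 1)) + s) * 4 ^ l)}

/-- The row of column `i` near which the partial products of a constant are: the constant is the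
first operand if `b = true`. -/
def constRow (b : Bool) (i : ℕ) : ℕ := if b then i else 0

/-- Adder `j` in layer `l` of a column is close to the row `t` of layer `0`. -/
def NearTree (B l t j : ℕ) : Prop := j ≤ tau l t / 3 + B ∧ tau l t / 3 ≤ j + B

/-- Row `j` is close to row `t`. -/
def NearRow (c t j : ℕ) : Prop := j ≤ t + c ∧ t ≤ j + c

instance (B l t j : ℕ) : Decidable (NearTree B l t j) := inferInstanceAs (Decidable (_ ∧ _))

instance (c t j : ℕ) : Decidable (NearRow c t j) := inferInstanceAs (Decidable (_ ∧ _))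

/-- The outputs of the adders in layer `l` of column `i` that are close to the row `t` of layer `0`. -/
def treeVars (B l i t : ℕ) : Finset LocalVar :=
  (Finset.Icc (tau l t / 3 - B) (tau l t / 3 + B)).biUnion fun j =>
    {.treeSum l i j, .treeCarry l i j}

theorem treeSum_mem_treeVars {B l i t l' i' j : ℕ} :
    LocalVar.treeSum l' i' j ∈ treeVars B l i t ↔ l' = l ∧ i' = i ∧ NearTree B l t j := by
  simp only [treeVars, Finset.mem_biUnion, Finset.mem_Icc, Finset.mem_insert, Finset.mem_singleton,
    LocalVar.treeSum.injEq, reduceCtorEq, or_false, NearTree]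
  constructor
  · rintro ⟨a, ha, rfl, rfl, rfl⟩; exact ⟨rfl, rfl, by omega⟩
  · rintro ⟨rfl, rfl, h⟩; exact ⟨j, by omega, rfl, rfl, rfl⟩

theorem treeCarry_mem_treeVars {B l i t l' i' j : ℕ} :
    LocalVar.treeCarry l' i' j ∈ treeVars B l i t ↔ l' = l ∧ i' = i ∧ NearTree B l t j := by
  simp only [treeVars, Finset.mem_biUnion, Finset.mem_Icc, Finset.mem_insert, Finset.mem_singleton,
    LocalVar.treeCarry.injEq, reduceCtorEq, false_or, NearTree]
  constructor
  · rintro ⟨a, ha, rfl, rfl, rfl⟩; exact ⟨rfl, rfl, by omega⟩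
  · rintro ⟨rfl, rfl, h⟩; exact ⟨j, by omega, rfl, rfl, rfl⟩

/-- The variables of column `m` of a multiplication by a constant of width `c` that are not forced
to be `0`. -/
def constMulCol (N c : ℕ) (b : Bool) (m : ℕ) : Finset LocalVar :=
  claCol (Nat.clog 4 (2 * N)) m ∪
  (Finset.Icc (constRow b m - c) (constRow b m + c)).image (.partialProduct m) ∪
  -- Column `m - 1` is included because its carries are entries of column `m`. The radius `2 * c +
  -- 5` is large enough for `far_input`.
  (Finset.range (wallaceDepth N)).biUnion fun l =>
    treeVars (2 * c + 5) l (m - 1) (constRow b (m - 1)) ∪ treeVars (2 * c + 5) l m (constRow b m)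

namespace RingExpr

/-- The local variables of a node that belong to bit position `m`. -/
def colVars (n A w : ℕ) : RingExpr → ℕ → Finset LocalVar
  | add _ _, m => {.rcSum m, .rcCarry m, .rcCarry (m - 1)}
  | mul a b, m => {.claOut m} ∪
      if a.degree = 0 then constMulCol (max (a.width n) (b.width n)) (a.width n) true m
      else if b.degree = 0 then constMulCol (max (a.width n) (b.width n)) (b.width n) false m
      -- In a product of linear expressions the position `m` is a row: these are the partial
      -- products of the window with bit `m` of the second operand.
      else (Finset.Icc (A - wallaceDepth (max (a.width n) (b.width n))) w).image
        fun i => .partialProduct i m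
  | _, _ => ∅

/-- The local variables of a product of two linear expressions that belong to row `t` of layer `0`. -/
def rowVars (n A w : ℕ) : RingExpr → ℕ → Finset LocalVar
  | mul a b, t =>
      let N := max (a.width n) (b.width n)
      if a.degree = 0 ∨ b.degree = 0 then ∅
      else (Finset.range (wallaceDepth N)).biUnion fun l =>
        (Finset.Icc (A - wallaceDepth N) w).biUnion fun i =>
          -- Column `i` of layer 0 starts with the partial product of row `i + 1 - N`. The offset is
          -- that of the highest column of the window, and `t` less this offset is the row inside
          -- the column.
          treeVars 4 l i (t - (min w (2 * N - 1) + 1 - N))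
  | _, _ => ∅

/-- The local variables of a node that are kept all the time. -/
def permVars (n A w : ℕ) (e : RingExpr) : Finset LocalVar :=
  (if e.degree = 0 then (Finset.range (e.width n)).biUnion (e.colVars n A w) else ∅) ∪
  match e with
  | mul a b => if a.degree = 0 ∨ b.degree = 0 then ∅
      else insert (.claCarry 0)
        ((Finset.Icc A w).biUnion (claCol (Nat.clog 4 (2 * max (a.width n) (b.width n)))))
  | _ => ∅

/-- The local variables of a node in the bag at time `t`. -/
def localBag (n A w ρ : ℕ) (e : RingExpr) (t : ℕ) : Finset LocalVar :=
  e.permVars n A w ∪ (nearSet ρ (w + 1) t).biUnion (e.colVars n A w) ∪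
    (nearSet 0 (w + 1) t).biUnion (e.rowVars n A w)

/-- The variables of a node in the bag at time `t`. -/
def nodeBag (n A w ρ : ℕ) (q : List Bool) (e : RingExpr) (t : ℕ) : Finset Var :=
  match e with
  | var k => (nearSet ρ (w + 1) t).image (.input k)
  | e => (e.localBag n A w ρ t).image (.node q)

/-- The subexpressions of an expression, with their addresses. -/
def nodes : RingExpr → List Bool → List (List Bool × RingExpr)
  | add a b, p => (p, add a b) :: (a.nodes (false :: p) ++ b.nodes (true :: p))
  | mul a b, p => (p, mul a b) :: (a.nodes (false :: p) ++ b.nodes (true :: p))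
  | e, p => [(p, e)]

theorem self_mem_nodes (e : RingExpr) (p : List Bool) : (p, e) ∈ e.nodes p := by
  cases e <;> simp [nodes]

theorem suffix_of_mem_nodes {e : RingExpr} {p : List Bool} {x : List Bool × RingExpr}
    (h : x ∈ e.nodes p) : p <:+ x.1 := by
  induction e generalizing p with
  | var | zero | one => simp [nodes] at h; simp [h]
  | add a b iha ihb | mul a b iha ihb =>
    simp only [nodes, List.mem_cons, List.mem_append] at h
    rcases h with rfl | h | h
    · exact List.suffix_rfl
    · exact (List.suffix_cons _ _).trans (iha h)
    · exact (List.suffix_cons _ _).trans (ihb h)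

theorem not_suffix_both {c c' : Bool} {p q : List Bool} (hc : c ≠ c') (h : (c :: p) <:+ q)
    (h' : (c' :: p) <:+ q) : False := by
  have := List.suffix_of_suffix_length_le h h' (by simp)
  have := this.eq_of_length (by simp)
  simp at this
  exact hc this

theorem nodes_unique {e : RingExpr} {p q : List Bool} {e₁ e₂ : RingExpr}
    (h₁ : (q, e₁) ∈ e.nodes p) (h₂ : (q, e₂) ∈ e.nodes p) : e₁ = e₂ := by
  have hno : ∀ (c : Bool) (p : List Bool), ¬ (c :: p) <:+ p := fun c p h => by
    have := h.length_le
    simp at this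
  induction e generalizing p with
  | var | zero | one => simp [nodes] at h₁ h₂; rw [h₁.2, h₂.2]
  | add a b iha ihb | mul a b iha ihb =>
    simp only [nodes, List.mem_cons, List.mem_append, Prod.mk.injEq] at h₁ h₂
    rcases h₁ with ⟨rfl, rfl⟩ | h₁ | h₁ <;> rcases h₂ with ⟨h, rfl⟩ | h₂ | h₂
    · rfl
    · exact absurd (suffix_of_mem_nodes h₂) (hno _ _)
    · exact absurd (suffix_of_mem_nodes h₂) (hno _ _)
    · subst h; exact absurd (suffix_of_mem_nodes h₁) (hno _ _)
    · exact iha h₁ h₂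
    · exact (not_suffix_both Bool.false_ne_true (suffix_of_mem_nodes (x := (q, e₁)) h₁)
        (suffix_of_mem_nodes (x := (q, e₂)) h₂)).elim
    · subst h; exact absurd (suffix_of_mem_nodes h₁) (hno _ _)
    · exact (not_suffix_both Bool.false_ne_true.symm (suffix_of_mem_nodes (x := (q, e₁)) h₁)
        (suffix_of_mem_nodes (x := (q, e₂)) h₂)).elim
    · exact ihb h₁ h₂

end RingExpr

open RingExpr

/-- The nodes of the two expressions. -/
def allNodes (L R : RingExpr) : List (List Bool × RingExpr) := L.nodes [false] ++ R.nodes [true]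

theorem allNodes_unique {L R : RingExpr} {q : List Bool} {e₁ e₂ : RingExpr}
    (h₁ : (q, e₁) ∈ allNodes L R) (h₂ : (q, e₂) ∈ allNodes L R) : e₁ = e₂ := by
  rcases List.mem_append.1 h₁ with h₁ | h₁ <;> rcases List.mem_append.1 h₂ with h₂ | h₂
  · exact nodes_unique h₁ h₂
  · exact (not_suffix_both Bool.false_ne_true (suffix_of_mem_nodes (x := (q, e₁)) h₁)
      (suffix_of_mem_nodes (x := (q, e₂)) h₂)).elim
  · exact (not_suffix_both Bool.false_ne_true.symm (suffix_of_mem_nodes (x := (q, e₁)) h₁)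
      (suffix_of_mem_nodes (x := (q, e₂)) h₂)).elim
  · exact nodes_unique h₁ h₂

open Classical in
/-- The bag at time `t`. -/
noncomputable def bag (L R : RingExpr) (n A w ρ t : ℕ) : Finset Var :=
  (allNodes L R).toFinset.biUnion fun x => nodeBag n A w ρ x.1 x.2 t

theorem mem_bag {L R : RingExpr} {n A w ρ t : ℕ} {v : Var} : v ∈ bag L R n A w ρ t ↔
    ∃ q e, (q, e) ∈ allNodes L R ∧ v ∈ nodeBag n A w ρ q e t := by
  simp [bag]

/-! ### Every variable occurs in an interval of bags -/

theorem mem_claCol {K m : ℕ} {v : LocalVar} : v ∈ claCol K m ↔ ∃ l ≤ K, ∃ s < 4,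
    v = .claGen l (4 * (m / 4 ^ (l + 1)) + s) ∨ v = .claProp l (4 * (m / 4 ^ (l + 1)) + s) ∨
      v = .claCarry ((4 * (m / 4 ^ (l + 1)) + s) * 4 ^ l) := by
  simp [claCol, Nat.lt_succ_iff]

theorem div_eq_of_between {i j k b : ℕ} (hij : i ≤ j) (hjk : j ≤ k) (h : i / b = k / b) :
    j / b = i / b :=
  le_antisymm ((Nat.div_le_div_right hjk).trans h.ge) (Nat.div_le_div_right hij)

/-- The block that contains a column is monotone in the column. A carry bit can be listed at several
levels; if it is listed for `i` and for `k` at different levels, the block of the higher level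
contains both columns and everything between. -/
theorem claCol_convex {K : ℕ} {v : LocalVar} : ∀ i j k, i ≤ j → j ≤ k → v ∈ claCol K i →
    v ∈ claCol K k → v ∈ claCol K j := by
  intro i j k hij hjk hi hk
  rw [mem_claCol] at *
  obtain ⟨l, hl, s, hs, hi⟩ := hi
  obtain ⟨l', hl', s', hs', hk⟩ := hk
  rcases hi with rfl | rfl | rfl
  · simp only [LocalVar.claGen.injEq, reduceCtorEq, or_false] at hk
    obtain ⟨rfl, hk⟩ := hk
    refine ⟨l, hl, s, hs, Or.inl ?_⟩
    rw [div_eq_of_between hij hjk (by omega)]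
  · simp only [LocalVar.claProp.injEq, reduceCtorEq, or_false, false_or] at hk
    obtain ⟨rfl, hk⟩ := hk
    refine ⟨l, hl, s, hs, Or.inr (Or.inl ?_)⟩
    rw [div_eq_of_between hij hjk (by omega)]
  · simp only [LocalVar.claCarry.injEq, reduceCtorEq, false_or] at hk
    have key : ∀ m l s, s < 4 → ((4 * (m / 4 ^ (l + 1)) + s) * 4 ^ l) / 4 ^ (l + 1) =
        m / 4 ^ (l + 1) := by
      intro m l s hs
      rw [pow_succ, ← Nat.div_div_eq_div_mul, Nat.mul_div_cancel _ (by positivity)]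
      omega
    have key2 : ∀ m c l d, m / 4 ^ (l + 1) = c / 4 ^ (l + 1) → l ≤ d →
        m / 4 ^ (d + 1) = c / 4 ^ (d + 1) := by
      intro m c l d h hld
      obtain ⟨e, rfl⟩ := Nat.exists_eq_add_of_le hld
      rw [show l + e + 1 = (l + 1) + e by ring, pow_add, ← Nat.div_div_eq_div_mul,
        ← Nat.div_div_eq_div_mul, h]
    have hi' := key i l s hs
    have hk' := key k l' s' hs'
    rw [← hk] at hk'
    generalize hc : (4 * (i / 4 ^ (l + 1)) + s) * 4 ^ l = c at *
    rcases le_total l l' with h | h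
    · have h1 := key2 i c l l' hi'.symm h
      have h2 := div_eq_of_between hij hjk (by rw [h1, hk'])
      refine ⟨l', hl', s', hs', Or.inr (Or.inr ?_)⟩
      rw [h2, h1, hk', hk]
    · have h1 := key2 k c l' l hk'.symm h
      have h2 := div_eq_of_between hij hjk (by rw [h1, hi'])
      refine ⟨l, hl, s, hs, Or.inr (Or.inr ?_)⟩
      rw [h2, hc]


theorem constMulCol_convex {N c : ℕ} {b : Bool} {v : LocalVar} {i j k : ℕ} (hij : i ≤ j)
    (hjk : j ≤ k) (hi : v ∈ constMulCol N c b i) (hk : v ∈ constMulCol N c b k) :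
    v ∈ constMulCol N c b j := by
  simp only [constMulCol, Finset.mem_union, Finset.mem_image, Finset.mem_biUnion,
    Finset.mem_range] at hi hk ⊢
  rcases hi with (hi | ⟨r, hr, rfl⟩) | ⟨l, hl, hi⟩ <;>
    rcases hk with (hk | ⟨r', hr', hk⟩) | ⟨l', hl', hk⟩
  · exact Or.inl (Or.inl (claCol_convex i j k hij hjk hi hk))
  · subst hk; simp [mem_claCol] at hi
  · rw [mem_claCol] at hi
    obtain ⟨_, _, _, _, rfl | rfl | rfl⟩ := hi <;> simp [treeVars] at hk
  · simp [mem_claCol] at hk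
  · simp only [LocalVar.partialProduct.injEq] at hk
    obtain ⟨rfl, rfl⟩ := hk
    have hji : j = k := by omega
    subst hji
    exact Or.inl (Or.inr ⟨_, hr, rfl⟩)
  · simp [treeVars] at hk
  · rw [mem_claCol] at hk
    obtain ⟨_, _, _, _, rfl | rfl | rfl⟩ := hk <;> simp [treeVars] at hi
  · subst hk; simp [treeVars] at hi
  · right
    cases v with
    | treeSum l₀ i₀ j₀ =>
      simp only [treeSum_mem_treeVars] at hi hk ⊢
      refine ⟨l, hl, ?_⟩
      rcases hi with ⟨rfl, rfl, hi⟩ | ⟨rfl, rfl, hi⟩ <;>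
        rcases hk with ⟨rfl, h, hk⟩ | ⟨rfl, h, hk⟩
      · by_cases hj : i - 1 = j - 1
        · left; rw [hj] at hi ⊢; exact ⟨rfl, rfl, hi⟩
        · omega
      · by_cases hj : i - 1 = j - 1
        · left; rw [hj] at hi ⊢; exact ⟨rfl, rfl, hi⟩
        · omega
      · by_cases hj : i₀ = j - 1
        · left; rw [← hj]; exact ⟨rfl, rfl, hi⟩
        · have hji : j = i₀ := by omega
          subst hji
          right; exact ⟨rfl, rfl, hi⟩
      · have hji : j = i₀ := by omega
        subst hji
        right; exact ⟨rfl, rfl, hi⟩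
    | treeCarry l₀ i₀ j₀ =>
      simp only [treeCarry_mem_treeVars] at hi hk ⊢
      refine ⟨l, hl, ?_⟩
      rcases hi with ⟨rfl, rfl, hi⟩ | ⟨rfl, rfl, hi⟩ <;>
        rcases hk with ⟨rfl, h, hk⟩ | ⟨rfl, h, hk⟩
      · by_cases hj : i - 1 = j - 1
        · left; rw [hj] at hi ⊢; exact ⟨rfl, rfl, hi⟩
        · omega
      · by_cases hj : i - 1 = j - 1
        · left; rw [hj] at hi ⊢; exact ⟨rfl, rfl, hi⟩
        · omega
      · by_cases hj : i₀ = j - 1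
        · left; rw [← hj]; exact ⟨rfl, rfl, hi⟩
        · have hji : j = i₀ := by omega
          subst hji
          right; exact ⟨rfl, rfl, hi⟩
      · have hji : j = i₀ := by omega
        subst hji
        right; exact ⟨rfl, rfl, hi⟩
    | _ => simp [treeVars] at hi

theorem colVars_convex {n A w : ℕ} {e : RingExpr} {v : LocalVar} (i j k : ℕ) (hij : i ≤ j)
    (hjk : j ≤ k) (hi : v ∈ e.colVars n A w i) (hk : v ∈ e.colVars n A w k) :
    v ∈ e.colVars n A w j := by
  cases e with
  | var | zero | one => simp [colVars] at hi
  | add a b =>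
    simp only [colVars, Finset.mem_insert, Finset.mem_singleton] at *
    rcases hi with rfl | rfl | rfl
    · simp only [LocalVar.rcSum.injEq, reduceCtorEq, or_false] at *
      omega
    · simp only [LocalVar.rcCarry.injEq, reduceCtorEq, false_or] at *
      omega
    · simp only [LocalVar.rcCarry.injEq, reduceCtorEq, false_or] at *
      omega
  | mul a b =>
    simp only [colVars, Finset.mem_union, Finset.mem_singleton] at *
    have hout : ∀ m, v = .claOut m → m = i → m = k → v = .claOut j := by
      intro m h h1 h2
      rw [h, LocalVar.claOut.injEq]; omega
    have hcl : ∀ N c b m m', LocalVar.claOut m ∈ constMulCol N c b m' → False := by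
      intro N c b m m' h
      simp [constMulCol, treeVars, mem_claCol] at h
    rcases hi with rfl | hi <;> rcases hk with hk | hk
    · simp only [LocalVar.claOut.injEq] at hk
      left; rw [LocalVar.claOut.injEq]; omega
    · exfalso
      split_ifs at hk
      · exact hcl _ _ _ _ _ hk
      · exact hcl _ _ _ _ _ hk
      · simp at hk
    · exfalso
      subst hk
      split_ifs at hi
      · exact hcl _ _ _ _ _ hi
      · exact hcl _ _ _ _ _ hi
      · simp at hi
    · right
      split_ifs at hi hk ⊢
      · exact constMulCol_convex hij hjk hi hk
      · exact constMulCol_convex hij hjk hi hk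
      · rw [Finset.mem_image] at *
        obtain ⟨s, hs, rfl⟩ := hi
        obtain ⟨s', hs', h⟩ := hk
        rw [LocalVar.partialProduct.injEq] at h
        exact ⟨s, hs, by rw [LocalVar.partialProduct.injEq]; omega⟩

theorem rowVars_convex {n A w : ℕ} {e : RingExpr} {v : LocalVar} (i j k : ℕ) (hij : i ≤ j)
    (hjk : j ≤ k) (hi : v ∈ e.rowVars n A w i) (hk : v ∈ e.rowVars n A w k) :
    v ∈ e.rowVars n A w j := by
  cases e with
  | var | zero | one | add => simp [rowVars] at hi
  | mul a b =>
    simp only [rowVars] at *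
    split_ifs at hi hk ⊢
    · exact hi
    simp only [Finset.mem_biUnion, Finset.mem_range] at *
    obtain ⟨l, hl, s, hs, hi⟩ := hi
    obtain ⟨l', hl', s', hs', hk⟩ := hk
    refine ⟨l, hl, s, hs, ?_⟩
    generalize min w (2 * max (a.width n) (b.width n) - 1) + 1 - max (a.width n) (b.width n) = o at *
    have h1 := tau_mono l (show i - o ≤ j - o by omega)
    have h2 := tau_mono l (show j - o ≤ k - o by omega)
    cases v with
    | treeSum l₀ i₀ j₀ =>
      simp only [treeSum_mem_treeVars] at *
      obtain ⟨rfl, rfl, hi⟩ := hi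
      obtain ⟨rfl, rfl, hk⟩ := hk
      refine ⟨rfl, rfl, ?_⟩
      simp only [NearTree] at *
      omega
    | treeCarry l₀ i₀ j₀ =>
      simp only [treeCarry_mem_treeVars] at *
      obtain ⟨rfl, rfl, hi⟩ := hi
      obtain ⟨rfl, rfl, hk⟩ := hk
      refine ⟨rfl, rfl, ?_⟩
      simp only [NearTree] at *
      omega
    | _ => simp [treeVars] at hi

/-- Variables scheduled by column and variables scheduled by row are disjoint, so an interval of one
kind never has to be joined to one of the other kind. -/
theorem colVars_rowVars {n A w : ℕ} {e : RingExpr} {v : LocalVar} {m t : ℕ}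
    (h : v ∈ e.colVars n A w m) (h' : v ∈ e.rowVars n A w t) : False := by
  cases e with
  | var | zero | one | add => simp [rowVars] at h'
  | mul a b =>
    simp only [rowVars] at h'
    split_ifs at h' with hd
    · simp at h'
    rw [not_or] at hd
    simp only [colVars, hd.1, hd.2, if_false, Finset.mem_union, Finset.mem_singleton,
      Finset.mem_image] at h
    rcases h with rfl | ⟨_, _, rfl⟩ <;> simp [treeVars] at h'

theorem localBag_convex {n A w ρ : ℕ} {e : RingExpr} {v : LocalVar} {i j k : ℕ} (hij : i ≤ j)
    (hjk : j ≤ k) (hkw : k ≤ (w + 1) / 2) (hi : v ∈ e.localBag n A w ρ i)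
    (hk : v ∈ e.localBag n A w ρ k) : v ∈ e.localBag n A w ρ j := by
  simp only [localBag, Finset.mem_union, Finset.mem_biUnion] at *
  rcases hi with (hi | hi) | hi
  · exact Or.inl (Or.inl hi)
  · rcases hk with (hk | hk) | hk
    · exact Or.inl (Or.inl hk)
    · exact Or.inl (Or.inr (exists_nearSet_of_convex colVars_convex hij hjk hkw hi hk))
    · obtain ⟨m, -, h⟩ := hi
      obtain ⟨t, -, h'⟩ := hk
      exact (colVars_rowVars h h').elim
  · rcases hk with (hk | hk) | hk
    · exact Or.inl (Or.inl hk)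
    · obtain ⟨m, -, h⟩ := hk
      obtain ⟨t, -, h'⟩ := hi
      exact (colVars_rowVars h h').elim
    · exact Or.inr (exists_nearSet_of_convex rowVars_convex hij hjk hkw hi hk)

theorem bag_convex {L R : RingExpr} {n A w ρ : ℕ} (v : Var) (i j k : ℕ) (hij : i ≤ j)
    (hjk : j ≤ k) (hkw : k < (w + 1) / 2 + 1) (hi : v ∈ bag L R n A w ρ i)
    (hk : v ∈ bag L R n A w ρ k) : v ∈ bag L R n A w ρ j := by
  rw [mem_bag] at *
  obtain ⟨q, e, he, hi⟩ := hi
  obtain ⟨q', e', he', hk⟩ := hk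
  cases v with
  | const | neq => cases e <;> simp [nodeBag] at hi
  | input x m =>
    refine ⟨q, e, he, ?_⟩
    cases e with
    | var x' =>
      cases e' with
      | var x'' =>
        simp only [nodeBag, Finset.mem_image, Var.input.injEq, exists_eq_right_right] at *
        obtain ⟨hi, rfl⟩ := hi
        obtain ⟨hk, rfl⟩ := hk
        obtain ⟨_, h, rfl⟩ := exists_nearSet_of_convex (P := (· = m))
          (fun _ _ _ h h' h₁ h₂ => by omega) hij hjk (by omega) ⟨m, hi, rfl⟩ ⟨m, hk, rfl⟩
        exact ⟨h, rfl⟩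
      | _ => simp [nodeBag] at hk
    | _ => simp [nodeBag] at hi
  | node q₀ v =>
    have hloc : ∀ {q e t}, .node q₀ v ∈ nodeBag n A w ρ q e t → q = q₀ ∧ v ∈ e.localBag n A w ρ t := by
      intro q e t h
      cases e with
      | var => simp [nodeBag] at h
      | _ =>
        simp only [nodeBag, Finset.mem_image, Var.node.injEq, exists_eq_right_right] at h
        exact ⟨h.2, h.1⟩
    obtain ⟨rfl, hi'⟩ := hloc hi
    obtain ⟨rfl, hk'⟩ := hloc hk
    obtain rfl := allNodes_unique he he'
    refine ⟨q', e, he, ?_⟩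
    have := localBag_convex hij hjk (by omega) hi' hk'
    cases e with
    | var => simp [nodeBag] at hi
    | _ =>
      simp only [nodeBag, Finset.mem_image]
      exact ⟨v, this, rfl⟩

/-! ### The size of the bags -/

theorem card_biUnion_le {α β : Type*} [DecidableEq β] {s : Finset α} {f : α → Finset β} {m c : ℕ}
    (hs : s.card ≤ m) (hf : ∀ a ∈ s, (f a).card ≤ c) : (s.biUnion f).card ≤ m * c :=
  (Finset.card_biUnion_le_card_mul s f c hf).trans (Nat.mul_le_mul_right _ hs)

theorem card_treeVars_le (B l i t : ℕ) : (treeVars B l i t).card ≤ (2 * B + 1) * 2 :=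
  card_biUnion_le (by rw [Nat.card_Icc]; omega) fun _ _ => Finset.card_le_two

theorem card_claCol_le (K m : ℕ) : (claCol K m).card ≤ (K + 1) * 12 :=
  card_biUnion_le (by simp) fun _ _ =>
    (card_biUnion_le (m := 4) (c := 3) (by simp) fun _ _ => Finset.card_le_three)

theorem card_constMulCol_le (N c : ℕ) (b : Bool) (m : ℕ) : (constMulCol N c b m).card ≤
    (Nat.clog 4 (2 * N) + 1) * 12 + (2 * c + 1) + wallaceDepth N * (4 * (4 * c + 11)) := by
  refine (Finset.card_union_le _ _).trans (add_le_add ((Finset.card_union_le _ _).trans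
    (add_le_add (card_claCol_le _ _) ?_)) ?_)
  · refine Finset.card_image_le.trans ?_
    rw [Nat.card_Icc]; omega
  · refine card_biUnion_le (by simp) fun l _ => (Finset.card_union_le _ _).trans ?_
    have h1 := card_treeVars_le (2 * c + 5) l (m - 1) (constRow b (m - 1))
    have h2 := card_treeVars_le (2 * c + 5) l m (constRow b m)
    omega

section

variable {n A w ρ P Q : ℕ}

/-- The depths of the multipliers, the width of the strip and the constants are bounded. -/
structure SizeBound (n A w P Q : ℕ) (e : RingExpr) : Prop where
  one_le : 1 ≤ P
  one_le' : 1 ≤ Q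
  strip : w + 1 ≤ A + P
  const : e.degree = 0 → e.width n ≤ Q
  mul : ∀ a b, e = .mul a b → wallaceDepth (max (a.width n) (b.width n)) ≤ P ∧
    Nat.clog 4 (2 * max (a.width n) (b.width n)) + 1 ≤ P ∧
    (a.degree = 0 → a.width n ≤ Q) ∧ (b.degree = 0 → b.width n ≤ Q)

theorem card_colVars_le {e : RingExpr} (h : SizeBound n A w P Q e) (m : ℕ) :
    (e.colVars n A w m).card ≤ 100 * (P * Q) := by
  have h1 := h.one_le
  have h2 := h.one_le'
  have h3 : P ≤ P * Q := Nat.le_mul_of_pos_right _ h2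
  have h4 : Q ≤ P * Q := Nat.le_mul_of_pos_left _ h1
  have h5 := h.strip
  cases e with
  | var | zero | one => simp [colVars]
  | add a b =>
    refine Finset.card_le_three.trans ?_
    omega
  | mul a b =>
    obtain ⟨hD, hK, ha, hb⟩ := h.mul a b rfl
    have hc : ∀ c b', c ≤ Q → (constMulCol (max (a.width n) (b.width n)) c b' m).card ≤
        12 * P + (2 * Q + 1) + (16 * (P * Q) + 44 * P) := by
      intro c b' hc
      refine (card_constMulCol_le _ _ _ _).trans (add_le_add (by omega) ?_)
      calc _ ≤ P * (4 * (4 * Q + 11)) := Nat.mul_le_mul hD (by omega)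
        _ = _ := by ring
    refine (Finset.card_union_le _ _).trans ?_
    rw [Finset.card_singleton]
    split_ifs with h6 h7
    · have := hc _ true (ha h6)
      omega
    · have := hc _ false (hb h7)
      omega
    · have := Finset.card_image_le (s := Finset.Icc (A - wallaceDepth (max (a.width n) (b.width n))) w)
        (f := fun i => LocalVar.partialProduct i m)
      rw [Nat.card_Icc] at this
      omega

/-- The number of layers and the number of columns of the window are both logarithmic, with
boundedly many adders for each pair. This and the permanent lookahead bits make the bags quadratic
in the logarithm. -/
theorem card_rowVars_le {e : RingExpr} (h : SizeBound n A w P Q e) (t : ℕ) :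
    (e.rowVars n A w t).card ≤ 36 * (P * P) := by
  have h5 := h.strip
  cases e with
  | var | zero | one | add => simp [rowVars]
  | mul a b =>
    obtain ⟨hD, hK, ha, hb⟩ := h.mul a b rfl
    simp only [rowVars]
    split_ifs
    · simp
    refine (card_biUnion_le (m := P) (c := 2 * P * 18) (by simpa using hD) fun l _ =>
      card_biUnion_le (by rw [Nat.card_Icc]; omega) fun i _ => card_treeVars_le _ _ _ _).trans ?_
    apply le_of_eq; ring

theorem card_permVars_le {e : RingExpr} (h : SizeBound n A w P Q e) :
    (e.permVars n A w).card ≤ 100 * (P * Q * Q) + (12 * (P * P) + 1) := by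
  have h5 := h.strip
  refine (Finset.card_union_le _ _).trans (add_le_add ?_ ?_)
  · split_ifs with h0
    · refine (card_biUnion_le (m := Q) (by simpa using h.const h0) fun m _ =>
        card_colVars_le h m).trans (le_of_eq (by ring))
    · simp
  · cases e with
    | var | zero | one | add => simp
    | mul a b =>
      obtain ⟨hD, hK, ha, hb⟩ := h.mul a b rfl
      dsimp only
      split_ifs
      · simp
      · refine (Finset.card_insert_le _ _).trans (Nat.succ_le_succ ?_)
        refine (card_biUnion_le (m := P) (c := P * 12) (by rw [Nat.card_Icc]; omega) fun m _ =>
          (card_claCol_le _ m).trans ?_).trans (le_of_eq (by ring))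
        exact Nat.mul_le_mul_right _ hK

theorem card_nodeBag_le {e : RingExpr} (h : SizeBound n A w P Q e) (hρ : ρ ≤ P) (q : List Bool)
    (t : ℕ) : (nodeBag n A w ρ q e t).card ≤ 1000 * (P * Q) ^ 2 := by
  have h1 := h.one_le
  have h2 := h.one_le'
  have e1 : P * Q ≤ (P * Q) ^ 2 := Nat.le_self_pow two_ne_zero _
  have e2 : P ≤ P * Q := Nat.le_mul_of_pos_right _ h2
  have e3 : P * P ≤ (P * Q) ^ 2 := by rw [sq]; exact Nat.mul_le_mul e2 e2
  have e4 : P * Q * Q ≤ (P * Q) ^ 2 := by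
    rw [sq]; exact Nat.mul_le_mul_left _ (Nat.le_mul_of_pos_left _ h1)
  have hloc : (e.localBag n A w ρ t).card ≤ 1000 * (P * Q) ^ 2 := by
    refine (Finset.card_union_le _ _).trans ((add_le_add ((Finset.card_union_le _ _).trans
      (add_le_add (card_permVars_le h) (card_biUnion_le (card_nearSet_le _ _ _) fun m _ =>
        card_colVars_le h m))) (card_biUnion_le (card_nearSet_le _ _ _) fun m _ =>
        card_rowVars_le h m)).trans ?_)
    have e5 : (4 * ρ + 2) * (100 * (P * Q)) ≤ 600 * (P * Q) ^ 2 := by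
      calc _ ≤ (6 * (P * Q)) * (100 * (P * Q)) := Nat.mul_le_mul_right _ (by omega)
        _ = _ := by ring
    omega
  cases e with
  | var x =>
    refine Finset.card_image_le.trans ((card_nearSet_le _ _ _).trans ?_)
    omega
  | _ => exact Finset.card_image_le.trans hloc

theorem card_bag_le {L R : RingExpr} (h : ∀ x ∈ allNodes L R, SizeBound n A w P Q x.2) (hρ : ρ ≤ P)
    (t : ℕ) : (bag L R n A w ρ t).card ≤ (allNodes L R).length * (1000 * (P * Q) ^ 2) := by
  classical
  refine card_biUnion_le (List.toFinset_card_le _) fun x hx => ?_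
  exact card_nodeBag_le (h x (List.mem_toFinset.1 hx)) hρ _ _

end

/-! ### The gates of a node -/

theorem StripGate.mem {p : List Bool} {N : ℕ} {x y : ℕ → Var} {A w : ℕ} {g : Gate}
    (h : StripGate p N x y A w g) : g ∈ wallaceMultiplier p N x y := by
  have hN : ∀ i, i < 2 * N → i < 4 ^ Nat.clog 4 (2 * N) := fun i hi =>
    hi.trans_le (Nat.le_pow_clog (by norm_num) _)
  rw [wallaceMultiplier, List.mem_append, List.mem_append]
  cases h with
  | pp i j h1 h2 h3 h4 h5 h6 =>
    refine Or.inl (Or.inl (List.mem_flatMap.2 ⟨i, List.mem_range.2 h3, List.mem_map.2 ⟨j, ?_, rfl⟩⟩))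
    exact List.mem_filter.2 ⟨List.mem_range.2 h4, by simp [h5, h6]⟩
  | sum l i j h1 h2 h3 h4 h5 | carry l i j h1 h2 h3 h4 h5 =>
    refine Or.inl (Or.inr (List.mem_flatMap.2 ⟨l, List.mem_range.2 h1, List.mem_flatMap.2
      ⟨i, List.mem_range.2 h4, List.mem_flatMap.2 ⟨j, List.mem_range.2 (by omega), ?_⟩⟩⟩))
    simp [adder]
  | carryIn => exact Or.inr (by simp [carryLookahead])
  | gen i h1 h2 h3 | prop i h1 h2 h3 | out i h1 h2 h3 =>
    refine Or.inr (List.mem_append_left _ (List.mem_append_right _ (List.mem_flatMap.2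
      ⟨i, List.mem_range.2 (hN i h3), ?_⟩)))
    simp [h3]
  | block l i g h1 h2 h3 h4 h5 =>
    refine Or.inr (List.mem_append_right _ (List.mem_flatMap.2
      ⟨l, List.mem_range.2 h1, List.mem_flatMap.2 ⟨i / 4 ^ (l + 1), List.mem_range.2 ?_, h5⟩⟩))
    rw [Nat.div_lt_iff_lt_mul (by positivity), ← pow_add]
    convert hN i h4 using 2
    omega

namespace RingExpr

theorem children_mem_nodes {e : RingExpr} {p q : List Bool} {a b : RingExpr}
    (h : (q, add a b) ∈ e.nodes p ∨ (q, mul a b) ∈ e.nodes p) :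
    (false :: q, a) ∈ e.nodes p ∧ (true :: q, b) ∈ e.nodes p := by
  induction e generalizing p with
  | var | zero | one => simp [nodes] at h
  | add a' b' iha ihb | mul a' b' iha ihb =>
    simp only [nodes, List.mem_cons, List.mem_append, Prod.mk.injEq, add.injEq, mul.injEq,
      reduceCtorEq, and_false, false_or] at h ⊢
    have h1 := @iha (false :: p)
    have h2 := @ihb (true :: p)
    have h3 := self_mem_nodes a' (false :: p)
    have h4 := self_mem_nodes b' (true :: p)
    rcases h with h | h
    · first
      | (rcases h with ⟨rfl, rfl, rfl⟩ | h | h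
         · exact ⟨Or.inr (Or.inl h3), Or.inr (Or.inr h4)⟩
         · exact ⟨Or.inr (Or.inl (h1 (.inl h)).1), Or.inr (Or.inl (h1 (.inl h)).2)⟩
         · exact ⟨Or.inr (Or.inr (h2 (.inl h)).1), Or.inr (Or.inr (h2 (.inl h)).2)⟩)
      | (rcases h with h | h
         · exact ⟨Or.inr (Or.inl (h1 (.inl h)).1), Or.inr (Or.inl (h1 (.inl h)).2)⟩
         · exact ⟨Or.inr (Or.inr (h2 (.inl h)).1), Or.inr (Or.inr (h2 (.inl h)).2)⟩)
    · first
      | (rcases h with ⟨rfl, rfl, rfl⟩ | h | h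
         · exact ⟨Or.inr (Or.inl h3), Or.inr (Or.inr h4)⟩
         · exact ⟨Or.inr (Or.inl (h1 (.inr h)).1), Or.inr (Or.inl (h1 (.inr h)).2)⟩
         · exact ⟨Or.inr (Or.inr (h2 (.inr h)).1), Or.inr (Or.inr (h2 (.inr h)).2)⟩)
      | (rcases h with h | h
         · exact ⟨Or.inr (Or.inl (h1 (.inr h)).1), Or.inr (Or.inl (h1 (.inr h)).2)⟩
         · exact ⟨Or.inr (Or.inr (h2 (.inr h)).1), Or.inr (Or.inr (h2 (.inr h)).2)⟩)

theorem rippleCarry_subset_circuit {e : RingExpr} {n : ℕ} {p q : List Bool} {a b : RingExpr}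
    (h : (q, add a b) ∈ e.nodes p) : rippleCarry q (max (a.width n) (b.width n))
      (a.bit n (false :: q)) (b.bit n (true :: q)) ⊆ e.circuit n p := by
  induction e generalizing p with
  | var | zero | one => simp [nodes] at h
  | add a' b' iha ihb =>
    simp only [nodes, List.mem_cons, List.mem_append, Prod.mk.injEq, add.injEq] at h
    intro g hg
    rw [circuit, List.mem_append, List.mem_append]
    rcases h with ⟨rfl, rfl, rfl⟩ | h | h
    · exact Or.inr hg
    · exact Or.inl (Or.inl (iha h hg))
    · exact Or.inl (Or.inr (ihb h hg))
  | mul a' b' iha ihb =>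
    simp only [nodes, List.mem_cons, List.mem_append, Prod.mk.injEq, reduceCtorEq, and_false,
      false_or] at h
    intro g hg
    rw [circuit, List.mem_append, List.mem_append]
    rcases h with h | h
    · exact Or.inl (Or.inl (iha h hg))
    · exact Or.inl (Or.inr (ihb h hg))

theorem wallaceMultiplier_subset_circuit {e : RingExpr} {n : ℕ} {p q : List Bool} {a b : RingExpr}
    (h : (q, mul a b) ∈ e.nodes p) : wallaceMultiplier q (max (a.width n) (b.width n))
      (a.bit n (false :: q)) (b.bit n (true :: q)) ⊆ e.circuit n p := by
  induction e generalizing p with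
  | var | zero | one => simp [nodes] at h
  | mul a' b' iha ihb =>
    simp only [nodes, List.mem_cons, List.mem_append, Prod.mk.injEq, mul.injEq] at h
    intro g hg
    rw [circuit, List.mem_append, List.mem_append]
    rcases h with ⟨rfl, rfl, rfl⟩ | h | h
    · exact Or.inr hg
    · exact Or.inl (Or.inl (iha h hg))
    · exact Or.inl (Or.inr (ihb h hg))
  | add a' b' iha ihb =>
    simp only [nodes, List.mem_cons, List.mem_append, Prod.mk.injEq, reduceCtorEq, and_false,
      false_or] at h
    intro g hg
    rw [circuit, List.mem_append, List.mem_append]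
    rcases h with h | h
    · exact Or.inl (Or.inl (iha h hg))
    · exact Or.inl (Or.inr (ihb h hg))

end RingExpr

section

variable {L R : RingExpr} {n : ℕ}

theorem children_mem_allNodes {q : List Bool} {a b : RingExpr}
    (h : (q, add a b) ∈ allNodes L R ∨ (q, mul a b) ∈ allNodes L R) :
    (false :: q, a) ∈ allNodes L R ∧ (true :: q, b) ∈ allNodes L R := by
  simp only [allNodes, List.mem_append] at *
  have h1 := @children_mem_nodes L [false] q a b
  have h2 := @children_mem_nodes R [true] q a b
  tauto

theorem rippleCarry_subset {q : List Bool} {a b : RingExpr} (h : (q, add a b) ∈ allNodes L R) :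
    rippleCarry q (max (a.width n) (b.width n)) (a.bit n (false :: q)) (b.bit n (true :: q)) ⊆
      instanceGates L R n := by
  intro g hg
  rw [instanceGates, List.mem_append, List.mem_append]
  rcases List.mem_append.1 h with h | h
  · exact Or.inl (Or.inl (rippleCarry_subset_circuit h hg))
  · exact Or.inl (Or.inr (rippleCarry_subset_circuit h hg))

theorem wallaceMultiplier_subset {q : List Bool} {a b : RingExpr} (h : (q, mul a b) ∈ allNodes L R) :
    wallaceMultiplier q (max (a.width n) (b.width n)) (a.bit n (false :: q))
      (b.bit n (true :: q)) ⊆ instanceGates L R n := by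
  intro g hg
  rw [instanceGates, List.mem_append, List.mem_append]
  rcases List.mem_append.1 h with h | h
  · exact Or.inl (Or.inl (wallaceMultiplier_subset_circuit h hg))
  · exact Or.inl (Or.inr (wallaceMultiplier_subset_circuit h hg))

end

/-! ### Multiplication by a constant -/

/-- The variables that are `0` in a multiplication by a constant of width `c` since they are not
close to its partial products. -/
def Far (N c : ℕ) (b : Bool) : LocalVar → Prop
  | .partialProduct i j => i < 2 * N ∧ j < N ∧ j ≤ i ∧ i < j + N ∧ ¬ NearRow c (constRow b i) j
  | .treeSum l i j | .treeCarry l i j => l < wallaceDepth N ∧ i < 2 * N ∧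
      3 * j < (wallaceCol N l i).length ∧ ¬ NearTree (2 * c + 5) l (constRow b i) j
  | _ => False

/-- Going from an adder to the adders that feed it scales the distance from the aligned row by 3/2,
which outweighs rounding beyond the radius `2 * c + 5`. So being far is inherited down to layer 0,
where a far partial product contains a padding bit of the constant. -/
theorem far_input {N c : ℕ} {b : Bool} {l i j s : ℕ} (hl : l < wallaceDepth N) (hi : i < 2 * N)
    (hfar : ¬ NearTree (2 * c + 5) l (constRow b i) j) (hs : s < 3) {v : LocalVar}
    (hv : (wallaceCol N l i)[3 * j + s]? = some v) : Far N c b v := by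
  cases l with
  | zero =>
    obtain ⟨rfl, h1, h2⟩ := getElem?_wallaceCol_zero hv
    refine ⟨hi, h1, h2, by omega, ?_⟩
    cases b <;> simp only [NearTree, NearRow, constRow, tau, if_true, Bool.false_eq_true, if_false]
      at * <;> omega
  | succ l =>
    rcases getElem?_wallaceCol_succ hv with ⟨j', rfl, h1, h2⟩ | ⟨j', rfl, h0, h1, h2⟩
    · refine ⟨by omega, hi, h2, ?_⟩
      simp only [NearTree, tau] at *
      omega
    · refine ⟨by omega, by omega, by omega, ?_⟩
      have h3 : tau l (constRow b i) ≤ tau l (constRow b (i - 1)) + 2 ∧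
          tau l (constRow b (i - 1)) ≤ tau l (constRow b i) := by
        cases b
        · simp [constRow]
        · have := tau_succ_le l (i - 1)
          rw [Nat.sub_add_cancel h0] at this
          exact ⟨this, tau_mono l (Nat.sub_le _ _)⟩
      simp only [NearTree, tau] at *
      omega

theorem mem_constMulCol_or_far {N c : ℕ} {b : Bool} {l i s : ℕ} (hl : l ≤ wallaceDepth N)
    (hi : i < 2 * N) {v : LocalVar} (hv : (wallaceCol N l i)[s]? = some v) :
    v ∈ constMulCol N c b i ∨ Far N c b v := by
  simp only [constMulCol, Finset.mem_union, Finset.mem_image, Finset.mem_biUnion,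
    Finset.mem_range, Finset.mem_Icc]
  cases l with
  | zero =>
    obtain ⟨rfl, h1, h2⟩ := getElem?_wallaceCol_zero hv
    by_cases h : NearRow c (constRow b i) (s + (i + 1 - N))
    · exact Or.inl (Or.inl (Or.inr ⟨_, by simp only [NearRow] at h; omega, rfl⟩))
    · exact Or.inr ⟨hi, h1, h2, by omega, h⟩
  | succ l =>
    rcases getElem?_wallaceCol_succ hv with ⟨j', rfl, h1, h2⟩ | ⟨j', rfl, h0, h1, h2⟩
    · by_cases h : NearTree (2 * c + 5) l (constRow b i) j'
      · exact Or.inl (Or.inr ⟨l, hl, Or.inr (treeSum_mem_treeVars.2 ⟨rfl, rfl, h⟩)⟩)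
      · exact Or.inr ⟨hl, hi, h2, h⟩
    · by_cases h : NearTree (2 * c + 5) l (constRow b (i - 1)) j'
      · exact Or.inl (Or.inr ⟨l, hl, Or.inl (treeCarry_mem_treeVars.2 ⟨rfl, rfl, h⟩)⟩)
      · exact Or.inr ⟨hl, by omega, by omega, h⟩

theorem claGen_mem_claCol {K l i s : ℕ} (hl : l ≤ K) (hs : s < 4) :
    LocalVar.claGen l (4 * (i / 4 ^ (l + 1)) + s) ∈ claCol K i :=
  mem_claCol.2 ⟨l, hl, s, hs, Or.inl rfl⟩

theorem claProp_mem_claCol {K l i s : ℕ} (hl : l ≤ K) (hs : s < 4) :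
    LocalVar.claProp l (4 * (i / 4 ^ (l + 1)) + s) ∈ claCol K i :=
  mem_claCol.2 ⟨l, hl, s, hs, Or.inr (Or.inl rfl)⟩

theorem claCarry_mem_claCol {K l i s : ℕ} (hl : l ≤ K) (hs : s < 4) :
    LocalVar.claCarry ((4 * (i / 4 ^ (l + 1)) + s) * 4 ^ l) ∈ claCol K i :=
  mem_claCol.2 ⟨l, hl, s, hs, Or.inr (Or.inr rfl)⟩

theorem column_mem_claCol (K i : ℕ) : LocalVar.claGen 0 i ∈ claCol K i ∧
    LocalVar.claProp 0 i ∈ claCol K i ∧ LocalVar.claCarry i ∈ claCol K i := by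
  have e : 4 * (i / 4 ^ (0 + 1)) + i % 4 = i := by simp; omega
  have hs : i % 4 < 4 := Nat.mod_lt _ (by norm_num)
  have h1 := claGen_mem_claCol (i := i) (Nat.zero_le K) hs
  have h2 := claProp_mem_claCol (i := i) (Nat.zero_le K) hs
  have h3 := claCarry_mem_claCol (i := i) (Nat.zero_le K) hs
  rw [e] at h1 h2 h3
  exact ⟨h1, h2, by simpa using h3⟩

theorem mem_claCol_of_mem_blockGates {p : List Bool} {K l i : ℕ} {g : Gate} (hl : l < K)
    (hg : g ∈ blockGates p l (i / 4 ^ (l + 1))) {v : Var} (hv : v = g.out ∨ v ∈ g.ins) :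
    ∃ u ∈ claCol K i, v = .node p u := by
  have hq : 4 * (i / 4 ^ (l + 1 + 1)) + i / 4 ^ (l + 1) % 4 = i / 4 ^ (l + 1) := by
    rw [pow_succ 4 (l + 1), ← Nat.div_div_eq_div_mul]
    omega
  have hs : i / 4 ^ (l + 1) % 4 < 4 := Nat.mod_lt _ (by norm_num)
  have g1 := claGen_mem_claCol (i := i) (show l + 1 ≤ K from hl) hs
  have r1 := claProp_mem_claCol (i := i) (show l + 1 ≤ K from hl) hs
  rw [hq] at g1 r1
  have hg0 := fun s hs => claGen_mem_claCol (s := s) (i := i) hl.le hs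
  have hr0 := fun s hs => claProp_mem_claCol (s := s) (i := i) hl.le hs
  have hc0 := fun s hs => claCarry_mem_claCol (s := s) (i := i) hl.le hs
  have hg00 := hg0 0 (by norm_num)
  have hr00 := hr0 0 (by norm_num)
  have hc00 := hc0 0 (by norm_num)
  rw [add_zero] at hg00 hr00 hc00
  have hg01 := hg0 1 (by norm_num)
  have hr01 := hr0 1 (by norm_num)
  have hc01 := hc0 1 (by norm_num)
  have hg02 := hg0 2 (by norm_num)
  have hr02 := hr0 2 (by norm_num)
  have hc02 := hc0 2 (by norm_num)
  have hg03 := hg0 3 (by norm_num)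
  have hr03 := hr0 3 (by norm_num)
  have hc03 := hc0 3 (by norm_num)
  simp only [blockGates, List.mem_cons, List.not_mem_nil, or_false] at hg
  rcases hg with rfl | rfl | rfl | rfl | rfl <;>
    simp only [List.mem_cons, List.not_mem_nil, or_false] at hv
  · rcases hv with rfl | rfl | rfl | rfl | rfl <;> exact ⟨_, by assumption, rfl⟩
  · rcases hv with rfl | rfl | rfl | rfl | rfl | rfl | rfl | rfl <;> exact ⟨_, by assumption, rfl⟩
  · rcases hv with rfl | rfl | rfl | rfl <;> exact ⟨_, by assumption, rfl⟩
  · rcases hv with rfl | rfl | rfl | rfl | rfl | rfl <;> exact ⟨_, by assumption, rfl⟩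
  · rcases hv with rfl | rfl | rfl | rfl | rfl | rfl | rfl | rfl <;> exact ⟨_, by assumption, rfl⟩

section ConstMul

variable {α : Var → Bool} {q : List Bool} {N c w : ℕ} {b : Bool} {x y : ℕ → Var}
  {F : ℕ → Var → Prop}

theorem wallaceBit_cases {l i s : ℕ} {P : Var → Prop} (h0 : P (.const false))
    (h : ∀ v, (wallaceCol N l i)[s]? = some v → P (.node q v)) : P (wallaceBit q N l i s) := by
  rw [wallaceBit]
  rcases hv : (wallaceCol N l i)[s]? with _ | v
  · exact h0
  · exact h v hv

/-- A gate near the constant has all its variables available at the folded time of its column. A far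
gate holds without this: its output is false, and so are all its inputs (or one of the two, for a
partial product). -/
theorem holds_of_constMul
    (hfit : ∀ g, StripGate q N x y 0 w g → (∃ t ≤ (w + 1) / 2, ∀ v, v = g.out ∨ v ∈ g.ins → F t v) →
      g.Holds α)
    (hF0 : ∀ t, F t (.const false)) (hα0 : α (.const false) = false)
    (hcol : ∀ i ≤ w, ∀ v, v = .claOut i ∨ v ∈ constMulCol N c b i → F (foldTime (w + 1) i) (.node q v))
    (hfar : ∀ v, Far N c b v → (∀ t, F t (.node q v)) ∧ α (.node q v) = false)
    (hop : ∀ i j, i ≤ w → j ≤ i → NearRow c (constRow b i) j →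
      F (foldTime (w + 1) i) (x (i - j)) ∧ F (foldTime (w + 1) i) (y j))
    (hop' : ∀ i j, j ≤ i → ¬ NearRow c (constRow b i) j →
      x (i - j) = .const false ∨ y j = .const false) {g : Gate} (hg : StripGate q N x y 0 w g) :
    g.Holds α := by
  have hbit : ∀ l i s, l ≤ wallaceDepth N → i ≤ w → i < 2 * N →
      F (foldTime (w + 1) i) (wallaceBit q N l i s) := by
    intro l i s hl hi hN
    refine wallaceBit_cases (hF0 _) fun v hv => ?_
    rcases mem_constMulCol_or_far (c := c) (b := b) hl hN hv with h | h
    · exact hcol i hi v (Or.inr h)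
    · exact (hfar v h).1 _
  have hcla : ∀ i ≤ w, ∀ v ∈ claCol (Nat.clog 4 (2 * N)) i, F (foldTime (w + 1) i) (.node q v) :=
    fun i hi v hv => hcol i hi v (Or.inr (Finset.mem_union_left _ (Finset.mem_union_left _ hv)))
  have hfarbit : ∀ l i j s, l < wallaceDepth N → i < 2 * N →
      ¬ NearTree (2 * c + 5) l (constRow b i) j → s < 3 →
      α (wallaceBit q N l i (3 * j + s)) = false := by
    intro l i j s hl hi h hs
    exact wallaceBit_cases (P := fun v => α v = false) hα0 fun v hv =>
      (hfar v (far_input hl hi h hs hv)).2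
  have hadder : ∀ l i j, l < wallaceDepth N → i ≤ w → i < 2 * N →
      3 * j < (wallaceCol N l i).length → ∀ v ∈ [LocalVar.treeSum l i j, .treeCarry l i j],
      F (foldTime (w + 1) i) (.node q v) := by
    intro l i j hl hi hN hlen v hv
    have hv' : v = .treeSum l i j ∨ v = .treeCarry l i j := by simpa using hv
    by_cases h : NearTree (2 * c + 5) l (constRow b i) j
    · refine hcol i hi v (Or.inr (Finset.mem_union_right _ (Finset.mem_biUnion.2
        ⟨l, Finset.mem_range.2 hl, Finset.mem_union_right _ ?_⟩)))
      rcases hv' with rfl | rfl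
      · exact treeSum_mem_treeVars.2 ⟨rfl, rfl, h⟩
      · exact treeCarry_mem_treeVars.2 ⟨rfl, rfl, h⟩
    · refine (hfar v ?_).1 _
      rcases hv' with rfl | rfl <;> exact ⟨hl, hN, hlen, h⟩
  have hft := hfit g hg
  cases hg with
  | pp i j h1 h2 h3 h4 h5 h6 =>
    by_cases h : NearRow c (constRow b i) j
    · refine hft ⟨_, foldTime_le _ i, fun v hv => ?_⟩
      simp only [List.mem_cons, List.not_mem_nil, or_false] at hv
      rcases hv with rfl | rfl | rfl
      · refine hcol i h2 _ (Or.inr (Finset.mem_union_left _ (Finset.mem_union_right _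
          (Finset.mem_image.2 ⟨j, ?_, rfl⟩))))
        rw [Finset.mem_Icc]
        simp only [NearRow] at h
        omega
      · exact (hop i j h2 h5 h).1
      · exact (hop i j h2 h5 h).2
    · have := (hfar (.partialProduct i j) ⟨h3, h4, h5, h6, h⟩).2
      simp only [Gate.Holds, this, List.map_cons, List.map_nil, conj_two]
      rcases hop' i j h5 h with h | h <;> simp [h, hα0]
  | sum l i j h1 h2 h3 h4 h5 =>
    by_cases h : NearTree (2 * c + 5) l (constRow b i) j
    · refine hft ⟨_, foldTime_le _ i, fun v hv => ?_⟩
      simp only [List.mem_cons, List.not_mem_nil, or_false] at hv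
      rcases hv with rfl | rfl | rfl | rfl
      · exact hadder l i j h1 h3 h4 h5 _ (by simp)
      all_goals exact hbit _ _ _ h1.le h3 h4
    · have := (hfar (.treeSum l i j) ⟨h1, h4, h5, h⟩).2
      have e0 := hfarbit l i j 0 h1 h4 h (by norm_num)
      rw [add_zero] at e0
      simp only [Gate.Holds, this, List.map_cons, List.map_nil, e0,
        hfarbit l i j 1 h1 h4 h (by norm_num), hfarbit l i j 2 h1 h4 h (by norm_num)]
      rfl
  | carry l i j h1 h2 h3 h4 h5 =>
    by_cases h : NearTree (2 * c + 5) l (constRow b i) j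
    · refine hft ⟨_, foldTime_le _ i, fun v hv => ?_⟩
      simp only [List.mem_cons, List.not_mem_nil, or_false] at hv
      rcases hv with rfl | rfl | rfl | rfl
      · exact hadder l i j h1 h3 h4 h5 _ (by simp)
      all_goals exact hbit _ _ _ h1.le h3 h4
    · have := (hfar (.treeCarry l i j) ⟨h1, h4, h5, h⟩).2
      have e0 := hfarbit l i j 0 h1 h4 h (by norm_num)
      rw [add_zero] at e0
      simp only [Gate.Holds, this, List.map_cons, List.map_nil, e0,
        hfarbit l i j 1 h1 h4 h (by norm_num), hfarbit l i j 2 h1 h4 h (by norm_num)]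
      rfl
  | carryIn =>
    refine hft ⟨_, foldTime_le _ 0, fun v hv => ?_⟩
    simp only [List.mem_cons, List.not_mem_nil, or_false] at hv
    rcases hv with rfl | rfl
    · exact hcla 0 (Nat.zero_le _) _ (column_mem_claCol _ 0).2.2
    · exact hF0 _
  | gen i h1 h2 h3 =>
    refine hft ⟨_, foldTime_le _ i, fun v hv => ?_⟩
    simp only [List.mem_cons, List.not_mem_nil, or_false] at hv
    rcases hv with rfl | rfl | rfl
    · exact hcla i h2 _ (column_mem_claCol _ i).1
    all_goals exact hbit _ _ _ le_rfl h2 h3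
  | prop i h1 h2 h3 =>
    refine hft ⟨_, foldTime_le _ i, fun v hv => ?_⟩
    simp only [List.mem_cons, List.not_mem_nil, or_false] at hv
    rcases hv with rfl | rfl | rfl
    · exact hcla i h2 _ (column_mem_claCol _ i).2.1
    all_goals exact hbit _ _ _ le_rfl h2 h3
  | out i h1 h2 h3 =>
    refine hft ⟨_, foldTime_le _ i, fun v hv => ?_⟩
    simp only [List.mem_cons, List.not_mem_nil, or_false] at hv
    rcases hv with rfl | rfl | rfl | rfl
    · exact hcol i h2 _ (Or.inl rfl)
    · exact hcla i h2 _ (column_mem_claCol _ i).2.2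
    all_goals exact hbit _ _ _ le_rfl h2 h3
  | block l i g h1 h2 h3 h4 h5 =>
    refine hft ⟨_, foldTime_le _ i, fun v hv => ?_⟩
    obtain ⟨u, hu, rfl⟩ := mem_claCol_of_mem_blockGates h1 h5 hv
    exact hcla i h3 u hu

end ConstMul

/-! ### Products of two linear expressions -/

theorem foldTime_mem_nearSet {ρ W m k : ℕ} (hm : m ≤ W)
    (h : (k ≤ m + ρ ∧ m ≤ k + ρ) ∨ (k + m ≤ W + ρ ∧ W ≤ k + m + ρ)) :
    k ∈ nearSet ρ W (foldTime W m) := by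
  rw [mem_nearSet (by rw [foldTime]; omega), foldTime]
  omega

section Prod

variable {α : Var → Bool} {q : List Bool} {N A w ρ : ℕ} {x y : ℕ → Var} {F : ℕ → Var → Prop}

/-- Each gate finds its time. A partial product of row `j` gets the time of `j`, since its other
operand bit `i - j` is near `w + 1 - j`. An adder of the tree gets the time of the row it is aligned
with. All lookahead gates get time 0, when the entries of the last two rows are in the bag. -/
theorem holds_of_prod (hAw : A ≤ w) (hρ : w + wallaceDepth N + 7 ≤ A + ρ)
    (hfit : ∀ g, StripGate q N x y A w g → (∃ t ≤ (w + 1) / 2, ∀ v, v = g.out ∨ v ∈ g.ins → F t v) →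
      g.Holds α)
    (hF0 : ∀ t, F t (.const false))
    (hout : ∀ t, ∀ m ∈ nearSet ρ (w + 1) t, F t (.node q (.claOut m)))
    (hpp : ∀ t, ∀ m ∈ nearSet ρ (w + 1) t, ∀ i, A ≤ i + wallaceDepth N → i ≤ w →
      F t (.node q (.partialProduct i m)))
    (hrow : ∀ t, ∀ m ∈ nearSet 0 (w + 1) t, ∀ l < wallaceDepth N, ∀ i, A ≤ i + wallaceDepth N →
      i ≤ w → ∀ v ∈ treeVars 4 l i (m - (min w (2 * N - 1) + 1 - N)), F t (.node q v))
    (hc0 : ∀ t, F t (.node q (.claCarry 0)))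
    (hcla : ∀ t i, A ≤ i → i ≤ w → ∀ v ∈ claCol (Nat.clog 4 (2 * N)) i, F t (.node q v))
    (hop : ∀ t, ∀ m ∈ nearSet ρ (w + 1) t, F t (x m) ∧ F t (y m))
    {g : Gate} (hg : StripGate q N x y A w g) : g.Holds α := by
  have hbit0 : ∀ i s, s < 2 → A ≤ i → i ≤ w → i < 2 * N →
      F 0 (wallaceBit q N (wallaceDepth N) i s) := by
    intro i s hs hA hw hN
    refine wallaceBit_cases (hF0 _) fun v hv => ?_
    rcases hD : wallaceDepth N with _ | l
    -- Column `N - 1` of layer 0 has `N` entries, so a tree without layers has `N ≤ 2`.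
    · have hlen := length_wallaceCol_wallaceDepth N (N - 1) (by omega)
      rw [hD] at hv hlen
      rw [wallaceCol_zero, List.length_map, List.length_range'] at hlen
      obtain ⟨rfl, h1, h2⟩ := getElem?_wallaceCol_zero hv
      exact hpp 0 _ ((mem_nearSet (Nat.zero_le _)).2 (by omega)) i (by omega) hw
    · rw [hD] at hv
      have h0 : 0 ∈ nearSet 0 (w + 1) 0 := (mem_nearSet (Nat.zero_le _)).2 (by omega)
      rcases getElem?_wallaceCol_succ hv with ⟨j', rfl, h1, h2⟩ | ⟨j', rfl, h3, h1, h2⟩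
      · refine hrow 0 0 h0 l (by omega) i (by omega) hw _ (treeSum_mem_treeVars.2 ⟨rfl, rfl, ?_⟩)
        rw [Nat.zero_sub, NearTree, tau_zero]
        omega
      · refine hrow 0 0 h0 l (by omega) (i - 1) (by omega) (by omega) _
          (treeCarry_mem_treeVars.2 ⟨rfl, rfl, ?_⟩)
        rw [Nat.zero_sub, NearTree, tau_zero]
        omega
  have hadder : ∀ l i j, l < wallaceDepth N → A + l ≤ i + wallaceDepth N → i ≤ w → i < 2 * N →
      3 * j < (wallaceCol N l i).length → ∃ t ≤ (w + 1) / 2, F t (.node q (.treeSum l i j)) ∧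
        F t (.node q (.treeCarry l i j)) ∧ ∀ s < 3, F t (wallaceBit q N l i (3 * j + s)) := by
    intro l i j hl hA hw hN hj
    set o := min w (2 * N - 1) + 1 - N with ho
    have hlen : (wallaceCol N l i).length ≤ tau l (w + 1 - o) + 4 := by
      refine length_wallaceCol_le_tau N _ l i fun i' h1 h2 => ?_
      rw [wallaceCol_zero, List.length_map, List.length_range']
      omega
    -- `pos` is the row of layer 0 that is aligned with the first input of the adder, counted from
    -- the offset `o`.
    obtain ⟨pos, hpos, h1, h2⟩ := exists_tau_eq l (3 * j) (w + 1 - o) (by omega)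
    have hm : o + pos ∈ nearSet 0 (w + 1) (foldTime (w + 1) (o + pos)) :=
      foldTime_mem_nearSet (by omega) (by omega)
    have hsub : o + pos - o = pos := Nat.add_sub_cancel_left _ _
    have hnear : NearTree 4 l (o + pos - o) j := by
      rw [hsub, NearTree]
      omega
    refine ⟨_, foldTime_le _ (o + pos),
      hrow _ _ hm l hl i (by omega) hw _ (treeSum_mem_treeVars.2 ⟨rfl, rfl, hnear⟩),
      hrow _ _ hm l hl i (by omega) hw _ (treeCarry_mem_treeVars.2 ⟨rfl, rfl, hnear⟩), ?_⟩
    intro s hs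
    refine wallaceBit_cases (hF0 _) fun v hv => ?_
    cases l with
    | zero =>
      obtain ⟨rfl, h3, h4⟩ := getElem?_wallaceCol_zero hv
      refine hpp _ _ (foldTime_mem_nearSet (by omega) (Or.inl ?_)) i (by omega) hw
      simp only [tau] at h1 h2
      omega
    | succ l =>
      simp only [tau] at h1 h2
      rcases getElem?_wallaceCol_succ hv with ⟨j', rfl, h3, h4⟩ | ⟨j', rfl, h0, h3, h4⟩
      · refine hrow _ _ hm l (by omega) i (by omega) hw _ (treeSum_mem_treeVars.2 ⟨rfl, rfl, ?_⟩)
        rw [hsub, NearTree]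
        omega
      · refine hrow _ _ hm l (by omega) (i - 1) (by omega) (by omega) _
          (treeCarry_mem_treeVars.2 ⟨rfl, rfl, ?_⟩)
        rw [hsub, NearTree]
        omega
  have hft := hfit g hg
  cases hg with
  | pp i j h1 h2 h3 h4 h5 h6 =>
    refine hft ⟨_, foldTime_le _ j, fun v hv => ?_⟩
    simp only [List.mem_cons, List.not_mem_nil, or_false] at hv
    have hj : j ∈ nearSet ρ (w + 1) (foldTime (w + 1) j) :=
      foldTime_mem_nearSet (by omega) (by omega)
    rcases hv with rfl | rfl | rfl
    · exact hpp _ j hj i h1 h2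
    · exact (hop _ _ (foldTime_mem_nearSet (by omega) (Or.inr (by omega)))).1
    · exact (hop _ _ hj).2
  | sum l i j h1 h2 h3 h4 h5 =>
    obtain ⟨t, ht, hs, hc, hi⟩ := hadder l i j h1 h2 h3 h4 h5
    refine hft ⟨t, ht, fun v hv => ?_⟩
    simp only [List.mem_cons, List.not_mem_nil, or_false] at hv
    rcases hv with rfl | rfl | rfl | rfl
    exacts [hs, hi 0 (by norm_num), hi 1 (by norm_num), hi 2 (by norm_num)]
  | carry l i j h1 h2 h3 h4 h5 =>
    obtain ⟨t, ht, hs, hc, hi⟩ := hadder l i j h1 h2 h3 h4 h5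
    refine hft ⟨t, ht, fun v hv => ?_⟩
    simp only [List.mem_cons, List.not_mem_nil, or_false] at hv
    rcases hv with rfl | rfl | rfl | rfl
    exacts [hc, hi 0 (by norm_num), hi 1 (by norm_num), hi 2 (by norm_num)]
  | carryIn =>
    refine hft ⟨0, Nat.zero_le _, fun v hv => ?_⟩
    simp only [List.mem_cons, List.not_mem_nil, or_false] at hv
    rcases hv with rfl | rfl
    exacts [hc0 _, hF0 _]
  | gen i h1 h2 h3 =>
    refine hft ⟨0, Nat.zero_le _, fun v hv => ?_⟩
    simp only [List.mem_cons, List.not_mem_nil, or_false] at hv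
    rcases hv with rfl | rfl | rfl
    exacts [hcla 0 i h1 h2 _ (column_mem_claCol _ i).1, hbit0 i 0 (by norm_num) h1 h2 h3,
      hbit0 i 1 (by norm_num) h1 h2 h3]
  | prop i h1 h2 h3 =>
    refine hft ⟨0, Nat.zero_le _, fun v hv => ?_⟩
    simp only [List.mem_cons, List.not_mem_nil, or_false] at hv
    rcases hv with rfl | rfl | rfl
    exacts [hcla 0 i h1 h2 _ (column_mem_claCol _ i).2.1, hbit0 i 0 (by norm_num) h1 h2 h3,
      hbit0 i 1 (by norm_num) h1 h2 h3]
  | out i h1 h2 h3 =>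
    refine hft ⟨0, Nat.zero_le _, fun v hv => ?_⟩
    simp only [List.mem_cons, List.not_mem_nil, or_false] at hv
    rcases hv with rfl | rfl | rfl | rfl
    exacts [hout 0 i ((mem_nearSet (Nat.zero_le _)).2 (by omega)),
      hcla 0 i h1 h2 _ (column_mem_claCol _ i).2.2, hbit0 i 0 (by norm_num) h1 h2 h3,
      hbit0 i 1 (by norm_num) h1 h2 h3]
  | block l i g h1 h2 h3 h4 h5 =>
    refine hft ⟨0, Nat.zero_le _, fun v hv => ?_⟩
    obtain ⟨u, hu, rfl⟩ := mem_claCol_of_mem_blockGates h1 h5 hv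
    exact hcla 0 i h2 h3 u hu

end Prod

/-! ### Sweeping over the bit positions -/

/-- The variables of a pair of expressions that are forced to be `0`. -/
def IsForced (L R : RingExpr) (n : ℕ) (z : Var) : Prop :=
  ∃ q a b v, (q, mul a b) ∈ allNodes L R ∧ z = .node q v ∧
    ((a.degree = 0 ∧ Far (max (a.width n) (b.width n)) (a.width n) true v) ∨
      (a.degree ≠ 0 ∧ b.degree = 0 ∧ Far (max (a.width n) (b.width n)) (b.width n) false v))

/-- The constants and the forced variables have their values. -/
structure Base (L R : RingExpr) (n : ℕ) (D : Clause Var) : Prop where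
  const_false : (.const false, true) ∈ D
  const_true : (.const true, false) ∈ D
  forced : ∀ z, IsForced L R n z → (z, true) ∈ D

/-- The gates of the columns up to `w` hold, where the gates of products of two linear expressions
are restricted to the columns from `A` on. -/
structure StripHolds (L R : RingExpr) (n A w : ℕ) (α : Var → Bool) : Prop where
  const_false : α (.const false) = false
  const_true : α (.const true) = true
  add : ∀ q a b i, (q, RingExpr.add a b) ∈ allNodes L R → i ≤ w →
    i < max (a.width n) (b.width n) + 1 → ∀ g ∈ adder (.node q (.rcSum i)) (.node q (.rcCarry i))
      (if i = 0 then .const false else .node q (.rcCarry (i - 1)))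
      (a.bit n (false :: q) i) (b.bit n (true :: q) i), g.Holds α
  constMul : ∀ q a b, (q, RingExpr.mul a b) ∈ allNodes L R → a.degree = 0 ∨ b.degree = 0 → ∀ g,
    StripGate q (max (a.width n) (b.width n)) (a.bit n (false :: q)) (b.bit n (true :: q)) 0 w g →
      g.Holds α
  prod : ∀ q a b, (q, RingExpr.mul a b) ∈ allNodes L R → a.degree ≠ 0 → b.degree ≠ 0 → ∀ g,
    StripGate q (max (a.width n) (b.width n)) (a.bit n (false :: q)) (b.bit n (true :: q)) A w g →
      g.Holds α

theorem bit_of_le {n : ℕ} {e : RingExpr} {q : List Bool} {m : ℕ} (h : e.width n ≤ m) :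
    e.bit n q m = .const false := by
  rw [bit.eq_def, if_neg (by omega)]

section Sweep

variable {L R : RingExpr} {n A w ρ : ℕ} {D : Clause Var}

/-- The variable `v` is available at time `t`. -/
def Avail (L R : RingExpr) (n A w ρ : ℕ) (D : Clause Var) (t : ℕ) (v : Var) : Prop :=
  v ∈ bag L R n A w ρ t ∨ ∃ b, (v, b) ∈ D

theorem avail_of_mem_localBag {q : List Bool} {e : RingExpr} (h : (q, e) ∈ allNodes L R)
    (he : ∀ k, e ≠ var k) {t : ℕ} {v : LocalVar} (hv : v ∈ e.localBag n A w ρ t) :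
    Avail L R n A w ρ D t (.node q v) := by
  refine Or.inl (mem_bag.2 ⟨q, e, h, ?_⟩)
  cases e with
  | var k => exact absurd rfl (he k)
  | _ => exact Finset.mem_image_of_mem _ hv

theorem avail_of_mem_colVars {q : List Bool} {e : RingExpr} (h : (q, e) ∈ allNodes L R)
    (he : ∀ k, e ≠ var k) {t m : ℕ} {v : LocalVar} (hv : v ∈ e.colVars n A w m)
    (hm : m ∈ nearSet ρ (w + 1) t) : Avail L R n A w ρ D t (.node q v) :=
  avail_of_mem_localBag h he (Finset.mem_union_left _ (Finset.mem_union_right _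
    (Finset.mem_biUnion.2 ⟨m, hm, hv⟩)))

theorem bit_cases {e : RingExpr} {q : List Bool} {m : ℕ} {P : Var → Prop}
    (h0 : P (.const false)) (h1 : P (.const true))
    (hvar : ∀ k, e = var k → m < e.width n → P (.input k m))
    (hnode : ∀ v, v ∈ e.colVars n A w m → (∀ k, e ≠ var k) → m < e.width n → P (.node q v)) :
    P (e.bit n q m) := by
  rw [bit.eq_def]
  split_ifs with hm
  · cases e with
    | var k => exact hvar k rfl hm
    | zero => exact h0
    | one => exact h1
    | add a b => exact hnode _ (by simp [colVars]) (by simp) hm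
    | mul a b => exact hnode _ (by simp [colVars]) (by simp) hm
  · exact h0

theorem avail_bit (hD : Base L R n D) {q : List Bool} {e : RingExpr} (h : (q, e) ∈ allNodes L R)
    {t m : ℕ} (hm : m ∈ nearSet ρ (w + 1) t) : Avail L R n A w ρ D t (e.bit n q m) := by
  refine bit_cases (A := A) (w := w) (Or.inr ⟨_, hD.const_false⟩) (Or.inr ⟨_, hD.const_true⟩) ?_ ?_
  · rintro k rfl -
    exact Or.inl (mem_bag.2 ⟨q, _, h, Finset.mem_image_of_mem _ hm⟩)
  · intro v hv he _
    exact avail_of_mem_colVars h he hv hm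

theorem avail_bit_const (hD : Base L R n D) {q : List Bool} {e : RingExpr}
    (h : (q, e) ∈ allNodes L R) (he0 : e.degree = 0) {t m : ℕ} :
    Avail L R n A w ρ D t (e.bit n q m) := by
  refine bit_cases (A := A) (w := w) (Or.inr ⟨_, hD.const_false⟩) (Or.inr ⟨_, hD.const_true⟩) ?_ ?_
  · rintro k rfl -
    simp [degree] at he0
  · intro v hv he hm
    refine avail_of_mem_localBag h he (Finset.mem_union_left _ (Finset.mem_union_left _
      (Finset.mem_union_left _ ?_)))
    rw [if_pos he0]
    exact Finset.mem_biUnion.2 ⟨m, Finset.mem_range.2 hm, hv⟩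

theorem stripHolds_of_avail (hD : Base L R n D) (hAw : A ≤ w)
    (hconst : ∀ q e, (q, e) ∈ allNodes L R → e.degree = 0 → e.width n ≤ ρ)
    (hprod : ∀ q a b, (q, RingExpr.mul a b) ∈ allNodes L R → a.degree ≠ 0 → b.degree ≠ 0 →
      w + wallaceDepth (max (a.width n) (b.width n)) + 7 ≤ A + ρ)
    {α : Var → Bool} (hα : Falsifies α D)
    (hfit : ∀ g ∈ instanceGates L R n, (∃ t ≤ (w + 1) / 2, ∀ v, v = g.out ∨ v ∈ g.ins →
      Avail L R n A w ρ D t v) → g.Holds α) : StripHolds L R n A w α := by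
  have hF0 : ∀ t, Avail L R n A w ρ D t (.const false) := fun t => Or.inr ⟨_, hD.const_false⟩
  have hα0 : α (.const false) = false := by simpa using hα _ hD.const_false
  have hself : ∀ i ≤ w, i ∈ nearSet ρ (w + 1) (foldTime (w + 1) i) := fun i hi =>
    foldTime_mem_nearSet (by omega) (by omega)
  refine ⟨hα0, by simpa using hα _ hD.const_true, ?_, ?_, ?_⟩
  · intro q a b i hq hi hlt g hg
    refine hfit g (rippleCarry_subset hq (List.mem_flatMap.2 ⟨i, List.mem_range.2 hlt, hg⟩))
      ⟨_, foldTime_le _ i, fun v hv => ?_⟩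
    obtain ⟨ha, hb⟩ := children_mem_allNodes (Or.inl hq)
    have hcol : ∀ v ∈ (RingExpr.add a b).colVars n A w i,
        Avail L R n A w ρ D (foldTime (w + 1) i) (.node q v) := fun v hv =>
      avail_of_mem_colVars hq (by simp) hv (hself i hi)
    have hc : Avail L R n A w ρ D (foldTime (w + 1) i)
        (if i = 0 then .const false else .node q (.rcCarry (i - 1))) := by
      split_ifs
      · exact hF0 _
      · exact hcol _ (by simp [colVars])
    have hs := hcol (.rcSum i) (by simp [colVars])
    have hc' := hcol (.rcCarry i) (by simp [colVars])
    have hxa := avail_bit (A := A) hD ha (hself i hi)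
    have hxb := avail_bit (A := A) hD hb (hself i hi)
    simp only [adder, List.mem_cons, List.not_mem_nil, or_false] at hg
    rcases hg with rfl | rfl <;> simp only [List.mem_cons, List.not_mem_nil, or_false] at hv <;>
      rcases hv with rfl | rfl | rfl | rfl <;> assumption
  · intro q a b hq hab g hg
    obtain ⟨ha, hb⟩ := children_mem_allNodes (Or.inr hq)
    have hfit' := fun g (hg : StripGate q (max (a.width n) (b.width n)) (a.bit n (false :: q))
      (b.bit n (true :: q)) 0 w g) => hfit g (wallaceMultiplier_subset hq hg.mem)
    have hforced : ∀ v, IsForced L R n (.node q v) → (∀ t, Avail L R n A w ρ D t (.node q v)) ∧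
        α (.node q v) = false := fun v hv =>
      ⟨fun t => Or.inr ⟨_, hD.forced _ hv⟩, by simpa using hα _ (hD.forced _ hv)⟩
    by_cases ha0 : a.degree = 0
    · refine holds_of_constMul (c := a.width n) (b := true) hfit' hF0 hα0 ?_ ?_ ?_ ?_ hg
      · intro i hi v hv
        refine avail_of_mem_colVars hq (by simp) ?_ (hself i hi)
        simpa [colVars, ha0] using hv
      · exact fun v hv => hforced v ⟨q, a, b, v, hq, rfl, Or.inl ⟨ha0, hv⟩⟩
      · intro i j hi hj h
        refine ⟨avail_bit_const hD ha ha0, avail_bit hD hb (foldTime_mem_nearSet (by omega) ?_)⟩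
        have := hconst _ _ ha ha0
        simp only [NearRow, constRow, if_true] at h
        omega
      · intro i j hj h
        left
        refine bit_of_le ?_
        simp only [NearRow, constRow, if_true] at h
        omega
    · have hb0 : b.degree = 0 := hab.resolve_left ha0
      refine holds_of_constMul (c := b.width n) (b := false) hfit' hF0 hα0 ?_ ?_ ?_ ?_ hg
      · intro i hi v hv
        refine avail_of_mem_colVars hq (by simp) ?_ (hself i hi)
        simpa [colVars, ha0, hb0] using hv
      · exact fun v hv => hforced v ⟨q, a, b, v, hq, rfl, Or.inr ⟨ha0, hb0, hv⟩⟩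
      · intro i j hi hj h
        refine ⟨avail_bit hD ha (foldTime_mem_nearSet (by omega) ?_), avail_bit_const hD hb hb0⟩
        have := hconst _ _ hb hb0
        simp only [NearRow, constRow, Bool.false_eq_true, if_false] at h
        omega
      · intro i j hj h
        right
        refine bit_of_le ?_
        simp only [NearRow, constRow, Bool.false_eq_true, if_false] at h
        omega
  · intro q a b hq ha0 hb0 g hg
    obtain ⟨ha, hb⟩ := children_mem_allNodes (Or.inr hq)
    refine holds_of_prod hAw (hprod q a b hq ha0 hb0)
      (fun g hg => hfit g (wallaceMultiplier_subset hq hg.mem)) hF0 ?_ ?_ ?_ ?_ ?_ ?_ hg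
    · exact fun t m hm => avail_of_mem_colVars hq (by simp) (by simp [colVars]) hm
    · intro t m hm i h1 h2
      refine avail_of_mem_colVars hq (by simp) ?_ hm
      simp only [colVars, ha0, hb0, if_false, Finset.mem_union, Finset.mem_image, Finset.mem_Icc]
      exact Or.inr ⟨i, by omega, rfl⟩
    · intro t m hm l hl i h1 h2 v hv
      refine avail_of_mem_localBag hq (by simp) (Finset.mem_union_right _
        (Finset.mem_biUnion.2 ⟨m, hm, ?_⟩))
      simp only [rowVars, ha0, hb0, or_self, if_false, Finset.mem_biUnion, Finset.mem_range,
        Finset.mem_Icc]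
      exact ⟨l, hl, i, by omega, hv⟩
    · refine fun t => avail_of_mem_localBag hq (by simp) (Finset.mem_union_left _
        (Finset.mem_union_left _ (Finset.mem_union_right _ ?_)))
      simp [ha0, hb0]
    · refine fun t i h1 h2 v hv => avail_of_mem_localBag hq (by simp) (Finset.mem_union_left _
        (Finset.mem_union_left _ (Finset.mem_union_right _ ?_)))
      simp only [ha0, hb0, or_self, if_false, Finset.mem_insert, Finset.mem_biUnion, Finset.mem_Icc]
      exact Or.inr ⟨i, ⟨h1, h2⟩, hv⟩
    · exact fun t m hm => ⟨avail_bit hD ha hm, avail_bit hD hb hm⟩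

/-- If no assignment that is consistent with `D` satisfies the gates of the columns up to `w`, then
`D` has a short refutation. -/
theorem Ref.of_strip {P Q : ℕ} (hD : Base L R n D) (hAw : A ≤ w)
    (hconst : ∀ q e, (q, e) ∈ allNodes L R → e.degree = 0 → e.width n ≤ ρ)
    (hprod : ∀ q a b, (q, RingExpr.mul a b) ∈ allNodes L R → a.degree ≠ 0 → b.degree ≠ 0 →
      w + wallaceDepth (max (a.width n) (b.width n)) + 7 ≤ A + ρ)
    (hsize : ∀ x ∈ allNodes L R, SizeBound n A w P Q x.2) (hρ : ρ ≤ P)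
    (h : ∀ α, Falsifies α D → StripHolds L R n A w α →
      (∀ i ≤ w, i < max (L.width n) (R.width n) → (∃ b, (.neq i, b) ∈ D) →
        α (.neq i) = xor (α (L.bit n [false] i)) (α (R.bit n [true] i))) → False) :
    Ref (phiWall L R n) D
      ((w + 1) * 2 ^ ((allNodes L R).length * (1000 * (P * Q) ^ 2) + 1)) := by
  refine (Ref.of_gates (T := (w + 1) / 2 + 1) (G := {g | g ∈ instanceGates L R n})
    (fun g hg C hC => Or.inl ⟨g, hg, hC⟩) (bag L R n A w ρ) bag_convex
    (fun t _ => card_bag_le hsize hρ t) fun α hα hfit => ?_).mono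
    (Nat.mul_le_mul_right _ (by omega))
  have hfit' : ∀ g ∈ instanceGates L R n, (∃ t ≤ (w + 1) / 2, ∀ v, v = g.out ∨ v ∈ g.ins →
      Avail L R n A w ρ D t v) → g.Holds α :=
    fun g hg ⟨t, ht, h⟩ => hfit g hg ⟨t, Nat.lt_succ_of_le ht, h⟩
  refine h α hα (stripHolds_of_avail hD hAw hconst hprod hα hfit') fun i hi hM hb => ?_
  have hself : i ∈ nearSet ρ (w + 1) (foldTime (w + 1) i) :=
    foldTime_mem_nearSet (by omega) (by omega)
  have := hfit' ⟨.neq i, [L.bit n [false] i, R.bit n [true] i], parity⟩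
    (List.mem_append_right _ (List.mem_map.2 ⟨i, List.mem_range.2 hM, rfl⟩))
    ⟨_, foldTime_le _ i, fun v hv => ?_⟩
  · simpa [Gate.Holds, parity_two] using this
  · simp only [List.mem_cons, List.not_mem_nil, or_false] at hv
    rcases hv with rfl | rfl | rfl
    · exact Or.inr hb
    · exact avail_bit hD (List.mem_append_left _ (self_mem_nodes _ _)) hself
    · exact avail_bit hD (List.mem_append_right _ (self_mem_nodes _ _)) hself

end Sweep

/-! ### Values of expressions and congruence up to an error -/

namespace RingExpr

/-- The value of an expression. -/
def eval (v : ℕ → ℕ) : RingExpr → ℕ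
  | var k => v k
  | zero => 0
  | one => 1
  | add a b => a.eval v + b.eval v
  | mul a b => a.eval v * b.eval v

theorem Identity.eval_eq {a b : RingExpr} (h : Identity a b) (v : ℕ → ℕ) : a.eval v = b.eval v := by
  induction h with
  | refl => rfl
  | symm _ ih => exact ih.symm
  | trans _ _ ih₁ ih₂ => exact ih₁.trans ih₂
  | add_congr _ _ ih₁ ih₂ | mul_congr _ _ ih₁ ih₂ => simp only [eval, ih₁, ih₂]
  | _ => simp only [eval]; ring

theorem eval_of_degree_eq_zero {e : RingExpr} (h : e.degree = 0) (v : ℕ → ℕ) :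
    e.eval v = e.eval 0 := by
  induction e with
  | var k => simp [degree] at h
  | zero | one => rfl
  | add a b iha ihb | mul a b iha ihb =>
    simp only [degree] at h
    simp only [eval]
    rw [iha (by omega), ihb (by omega)]

/-- The error of the value of an expression when the columns below a strip are not known. -/
def err : RingExpr → ℕ
  | add a b => a.err + b.err
  | mul a b => if a.degree = 0 then a.eval 0 * b.err
      else if b.degree = 0 then a.err * b.eval 0 else 3
  | _ => 0

/-- Degree at most 1 excludes a product of two factors of positive degree, the only source of
errors. -/
theorem err_eq_zero {e : RingExpr} (h : e.degree ≤ 1) : e.err = 0 := by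
  induction e with
  | var | zero | one => rfl
  | add a b iha ihb =>
    simp only [degree] at h
    simp only [err]
    rw [iha (by omega), ihb (by omega)]
  | mul a b iha ihb =>
    simp only [degree] at h
    simp only [err]
    rw [iha (by omega), ihb (by omega)]
    split_ifs <;> omega

end RingExpr

/-- The integers `a` and `b` are congruent modulo `m` up to an error of at most `r`. -/
def Close (m r a b : ℤ) : Prop := ∃ z, |a - b - m * z| ≤ r

theorem Close.add {m r s a b c d : ℤ} (h : Close m r a b) (h' : Close m s c d) :
    Close m (r + s) (a + c) (b + d) := by
  obtain ⟨z, hz⟩ := h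
  obtain ⟨z', hz'⟩ := h'
  refine ⟨z + z', (abs_add_le _ _ |>.trans (add_le_add hz hz')).trans' (le_of_eq ?_)⟩
  congr 1; ring

theorem Close.trans {m r s a b c : ℤ} (h : Close m r a b) (h' : Close m s b c) :
    Close m (r + s) a c := by
  obtain ⟨z, hz⟩ := h
  obtain ⟨z', hz'⟩ := h'
  refine ⟨z + z', (abs_add_le _ _ |>.trans (add_le_add hz hz')).trans' (le_of_eq ?_)⟩
  congr 1; ring

theorem Close.symm {m r a b : ℤ} (h : Close m r a b) : Close m r b a := by
  obtain ⟨z, hz⟩ := h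
  refine ⟨-z, ?_⟩
  rw [← abs_neg]
  convert hz using 2
  ring

theorem close_zero_of_eq {m a b z : ℤ} (h : a = b + m * z) : Close m 0 a b :=
  ⟨z, by rw [h]; simp⟩

/-- The exact factor is the constant one. An inexact factor times an unbounded value would lose
control of the error; degree at most 2 avoids this. -/
theorem Close.mul {m r a b c d : ℤ} (hd : 0 ≤ b) (h : Close m 0 a b) (h' : Close m r c d) :
    Close m (b * r) (a * c) (b * d) := by
  obtain ⟨z, hz⟩ := h
  obtain ⟨z', hz'⟩ := h'
  have hz : a = b + m * z := by
    have := abs_nonpos_iff.1 hz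
    linarith
  refine ⟨z * c + b * z', ?_⟩
  calc |a * c - b * d - m * (z * c + b * z')| = |b * (c - d - m * z')| := by
        rw [hz]; congr 1; ring
    _ = b * |c - d - m * z'| := by rw [abs_mul, abs_of_nonneg hd]
    _ ≤ b * r := mul_le_mul_of_nonneg_left hz' hd

section Semantics

variable {L R : RingExpr} {n A w : ℕ} {α : Var → Bool}

/-- The value of the output bits of a node. -/
def nodeVal (α : Var → Bool) (n : ℕ) (e : RingExpr) (q : List Bool) : ℕ :=
  bitsVal (fun i => α (e.bit n q i)) (e.width n)

theorem bitsVal_bit (h0 : α (.const false) = false) {e : RingExpr} {q : List Bool} {M : ℕ}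
    (hM : e.width n ≤ M) : bitsVal (fun i => α (e.bit n q i)) M = nodeVal α n e q := by
  rw [nodeVal, bitsVal, bitsVal, ← Finset.sum_range_add_sum_Ico _ hM]
  refine Nat.add_eq_left.2 (Finset.sum_eq_zero fun i hi => ?_)
  rw [bit_of_le (Finset.mem_Ico.1 hi).1, h0]
  simp

theorem bitsVal_ripple (hs : StripHolds L R n A w α) {q : List Bool} {a b : RingExpr}
    (hq : (q, RingExpr.add a b) ∈ allNodes L R) {t : ℕ} (ht : t ≤ w + 1)
    (ht' : t ≤ max (a.width n) (b.width n) + 1) :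
    bitsVal (fun i => α (.node q (.rcSum i))) t +
        2 ^ t * (α (if t = 0 then .const false else .node q (.rcCarry (t - 1)))).toNat =
      bitsVal (fun i => α (a.bit n (false :: q) i)) t +
        bitsVal (fun i => α (b.bit n (true :: q) i)) t := by
  induction t with
  | zero => simp [bitsVal, hs.const_false]
  | succ t ih =>
    have ih := ih (by omega) (by omega)
    have hg := hs.add q a b t hq (by omega) (by omega)
    simp only [adder, List.forall_mem_cons, List.not_mem_nil, false_imp_iff, implies_true, and_true,
      Gate.Holds, List.map_cons, List.map_nil] at hg
    have := adder_sum (α (if t = 0 then .const false else .node q (.rcCarry (t - 1))))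
      (α (a.bit n (false :: q) t)) (α (b.bit n (true :: q) t))
    rw [← hg.1, ← hg.2] at this
    have h2 := congrArg (2 ^ t * ·) this
    simp only [mul_add] at h2
    rw [bitsVal_succ, bitsVal_succ, bitsVal_succ, if_neg (by omega), Nat.add_sub_cancel, pow_succ]
    linarith

theorem close_of_split (x : ℕ → Bool) {m N : ℕ} (h : m ≤ N) :
    Close (2 ^ m) 0 (bitsVal x N) (bitsVal x m) := by
  obtain ⟨k, hk⟩ := bitsVal_split x h
  exact close_zero_of_eq (z := k) (by rw [hk]; push_cast; ring)

theorem close_add (hs : StripHolds L R n A w α) {q : List Bool} {a b : RingExpr}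
    (hq : (q, RingExpr.add a b) ∈ allNodes L R) : Close (2 ^ (w + 1)) 0
      (nodeVal α n (.add a b) q) (nodeVal α n a (false :: q) + nodeVal α n b (true :: q)) := by
  have hv : nodeVal α n (.add a b) q =
      bitsVal (fun i => α (.node q (.rcSum i))) (max (a.width n) (b.width n) + 1) := by
    rw [nodeVal, width]
    refine Finset.sum_congr rfl fun i hi => ?_
    dsimp only
    rw [bit.eq_def, width, if_pos (Finset.mem_range.1 hi)]
  rw [← bitsVal_bit (e := a) (M := max (a.width n) (b.width n) + 1) hs.const_false (by omega),
    ← bitsVal_bit (e := b) (M := max (a.width n) (b.width n) + 1) hs.const_false (by omega), hv]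
  rcases Nat.lt_or_ge w (max (a.width n) (b.width n) + 1) with h | h
  · have e := bitsVal_ripple hs hq (t := w + 1) le_rfl (by omega)
    rw [if_neg (by omega), Nat.add_sub_cancel] at e
    have h1 := close_of_split (fun i => α (.node q (.rcSum i))) (m := w + 1) h
    have h2 := (close_of_split (fun i => α (a.bit n (false :: q) i)) (m := w + 1) h).add
      (close_of_split (fun i => α (b.bit n (true :: q) i)) (m := w + 1) h)
    have h3 := (h1.trans (close_zero_of_eq (z := -((α (.node q (.rcCarry w))).toNat : ℤ)) ?_)).trans h2.symm
    · simpa using h3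
    · have e : ((_ : ℕ) : ℤ) = _ := congrArg Nat.cast e
      push_cast at e
      linarith
  · have e := bitsVal_ripple hs hq (t := max (a.width n) (b.width n) + 1) (by omega) le_rfl
    have hg := hs.add q a b (max (a.width n) (b.width n)) hq (by omega) (by omega)
    simp only [adder, List.forall_mem_cons, List.not_mem_nil, false_imp_iff, implies_true, and_true,
      Gate.Holds, List.map_cons, List.map_nil] at hg
    -- Both operand bits of the top column are padding, so its majority is 0 and no carry is lost.
    have hc : α (.node q (.rcCarry (max (a.width n) (b.width n)))) = false := by
      rw [hg.2, bit_of_le (le_max_left _ _), bit_of_le (le_max_right _ _), hs.const_false]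
      generalize α _ = c
      revert c; decide
    rw [if_neg (by omega), Nat.add_sub_cancel, hc] at e
    refine close_zero_of_eq (z := 0) ?_
    simp only [Bool.toNat_false, mul_zero, add_zero] at e ⊢
    exact mod_cast e

theorem nodeVal_mul (q : List Bool) (a b : RingExpr) : nodeVal α n (.mul a b) q =
    bitsVal (fun i => α (.node q (.claOut i))) (2 * max (a.width n) (b.width n)) := by
  rw [nodeVal, width]
  refine Finset.sum_congr rfl fun i hi => ?_
  dsimp only
  rw [bit.eq_def, width, if_pos (Finset.mem_range.1 hi)]

/-- The carry into column `A` of the multiplier at `q` is not propagated through all columns. -/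
def NoOverflow (α : Var → Bool) (q : List Bool) (N A w : ℕ) : Prop :=
  A = 0 ∨ w < 2 * N ∨ 2 * N ≤ A ∨ α (.node q (.claCarry A)) = false ∨
    ∃ i, A ≤ i ∧ i < 2 * N ∧ α (.node q (.claProp 0 i)) = false

theorem close_mul (h0 : α (.const false) = false) (hAw : A ≤ w) {q : List Bool} {a b : RingExpr}
    (hs : ∀ g, StripGate q (max (a.width n) (b.width n)) (a.bit n (false :: q))
      (b.bit n (true :: q)) A w g → g.Holds α)
    (hno : NoOverflow α q (max (a.width n) (b.width n)) A w) :
    Close (2 ^ (w + 1)) (3 * errUnit A) (nodeVal α n (.mul a b) q)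
      (nodeVal α n a (false :: q) * nodeVal α n b (true :: q)) := by
  have hP := bitsVal_rows (max (a.width n) (b.width n)) (α ∘ a.bit n (false :: q))
    (α ∘ b.bit n (true :: q))
  have e1 := bitsVal_bit (e := a) (q := false :: q) h0 (le_max_left (a.width n) (b.width n))
  have e2 := bitsVal_bit (e := b) (q := true :: q) h0 (le_max_right (a.width n) (b.width n))
  have hlt : nodeVal α n a (false :: q) * nodeVal α n b (true :: q) <
      2 ^ (2 * max (a.width n) (b.width n)) := by
    rw [← e1, ← e2, two_mul, pow_add]
    exact Nat.mul_lt_mul'' (bitsVal_lt _ _) (bitsVal_lt _ _)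
  obtain ⟨z, hz⟩ := (stripRows hs h0).approx (P := nodeVal α n a (false :: q) *
    nodeVal α n b (true :: q)) hAw (by rw [← e1, ← e2]; exact hP) hlt hno
  refine ⟨z, ?_⟩
  rw [nodeVal_mul]
  push_cast at hz
  exact hz

/-- Additions and multiplications by constants add no error of their own, the latter because their
window starts in column 0, where the unit is 0. A product of two linear expressions adds three
units, and its operands are exact modulo `2 ^ (w + 1)`. -/
theorem close_eval (hs : StripHolds L R n A w α) (hAw : A ≤ w)
    (hno : ∀ q a b, (q, RingExpr.mul a b) ∈ allNodes L R → a.degree ≠ 0 → b.degree ≠ 0 →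
      NoOverflow α q (max (a.width n) (b.width n)) A w) {e : RingExpr} (he : e.degree ≤ 2) :
    ∀ q, (q, e) ∈ allNodes L R → Close (2 ^ (w + 1)) (e.err * errUnit A) (nodeVal α n e q)
      (e.eval fun k => bitsVal (fun i => α (.input k i)) n) := by
  induction e with
  | var k =>
    intro q _
    refine close_zero_of_eq (z := 0) ?_ |>.trans (close_zero_of_eq (z := 0) (by simp; rfl)) |> fun h =>
      by simpa [err] using h
    rw [nodeVal, eval, mul_zero, add_zero]
    norm_cast
    refine Finset.sum_congr rfl fun i hi => ?_
    dsimp only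
    rw [bit.eq_def, width, if_pos (Finset.mem_range.1 hi)]
  | zero =>
    intro q _
    simp only [err, Nat.cast_zero, zero_mul]
    exact close_zero_of_eq (z := 0) (by simp [nodeVal, eval, bitsVal, width, bit, hs.const_false])
  | one =>
    intro q _
    simp only [err, Nat.cast_zero, zero_mul]
    exact close_zero_of_eq (z := 0) (by simp [nodeVal, eval, bitsVal, width, bit, hs.const_true])
  | add a b iha ihb =>
    intro q hq
    simp only [degree] at he
    obtain ⟨ha, hb⟩ := children_mem_allNodes (Or.inl hq)
    have := (close_add hs hq).trans ((iha (by omega) _ ha).add (ihb (by omega) _ hb))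
    simp only [err, eval]
    push_cast
    convert this using 1
    ring
  | mul a b iha ihb =>
    intro q hq
    simp only [degree] at he
    obtain ⟨ha, hb⟩ := children_mem_allNodes (Or.inr hq)
    have hca := iha (by omega) _ ha
    have hcb := ihb (by omega) _ hb
    simp only [err, eval]
    push_cast
    by_cases ha0 : a.degree = 0
    · have h := close_mul hs.const_false (Nat.zero_le w) (hs.constMul q a b hq (Or.inl ha0))
        (Or.inl rfl)
      rw [err_eq_zero (by omega)] at hca
      simp only [Nat.cast_zero, zero_mul] at hca
      have := h.trans (hca.mul (Int.natCast_nonneg _) hcb)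
      rw [if_pos ha0, ← eval_of_degree_eq_zero ha0 fun k => bitsVal (fun i => α (.input k i)) n]
      convert this using 1
      simp [errUnit, mul_assoc]
    by_cases hb0 : b.degree = 0
    · have h := close_mul hs.const_false (Nat.zero_le w) (hs.constMul q a b hq (Or.inr hb0))
        (Or.inl rfl)
      rw [err_eq_zero (by omega)] at hcb
      simp only [Nat.cast_zero, zero_mul] at hcb
      have h' := hcb.mul (Int.natCast_nonneg _) hca
      rw [mul_comm (nodeVal α n b (true :: q) : ℤ), mul_comm (eval _ b : ℤ) (eval _ a : ℤ)] at h'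
      have := h.trans h'
      rw [if_neg ha0, if_pos hb0,
        ← eval_of_degree_eq_zero hb0 fun k => bitsVal (fun i => α (.input k i)) n]
      convert this using 1
      simp only [show errUnit 0 = 0 from if_pos rfl, mul_zero, zero_add]
      ring
    · have h := close_mul hs.const_false hAw (hs.prod q a b hq ha0 hb0) (hno q a b hq ha0 hb0)
      rw [err_eq_zero (by omega)] at hca hcb
      simp only [Nat.cast_zero, zero_mul] at hca hcb
      have := h.trans (hca.mul (Int.natCast_nonneg _) hcb)
      rw [if_neg ha0, if_neg hb0]
      convert this using 1
      simp

theorem close_bitsVal_bit (h0 : α (.const false) = false) (e : RingExpr) (q : List Bool) (m : ℕ) :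
    Close (2 ^ m) 0 (nodeVal α n e q) (bitsVal (fun i => α (e.bit n q i)) m) := by
  rw [← bitsVal_bit h0 (le_max_left (e.width n) m)]
  exact close_of_split _ (le_max_right _ _)

/-- The two sides of an identity do not have a first disagreement in column `w`. -/
theorem false_of_disagree (hLR : Identity L R) (hL : L.degree ≤ 2) (hR : R.degree ≤ 2)
    (hs : StripHolds L R n A w α) (hAw : A ≤ w)
    (hno : ∀ q a b, (q, RingExpr.mul a b) ∈ allNodes L R → a.degree ≠ 0 → b.degree ≠ 0 →
      NoOverflow α q (max (a.width n) (b.width n)) A w)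
    {κ : ℕ} (hκ : L.err + R.err < 2 ^ κ) (hA : A = w - κ)
    (heq : ∀ i < w, α (L.bit n [false] i) = α (R.bit n [true] i))
    (hne : α (L.bit n [false] w) ≠ α (R.bit n [true] w)) : False := by
  have h1 := close_eval hs hAw hno hL [false] (List.mem_append_left _ (self_mem_nodes _ _))
  have h2 := close_eval hs hAw hno hR [true] (List.mem_append_right _ (self_mem_nodes _ _))
  rw [hLR.eval_eq] at h1
  have h3 := ((close_bitsVal_bit hs.const_false L [false] (w + 1)).symm.trans (h1.trans h2.symm)).trans
    (close_bitsVal_bit hs.const_false R [true] (w + 1))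
  rw [bitsVal_succ, bitsVal_succ] at h3
  have e : bitsVal (fun i => α (L.bit n [false] i)) w = bitsVal (fun i => α (R.bit n [true] i)) w :=
    Finset.sum_congr rfl fun i hi => by simp only [heq i (Finset.mem_range.1 hi)]
  rw [e] at h3
  obtain ⟨z, hz⟩ := h3
  -- The unit is 0 if `A = 0`; otherwise `w = κ + A`, and fewer than `2 ^ κ` units of `2 ^ A` occur.
  have hbound : (0 : ℤ) + (L.err * errUnit A + R.err * errUnit A) + 0 < 2 ^ w := by
    rw [zero_add, add_zero, ← add_mul]
    by_cases hA0 : A = 0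
    · rw [errUnit, if_pos hA0]
      simp
    · rw [errUnit, if_neg hA0, show w = κ + A by omega, pow_add]
      exact mul_lt_mul_of_pos_right (mod_cast hκ) (by positivity)
  have hz := hz.trans_lt hbound
  have hpos : (0 : ℤ) < 2 ^ w := by positivity
  rw [abs_lt, pow_succ] at hz
  revert hne hz
  generalize α (L.bit n [false] w) = b
  generalize α (R.bit n [true] w) = b'
  intro hne hz
  push_cast at hz
  -- The difference is an odd multiple of `2 ^ w`, so its absolute value is at least `2 ^ w`.
  have key : ∀ s : ℤ, s = 1 ∨ s = -1 → -2 ^ w < 2 ^ w * (s - 2 * z) → 2 ^ w * (s - 2 * z) < 2 ^ w →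
      False := by
    intro s hs' h1 h2
    have h3 : s - 2 * z < 1 := by
      by_contra h; nlinarith
    have h4 : -1 < s - 2 * z := by
      by_contra h; nlinarith
    omega
  cases b <;> cases b' <;> simp only [ne_eq, not_true_eq_false, Bool.toNat_false,
    Bool.toNat_true] at hne hz
  · exact key (-1) (Or.inr rfl) (by push_cast at hz; linarith) (by push_cast at hz; linarith)
  · exact key 1 (Or.inl rfl) (by push_cast at hz; linarith) (by push_cast at hz; linarith)

end Semantics

/-! ### A wrong carry that is propagated to the end of a multiplier -/

theorem falsifies_insert {V : Type} [DecidableEq V] {α : V → Bool} {D : Clause V} {z : V} {b : Bool} :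
    Falsifies α (insert (z, b) D) ↔ α z = !b ∧ Falsifies α D := by
  rw [Falsifies, Finset.forall_mem_insert, Falsifies, Bool.eq_not]

theorem mul_bitsVal_add_two_pow_le {x y : ℕ → Bool} {N m : ℕ} (hm : m < N)
    (h : x m = false ∨ y m = false) : bitsVal x N * bitsVal y N + 2 ^ (m + N) ≤ 2 ^ (2 * N) := by
  rcases h with h | h
  · exact mul_add_two_pow_le (bitsVal_add_two_pow_le hm h) (bitsVal_lt _ _)
  · rw [mul_comm]
    exact mul_add_two_pow_le (bitsVal_add_two_pow_le hm h) (bitsVal_lt _ _)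

theorem mul_bitsVal_lt (x y : ℕ → Bool) (N : ℕ) : bitsVal x N * bitsVal y N < 2 ^ (2 * N) := by
  rw [two_mul, pow_add]
  exact Nat.mul_lt_mul'' (bitsVal_lt _ _) (bitsVal_lt _ _)

/-- The carry into column `i` and all propagate bits from there on are `1`, and so are the operand
bits that are multiplied by the highest power of two into a column above `i`. -/
structure Propagating (x y : ℕ → Var) (N : ℕ) (q : List Bool) (i : ℕ) (α : Var → Bool) : Prop where
  carry : α (.node q (.claCarry i)) = true
  prop : ∀ j, i ≤ j → j < 2 * N → α (.node q (.claProp 0 j)) = true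
  left : ∀ m, m < N → i < m + N → α (x m) = true
  right : ∀ m, m < N → i < m + N → α (y m) = true

/-- Rows of numbers that add up to the product of the operands, in the columns from `A` to `w`. -/
def ProductStrip (α : Var → Bool) (q : List Bool) (N : ℕ) (x y : ℕ → Var) (A w : ℕ) : Prop :=
  ∃ ρ σ : ℕ → Bool, StripRows α q N A w ρ σ ∧ bitsVal ρ (2 * N) + bitsVal σ (2 * N) =
    bitsVal (fun i => α (x i)) N * bitsVal (fun i => α (y i)) N

theorem StripHolds.productStrip {L R : RingExpr} {n : ℕ} {q : List Bool} {a b : RingExpr}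
    (hq : (q, RingExpr.mul a b) ∈ allNodes L R) (ha : a.degree ≠ 0) (hb : b.degree ≠ 0) {A w : ℕ}
    {α : Var → Bool} (hs : StripHolds L R n A w α) :
    ProductStrip α q (max (a.width n) (b.width n)) (a.bit n (false :: q)) (b.bit n (true :: q)) A w :=
  ⟨_, _, stripRows (hs.prod q a b hq ha hb) hs.const_false, bitsVal_rows _ _ _⟩

section Overflow

variable {α : Var → Bool} {x y : ℕ → Var} {N : ℕ} {q : List Bool} {i : ℕ}

/-- All operand bits are 1, so the product misses `2 ^ (2 * N)` by `2 ^ (N + 1) - 1`, too much for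
propagation from column `N - 1` on. -/
theorem Propagating.false_of_lt (h : Propagating x y N q i α) (hi : i < N)
    (hs : ProductStrip α q N x y (N - 1) (min (N + 2) (2 * N - 1))) : False := by
  obtain ⟨ρ, σ, hrow, hP⟩ := hs
  have hu := two_pow_le_bitsVal_add (x := fun i => α (x i)) (Nat.zero_le N)
    fun m _ hm => h.left m hm (by omega)
  have hv := two_pow_le_bitsVal_add (x := fun i => α (y i)) (Nat.zero_le N)
    fun m _ hm => h.right m hm (by omega)
  have hu' := bitsVal_lt (fun i => α (x i)) N
  have hv' := bitsVal_lt (fun i => α (y i)) N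
  have e1 : bitsVal (fun i => α (x i)) N + 1 = 2 ^ N := by omega
  have e2 : bitsVal (fun i => α (y i)) N + 1 = 2 ^ N := by omega
  generalize bitsVal (fun i => α (x i)) N = U at *
  generalize bitsVal (fun i => α (y i)) N = V at *
  have hpow : 2 ^ N = 2 * 2 ^ (N - 1) := by
    rw [← pow_succ', Nat.sub_add_cancel (by omega)]
  have hpos : 0 < 2 ^ (N - 1) := by positivity
  refine false_of_propagate hP (E := U + V + 1) (m := N - 1) (t := min (N + 3) (2 * N)) ?_
    (by omega) (by omega) ?_ (by omega) ?_
  · rw [two_mul, pow_add]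
    nth_rw 1 [← e1]
    rw [← e2]
    ring
  · intro j h1 h2
    rw [← hrow.prop j h1 (by omega) (by omega)]
    exact h.prop j (by omega) (by omega)
  · rcases Nat.lt_or_ge (N + 3) (2 * N) with h | h
    · right
      rw [min_eq_left h.le, pow_add]
      omega
    · exact Or.inl (min_eq_right h)

theorem Propagating.product_le (h : Propagating x y N q i α) (hi : N ≤ i) (hi' : i < 2 * N) :
    2 ^ (2 * N) ≤ bitsVal (fun i => α (x i)) N * bitsVal (fun i => α (y i)) N + 2 ^ (i + 2) := by
  have := two_pow_le_mul_add
    (two_pow_le_bitsVal_add (x := fun i => α (x i)) (show i - N + 1 ≤ N by omega)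
      fun m h1 h2 => h.left m h2 (by omega))
    (two_pow_le_bitsVal_add (x := fun i => α (y i)) (show i - N + 1 ≤ N by omega)
      fun m h1 h2 => h.right m h2 (by omega)) (bitsVal_lt _ _) (by omega)
  rwa [show i - N + 1 + N + 1 = i + 2 by omega] at this

/-- The product is within `2 ^ (i + 2)` of `2 ^ (2 * N)`, so column `i - 1` cannot generate the
carry into `i` and must propagate it. -/
theorem Propagating.prop_ne_false (h : Propagating x y N q i α) (hi : N ≤ i) (hi' : i < 2 * N)
    (hs : ProductStrip α q N x y (i - 1) (min (i + 2) (2 * N - 1))) :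
    α (.node q (.claProp 0 (i - 1))) = true ∧ α (.node q (.claCarry (i - 1))) = true := by
  obtain ⟨ρ, σ, hrow, hP⟩ := hs
  have hlt := mul_bitsVal_lt (fun i => α (x i)) (fun i => α (y i)) N
  have hle := h.product_le hi hi'
  obtain ⟨E, hE⟩ := Nat.exists_eq_add_of_lt hlt
  have hc := hrow.carry (i - 1) le_rfl (by omega) (by omega)
  rw [Nat.sub_add_cancel (by omega), h.carry, ← hrow.prop (i - 1) le_rfl (by omega) (by omega)] at hc
  have hp := hrow.prop (i - 1) le_rfl (by omega) (by omega)
  have hg : (ρ (i - 1) && σ (i - 1)) = false := by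
    rw [← Bool.not_eq_true]
    intro hg
    refine false_of_generate hP (E := E + 1) hE.symm (Nat.succ_pos _) (m := i - 1)
      (t := min (i + 3) (2 * N)) (by omega) (by omega) hg (fun j h1 h2 => ?_) ?_
    · rw [← hrow.prop j h1.le (by omega) (by omega)]
      exact h.prop j (by omega) (by omega)
    · rcases Nat.lt_or_ge (i + 3) (2 * N) with h | h
      · right
        rw [min_eq_left h.le, Nat.sub_add_cancel (by omega), pow_add]
        rw [pow_add] at hle
        omega
      · exact Or.inl (min_eq_right h)
  rw [hg] at hc
  simpa using hc.symm

/-- An operand bit 0 at `i - N` makes the gap to `2 ^ (2 * N)` at least `2 ^ i`, too much for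
propagation from column `i - 1` on. -/
theorem Propagating.false_of_operand (h : Propagating x y N q i α) (hi : N ≤ i) (hi' : i < 2 * N)
    (hs : ProductStrip α q N x y (i - 1) (min (i + 2) (2 * N - 1)))
    (hp : α (.node q (.claProp 0 (i - 1))) = true)
    (hxy : α (x (i - N)) = false ∨ α (y (i - N)) = false) : False := by
  obtain ⟨ρ, σ, hrow, hP⟩ := hs
  have hle := h.product_le hi hi'
  have hge := mul_bitsVal_add_two_pow_le (x := fun i => α (x i)) (y := fun i => α (y i)) (N := N)
    (m := i - N) (by omega) hxy
  rw [Nat.sub_add_cancel hi] at hge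
  have hpow : 2 ^ i = 2 * 2 ^ (i - 1) := by
    rw [← pow_succ', Nat.sub_add_cancel (by omega)]
  have hpos : 0 < 2 ^ (i - 1) := by positivity
  obtain ⟨E, hE⟩ := Nat.exists_eq_add_of_le (le_of_add_le_left hge)
  refine false_of_propagate hP (E := E) hE.symm (m := i - 1) (t := min (i + 3) (2 * N))
    (by omega) (by omega) (fun j h1 h2 => ?_) (by omega) ?_
  · rw [← hrow.prop j h1 (by omega) (by omega)]
    rcases Nat.eq_or_lt_of_le h1 with rfl | h1
    · exact hp
    · exact h.prop j (by omega) (by omega)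
  · rcases Nat.lt_or_ge (i + 3) (2 * N) with h | h
    · right
      rw [min_eq_left h.le, pow_add]
      rw [pow_add] at hle
      omega
    · exact Or.inl (min_eq_right h)

theorem false_of_propagate_to_end {A m : ℕ} (hA : A < 2 * N)
    (hprop : ∀ j, A ≤ j → j < 2 * N → α (.node q (.claProp 0 j)) = true)
    (hs : ProductStrip α q N x y A (2 * N - 1)) (hm : m < N) (hAm : A < m + N)
    (hxy : α (x m) = false ∨ α (y m) = false) : False := by
  obtain ⟨ρ, σ, hrow, hP⟩ := hs
  have hge := mul_bitsVal_add_two_pow_le (x := fun i => α (x i)) (y := fun i => α (y i)) hm hxy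
  have hlt : 2 ^ A < 2 ^ (m + N) := Nat.pow_lt_pow_right (by norm_num) hAm
  obtain ⟨E, hE⟩ := Nat.exists_eq_add_of_le (le_of_add_le_left hge)
  refine false_of_propagate hP (E := E) hE.symm (m := A) (t := 2 * N) (by omega) le_rfl
    (fun j h1 h2 => ?_) (by omega) (Or.inl rfl)
  rw [← hrow.prop j h1 (by omega) (by omega)]
  exact hprop j h1 h2

variable {φ : Set (Clause Var)} {D : Clause Var} {X κ : ℕ}

/-- The descent: four queries extend the pattern from column `i` to column `i - 1`, and each wrong
answer is refuted by a sweep over at most four columns. It ends when `i < N`. -/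
theorem Ref.of_propagating (hsweep : ∀ D', D ⊆ D' → ∀ A w, A ≤ w → w < 2 * N → w ≤ A + κ →
      (∀ α, Falsifies α D' → ProductStrip α q N x y A w → False) → Ref φ D' X) (hκ : 3 ≤ κ) :
    ∀ k i, i < N + k → i < 2 * N → ∀ D', D ⊆ D' →
      (∀ α, Falsifies α D' → Propagating x y N q i α) → Ref φ D' (X + k * (4 * (X + 1))) := by
  intro k
  induction k with
  | zero =>
    intro i hi hi' D' hD h
    refine (hsweep D' hD (N - 1) (min (N + 2) (2 * N - 1)) (by omega) (by omega) (by omega)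
      fun α hα hs => ?_).mono (by omega)
    exact (h α hα).false_of_lt hi hs
  | succ k ih =>
    intro i hi hi' D' hD h
    rcases Nat.lt_or_ge i (N + k) with hik | hik
    · exact (ih i hik hi' D' hD h).mono (by gcongr; omega)
    rw [show X + (k + 1) * (4 * (X + 1)) =
      X + (X + (X + (X + (X + k * (4 * (X + 1))) + 1) + 1) + 1) + 1 by ring]
    have hstep := fun D' (hD : D ⊆ D') => hsweep D' hD (i - 1) (min (i + 2) (2 * N - 1)) (by omega)
      (by omega) (by omega)
    have hsub := fun (D' : Clause Var) l (hD : D ⊆ D') => hD.trans (Finset.subset_insert l D')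
    refine Ref.split (.node q (.claProp 0 (i - 1))) (hstep _ (hsub _ _ hD) fun α hα hs => ?_) ?_
    · rw [falsifies_insert] at hα
      have := ((h α hα.2).prop_ne_false (by omega) hi' hs).1
      rw [hα.1] at this
      simp at this
    refine Ref.split (.node q (.claCarry (i - 1)))
      (hstep _ (hsub _ _ (hsub _ _ hD)) fun α hα hs => ?_) ?_
    · simp only [falsifies_insert] at hα
      have := ((h α hα.2.2).prop_ne_false (by omega) hi' hs).2
      rw [hα.1] at this
      simp at this
    refine Ref.split (x (i - N)) (hstep _ (hsub _ _ (hsub _ _ (hsub _ _ hD))) fun α hα hs => ?_) ?_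
    · simp only [falsifies_insert] at hα
      exact (h α hα.2.2.2).false_of_operand (by omega) hi' hs (by simpa using hα.2.2.1)
        (Or.inl (by simpa using hα.1))
    refine Ref.split (y (i - N))
      (hstep _ (hsub _ _ (hsub _ _ (hsub _ _ (hsub _ _ hD)))) fun α hα hs => ?_) ?_
    · simp only [falsifies_insert] at hα
      exact (h α hα.2.2.2.2).false_of_operand (by omega) hi' hs (by simpa using hα.2.2.2.1)
        (Or.inr (by simpa using hα.1))
    refine ih (i - 1) (by omega) (by omega) _ (hsub _ _ (hsub _ _ (hsub _ _ (hsub _ _ hD))))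
      fun α hα => ?_
    simp only [falsifies_insert, Bool.not_false] at hα
    obtain ⟨hy, hx, hc, hp, hα⟩ := hα
    have h := h α hα
    refine ⟨hc, fun j h1 h2 => ?_, fun m h1 h2 => ?_, fun m h1 h2 => ?_⟩
    · rcases Nat.eq_or_lt_of_le h1 with rfl | h1
      · exact hp
      · exact h.prop j (by omega) h2
    · by_cases hm : m = i - N
      · rw [hm]; exact hx
      · exact h.left m h1 (by omega)
    · by_cases hm : m = i - N
      · rw [hm]; exact hy
      · exact h.right m h1 (by omega)

/-- A carry into column `A` that is propagated to the end is refuted. -/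
theorem Ref.of_overflow (hsweep : ∀ D', D ⊆ D' → ∀ A w, A ≤ w → w < 2 * N → w ≤ A + κ →
      (∀ α, Falsifies α D' → ProductStrip α q N x y A w → False) → Ref φ D' X) (hκ : 3 ≤ κ)
    {A : ℕ} (hA : A < 2 * N) (hAκ : 2 * N ≤ A + κ)
    (hc : ∀ α, Falsifies α D → α (.node q (.claCarry A)) = true)
    (hprop : ∀ α, Falsifies α D → ∀ j, A ≤ j → j < 2 * N → α (.node q (.claProp 0 j)) = true) :
    Ref φ D (X + 6 * N * (X + 1)) := by
  -- The operand bits that the pattern needs at column `A` are queried first. A 0 among them moves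
  -- the product too far from `2 ^ (2 * N)` for propagation to the top.
  have key : ∀ k s, s + k = N → ∀ D', D ⊆ D' → (∀ α, Falsifies α D' → ∀ m < s, A < m + N →
      α (x m) = true ∧ α (y m) = true) →
      Ref φ D' (X + N * (4 * (X + 1)) + k * (2 * (X + 1))) := by
    intro k
    induction k with
    | zero =>
      intro s hs D' hD h
      refine (Ref.of_propagating hsweep hκ N A (by omega) hA D' hD fun α hα => ?_).mono (by omega)
      have hα' : Falsifies α D := fun l hl => hα l (hD hl)
      exact ⟨hc α hα', hprop α hα', fun m h1 h2 => (h α hα m (by omega) h2).1,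
        fun m h1 h2 => (h α hα m (by omega) h2).2⟩
    | succ k ih =>
      intro s hs D' hD h
      have hsub := fun (D' : Clause Var) l (hD : D ⊆ D') => hD.trans (Finset.subset_insert l D')
      by_cases hAs : A < s + N
      swap
      · refine (ih (s + 1) (by omega) D' hD fun α hα m hm hAm => ?_).mono (by gcongr; omega)
        exact h α hα m (by omega) hAm
      have hstep := fun D' (hD : D ⊆ D') => hsweep D' hD A (2 * N - 1) (by omega) (by omega)
        (by omega)
      have hfalse : ∀ D', D ⊆ D' → (∀ α, Falsifies α D' → α (x s) = false ∨ α (y s) = false) →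
          Ref φ D' X := fun D' hD h => hstep D' hD fun α hα hst =>
        false_of_propagate_to_end hA (hprop α fun l hl => hα l (hD hl)) hst (by omega) hAs (h α hα)
      rw [show X + N * (4 * (X + 1)) + (k + 1) * (2 * (X + 1)) =
        X + (X + (X + N * (4 * (X + 1)) + k * (2 * (X + 1))) + 1) + 1 by ring]
      refine Ref.split (x s) (hfalse _ (hsub _ _ hD) fun α hα => Or.inl ?_)
        (Ref.split (y s) (hfalse _ (hsub _ _ (hsub _ _ hD)) fun α hα => Or.inr ?_) ?_)
      · simpa using (falsifies_insert.1 hα).1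
      · simpa using (falsifies_insert.1 hα).1
      · refine ih (s + 1) (by omega) _ (hsub _ _ (hsub _ _ hD)) fun α hα m hm hAm => ?_
        simp only [falsifies_insert, Bool.not_false] at hα
        rcases Nat.lt_succ_iff_lt_or_eq.1 hm with hm | rfl
        · exact h α hα.2.2 m hm hAm
        · exact ⟨hα.2.1, hα.1⟩
  refine (key N 0 (by omega) D subset_rfl fun α hα m hm => absurd hm (Nat.not_lt_zero _)).mono
    (le_of_eq (by ring))

end Overflow

/-! ### The parameters of the refutation -/

namespace RingExpr

theorem width_le_of_mem_nodes {e : RingExpr} {n : ℕ} {p : List Bool} {x : List Bool × RingExpr}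
    (h : x ∈ e.nodes p) : x.2.width n ≤ e.width n := by
  induction e generalizing p with
  | var | zero | one => simp [nodes] at h; simp [h]
  | add a b iha ihb | mul a b iha ihb =>
    simp only [nodes, List.mem_cons, List.mem_append] at h
    simp only [width]
    rcases h with rfl | h | h
    · simp only [width]; omega
    · have := iha h; omega
    · have := ihb h; omega

theorem width_of_degree_eq_zero {e : RingExpr} (h : e.degree = 0) (n m : ℕ) :
    e.width n = e.width m := by
  induction e with
  | var k => simp [degree] at h
  | zero | one => rfl
  | add a b iha ihb | mul a b iha ihb =>
    simp only [degree] at h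
    simp only [width]
    rw [iha (by omega), ihb (by omega)]

theorem width_pos {n : ℕ} (hn : 1 ≤ n) (e : RingExpr) : 1 ≤ e.width n := by
  induction e with
  | var k => exact hn
  | zero | one => exact le_rfl
  | add a b iha ihb | mul a b iha ihb => simp only [width]; omega

theorem exists_width_le (e : RingExpr) : ∃ c, ∀ n, 1 ≤ n → e.width n ≤ c * n := by
  induction e with
  | var k => exact ⟨1, fun n _ => by simp [width]⟩
  | zero | one => exact ⟨1, fun n hn => by simpa [width] using hn⟩
  | add a b iha ihb | mul a b iha ihb =>
    obtain ⟨c, hc⟩ := iha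
    obtain ⟨d, hd⟩ := ihb
    refine ⟨2 * (c + d) + 1, fun n hn => ?_⟩
    have h1 := hc n hn
    have h2 := hd n hn
    simp only [width, add_mul, mul_assoc]
    omega

end RingExpr

/-- The number of columns below the column under consideration that are taken into account. -/
def stripBits (L R : RingExpr) : ℕ := L.err + R.err + 3

/-- A bound for the widths of the constant subexpressions. -/
def constWidth (L R : RingExpr) : ℕ := max (L.width 1) (R.width 1)

/-- The common width of the two output vectors. -/
def outWidth (L R : RingExpr) (n : ℕ) : ℕ := max (L.width n) (R.width n)

/-- A bound for all logarithmic quantities. -/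
def logSize (L R : RingExpr) (n : ℕ) : ℕ :=
  stripBits L R + 2 * Nat.log 2 (outWidth L R n) + constWidth L R + 20

/-- The cost of a sweep over the bit positions. -/
def sweepCost (L R : RingExpr) (n : ℕ) : ℕ := outWidth L R n *
  2 ^ ((allNodes L R).length * (1000 * (logSize L R n * constWidth L R) ^ 2) + 1)

section

variable {L R : RingExpr} {n : ℕ}

theorem width_le_outWidth {x : List Bool × RingExpr} (h : x ∈ allNodes L R) (n : ℕ) :
    x.2.width n ≤ outWidth L R n := by
  rcases List.mem_append.1 h with h | h
  · exact (width_le_of_mem_nodes h).trans (le_max_left _ _)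
  · exact (width_le_of_mem_nodes h).trans (le_max_right _ _)

theorem width_le_constWidth {x : List Bool × RingExpr} (h : x ∈ allNodes L R) (n : ℕ)
    (hx : x.2.degree = 0) : x.2.width n ≤ constWidth L R := by
  rw [width_of_degree_eq_zero hx n 1]
  exact width_le_outWidth h 1

theorem two_mul_le_outWidth {q : List Bool} {a b : RingExpr}
    (h : (q, RingExpr.mul a b) ∈ allNodes L R) (n : ℕ) :
    2 * max (a.width n) (b.width n) ≤ outWidth L R n := width_le_outWidth h n

theorem wallaceDepth_le_logSize {q : List Bool} {a b : RingExpr}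
    (h : (q, RingExpr.mul a b) ∈ allNodes L R) : wallaceDepth (max (a.width n) (b.width n)) ≤
      2 * (Nat.log 2 (outWidth L R n) + 1) := by
  refine (wallaceDepth_le _).trans ?_
  have := two_mul_le_outWidth h n
  gcongr
  omega

theorem one_le_constWidth (L R : RingExpr) : 1 ≤ constWidth L R :=
  (width_pos le_rfl L).trans (le_max_left _ _)

theorem sizeBound {A w : ℕ} (hw : w ≤ A + stripBits L R)
    {x : List Bool × RingExpr} (hx : x ∈ allNodes L R) :
    SizeBound n A w (logSize L R n) (constWidth L R) x.2 where
  one_le := by rw [logSize]; omega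
  one_le' := one_le_constWidth L R
  strip := by rw [logSize]; omega
  const h := width_le_constWidth hx n h
  mul a b hab := by
    have hx' : (x.1, RingExpr.mul a b) ∈ allNodes L R := hab ▸ hx
    obtain ⟨ha, hb⟩ := children_mem_allNodes (Or.inr hx')
    refine ⟨(wallaceDepth_le_logSize hx').trans (by rw [logSize]; omega), ?_,
      width_le_constWidth ha n, width_le_constWidth hb n⟩
    have h1 : Nat.clog 4 (2 * max (a.width n) (b.width n)) ≤ Nat.log 2 (outWidth L R n) + 1 := by
      refine Nat.clog_le_of_le_pow ((two_mul_le_outWidth hx' n).trans ?_)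
      exact (Nat.lt_pow_succ_log_self (by norm_num) _).le.trans
        (Nat.pow_le_pow_left (by norm_num) _)
    rw [logSize]
    omega

theorem Ref.of_strip_logSize {D : Clause Var} (hD : Base L R n D) {A w : ℕ}
    (hAw : A ≤ w) (hwM : w < outWidth L R n) (hw : w ≤ A + stripBits L R)
    (h : ∀ α, Falsifies α D → StripHolds L R n A w α →
      (∀ i ≤ w, (∃ b, (.neq i, b) ∈ D) →
        α (.neq i) = xor (α (L.bit n [false] i)) (α (R.bit n [true] i))) → False) :
    Ref (phiWall L R n) D (sweepCost L R n) := by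
  refine (Ref.of_strip (ρ := logSize L R n) (P := logSize L R n) (Q := constWidth L R) hD hAw ?_ ?_
    (fun x hx => sizeBound hw hx) le_rfl fun α hα hs hneq => h α hα hs fun i hi =>
      hneq i hi (hi.trans_lt hwM)).mono (Nat.mul_le_mul_right _ hwM)
  · exact fun q e he h0 => (width_le_constWidth he n h0).trans (by rw [logSize]; omega)
  · intro q a b hq _ _
    have := wallaceDepth_le_logSize (n := n) hq
    rw [logSize]
    omega

/-! ### The first disagreement -/

theorem Base.mono {D D' : Clause Var} (h : Base L R n D) (hD : D ⊆ D') : Base L R n D' :=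
  ⟨hD h.const_false, hD h.const_true, fun z hz => hD (h.forced z hz)⟩

open Classical in
/-- The bits that tell whether a wrong carry into column `A` is propagated through a multiplier. -/
noncomputable def overflowVars (L R : RingExpr) (A w : ℕ) : Finset Var :=
  (allNodes L R).toFinset.biUnion fun x => insert (.node x.1 (.claCarry A))
    ((Finset.Icc A w).image fun i => .node x.1 (.claProp 0 i))

theorem card_overflowVars_le (L R : RingExpr) {A w κ : ℕ} (hw : w ≤ A + κ) :
    (overflowVars L R A w).card ≤ (allNodes L R).length * (κ + 2) := by
  classical
  refine card_biUnion_le (List.toFinset_card_le _) fun x hx => (Finset.card_insert_le _ _).trans ?_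
  refine Nat.succ_le_succ (Finset.card_image_le.trans ?_)
  rw [Nat.card_Icc]
  omega

/-- The cost of refuting a first disagreement in a given column. -/
def disagreeCost (L R : RingExpr) (n : ℕ) : ℕ := 2 ^ ((allNodes L R).length * (stripBits L R + 2)) *
  (sweepCost L R n + 6 * outWidth L R n * (sweepCost L R n + 1) + 1)

/-- The values of boundedly many carry and propagate bits decide between the two cases: a multiplier
with a carry propagated from `A` to its top, or a single sweep that contradicts the identity. -/
theorem Ref.of_disagree (hLR : Identity L R) (hL : L.degree ≤ 2) (hR : R.degree ≤ 2)
    {D : Clause Var} (hD : Base L R n D) {w : ℕ} (hw : w < outWidth L R n)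
    (heq : ∀ i < w, (.neq i, true) ∈ D) (hne : (.neq w, false) ∈ D) :
    Ref (phiWall L R n) D (disagreeCost L R n) := by
  set A := w - stripBits L R with hA
  have hAw : A ≤ w := Nat.sub_le _ _
  have hwA : w ≤ A + stripBits L R := by omega
  refine (Ref.of_forall_values (s := sweepCost L R n + 6 * outWidth L R n * (sweepCost L R n + 1))
    (overflowVars L R A w) D fun D' hDD' hval => ?_).mono ((Nat.sub_le _ _).trans
      (Nat.mul_le_mul_right _ (Nat.pow_le_pow_right (by norm_num) (card_overflowVars_le L R hwA))))
  have hD' := hD.mono hDD'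
  by_cases hov : ∃ q a b, (q, RingExpr.mul a b) ∈ allNodes L R ∧ a.degree ≠ 0 ∧ b.degree ≠ 0 ∧
      2 * max (a.width n) (b.width n) ≤ w ∧ A < 2 * max (a.width n) (b.width n) ∧
      (.node q (.claCarry A), false) ∈ D' ∧ ∀ i, A ≤ i → i < 2 * max (a.width n) (b.width n) →
        (.node q (.claProp 0 i), false) ∈ D'
  · obtain ⟨q, a, b, hq, ha, hb, h1, h2, h3, h4⟩ := hov
    have h5 := two_mul_le_outWidth hq n
    -- The summand 3 of `stripBits` admits the windows of four columns used in the descent.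
    refine (Ref.of_overflow (κ := stripBits L R) (X := sweepCost L R n)
      (x := a.bit n (false :: q)) (y := b.bit n (true :: q)) (N := max (a.width n) (b.width n))
      (q := q) (A := A) ?_ (by rw [stripBits]; omega) h2 (by omega) ?_ ?_).mono (by gcongr; omega)
    · intro D'' hD'' A' w' hA' hw' hw'' h
      exact Ref.of_strip_logSize (hD'.mono hD'') hA' (by omega) hw'' fun α hα hs _ =>
        h α hα (hs.productStrip hq ha hb)
    · exact fun α hα => by simpa using hα _ h3
    · exact fun α hα j hj hj' => by simpa using hα _ (h4 j hj hj')
  · refine (Ref.of_strip_logSize hD' hAw hw hwA fun α hα hs hneq => ?_).mono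
      (Nat.le_add_right _ _)
    have hbits : ∀ i < w, α (L.bit n [false] i) = α (R.bit n [true] i) := by
      intro i hi
      have h1 := hneq i hi.le ⟨_, hDD' (heq i hi)⟩
      have h2 : α (.neq i) = false := by simpa using hα _ (hDD' (heq i hi))
      rw [h2] at h1
      simpa using h1.symm
    have hbit : α (L.bit n [false] w) ≠ α (R.bit n [true] w) := by
      have h1 := hneq w le_rfl ⟨_, hDD' hne⟩
      have h2 : α (.neq w) = true := by simpa using hα _ (hDD' hne)
      rw [h2] at h1
      simpa using h1.symm
    refine false_of_disagree hLR hL hR hs hAw ?_ (κ := stripBits L R) ?_ hA hbits hbit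
    · intro q a b hq ha hb
      by_contra hno
      simp only [NoOverflow, not_or, not_exists, not_and, not_lt, not_le, Bool.not_eq_false] at hno
      obtain ⟨h0, h1, h2, h3, h4⟩ := hno
      have hmem : ∀ v, (∃ x ∈ allNodes L R, v = .node x.1 (.claCarry A) ∨
          ∃ i, A ≤ i ∧ i ≤ w ∧ v = .node x.1 (.claProp 0 i)) → α v = true → (v, false) ∈ D' := by
        rintro v ⟨x, hx, hv⟩ hαv
        obtain ⟨b, hb⟩ := hval v (by
          classical
          simp only [overflowVars, Finset.mem_biUnion, List.mem_toFinset, Finset.mem_insert,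
            Finset.mem_image, Finset.mem_Icc]
          refine ⟨x, hx, hv.imp_right ?_⟩
          rintro ⟨i, h1, h2, rfl⟩
          exact ⟨i, ⟨h1, h2⟩, rfl⟩)
        cases b with
        | false => exact hb
        | true => exact absurd hαv (hα _ hb)
      refine hov ⟨q, a, b, hq, ha, hb, h1, h2, hmem _ ⟨_, hq, Or.inl rfl⟩ h3, fun i hi hi' => ?_⟩
      exact hmem _ ⟨_, hq, Or.inr ⟨i, hi, by omega, rfl⟩⟩ (h4 i hi hi')
    · exact (by rw [stripBits]; omega : L.err + R.err < stripBits L R).trans Nat.lt_two_pow_self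

/-- A linear search for the first disagreement. If there is none, the clause on all comparison bits
is falsified. -/
theorem Ref.of_base (hLR : Identity L R) (hL : L.degree ≤ 2) (hR : R.degree ≤ 2)
    {D : Clause Var} (hD : Base L R n D) :
    Ref (phiWall L R n) D (1 + outWidth L R n * (disagreeCost L R n + 1)) := by
  have key : ∀ k w, w + k = outWidth L R n → ∀ D', D ⊆ D' → (∀ i < w, (.neq i, true) ∈ D') →
      Ref (phiWall L R n) D' (1 + k * (disagreeCost L R n + 1)) := by
    intro k
    induction k with
    | zero =>
      intro w hw D' hD' h
      rw [zero_mul]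
      refine Ref.of_mem (C := (Finset.range (max (L.width n) (R.width n))).image
        fun i => (.neq i, true)) (Or.inr (by simp)) ?_
      intro l hl
      obtain ⟨i, hi, rfl⟩ := Finset.mem_image.1 hl
      refine h i ?_
      rw [← Nat.add_zero w, hw]
      exact Finset.mem_range.1 hi
    | succ k ih =>
      intro w hw D' hD' h
      have hsub := fun l => Finset.subset_insert l D'
      refine (Ref.split (.neq w) (ih (w + 1) (by omega) _ (hD'.trans (hsub _)) fun i hi => ?_)
        (Ref.of_disagree hLR hL hR (hD.mono (hD'.trans (hsub _))) (w := w) (by omega)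
          (fun i hi => hsub _ (h i hi)) (Finset.mem_insert_self _ _))).mono (le_of_eq (by ring))
      rcases Nat.lt_succ_iff_lt_or_eq.1 hi with hi | rfl
      · exact hsub _ (h i hi)
      · exact Finset.mem_insert_self _ _
  exact key _ 0 (by omega) D subset_rfl fun i hi => absurd hi (Nat.not_lt_zero _)

/-! ### The forced variables -/

theorem Ref.of_gate {D : Clause Var} {g : Gate} (hg : g ∈ instanceGates L R n)
    (hlen : g.ins.length ≤ 3) (h : ∀ α, Falsifies α D → g.Holds α → False) :
    Ref (phiWall L R n) D 32 := by
  refine (Ref.of_gates (T := 1) (s := 4) (G := {g}) ?_ (fun _ => insert g.out g.ins.toFinset)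
    (fun _ _ _ _ _ _ _ h _ => h) (fun _ _ => ?_) fun α hα hfit => h α hα ?_).mono (by norm_num)
  · rintro g' rfl C hC
    exact Or.inl ⟨g', hg, hC⟩
  · refine (Finset.card_insert_le _ _).trans (Nat.succ_le_succ ?_)
    exact (List.toFinset_card_le _).trans hlen
  · refine hfit g rfl ⟨0, Nat.one_pos, fun v hv => Or.inl ?_⟩
    simpa using hv

/-- The order in which the forced variables are derived. -/
def forcedRank : Var → ℕ
  | .node _ (.partialProduct _ _) => 1
  | .node _ (.treeSum l _ _) => l + 2
  | .node _ (.treeCarry l _ _) => l + 2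
  | _ => 0

open Classical in
/-- The forced variables. -/
noncomputable def forcedVars (L R : RingExpr) (n : ℕ) : Finset Var :=
  ((allNodes L R).toFinset.biUnion fun x =>
    ((Finset.range (outWidth L R n) ×ˢ Finset.range (outWidth L R n)).image fun y =>
      Var.node x.1 (.partialProduct y.1 y.2)) ∪
    ((Finset.range (logSize L R n) ×ˢ Finset.range (outWidth L R n) ×ˢ
      Finset.range (outWidth L R n)).biUnion fun y =>
      {Var.node x.1 (.treeSum y.1 y.2.1 y.2.2), Var.node x.1 (.treeCarry y.1 y.2.1 y.2.2)})).filter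
    fun z => IsForced L R n z

theorem card_forcedVars_le (L R : RingExpr) (n : ℕ) : (forcedVars L R n).card ≤
    (allNodes L R).length * (outWidth L R n * outWidth L R n +
      logSize L R n * (outWidth L R n * outWidth L R n) * 2) := by
  classical
  refine (Finset.card_filter_le _ _).trans (card_biUnion_le (List.toFinset_card_le _) fun x _ =>
    (Finset.card_union_le _ _).trans (add_le_add (Finset.card_image_le.trans ?_)
      (card_biUnion_le ?_ fun _ _ => Finset.card_le_two)))
  · simp
  · simp

theorem mem_forcedVars {z : Var} : z ∈ forcedVars L R n ↔ IsForced L R n z := by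
  classical
  rw [forcedVars, Finset.mem_filter, and_iff_right_iff_imp]
  rintro ⟨q, a, b, v, hq, rfl, hv⟩
  have hM := two_mul_le_outWidth hq n
  have hP : wallaceDepth (max (a.width n) (b.width n)) ≤ logSize L R n :=
    (wallaceDepth_le_logSize hq).trans (by rw [logSize]; omega)
  obtain ⟨c, b', hv⟩ : ∃ c b', Far (max (a.width n) (b.width n)) c b' v := by
    rcases hv with ⟨-, hv⟩ | ⟨-, -, hv⟩
    exacts [⟨_, _, hv⟩, ⟨_, _, hv⟩]
  simp only [Finset.mem_biUnion, List.mem_toFinset, Finset.mem_union, Finset.mem_image,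
    Finset.mem_product, Finset.mem_range, Finset.mem_insert, Finset.mem_singleton, Prod.exists]
  refine ⟨q, _, hq, ?_⟩
  cases v with
  | partialProduct i j => exact Or.inl ⟨i, j, ⟨by have := hv.1; omega, by have := hv.2.1; omega⟩, rfl⟩
  | treeSum l i j =>
    have := length_wallaceCol_le (max (a.width n) (b.width n)) l i
    obtain ⟨h1, h2, h3, -⟩ := hv
    exact Or.inr ⟨l, i, j, ⟨by omega, by omega, by omega⟩, Or.inl rfl⟩
  | treeCarry l i j =>
    have := length_wallaceCol_le (max (a.width n) (b.width n)) l i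
    obtain ⟨h1, h2, h3, -⟩ := hv
    exact Or.inr ⟨l, i, j, ⟨by omega, by omega, by omega⟩, Or.inr rfl⟩
  | _ => exact hv.elim

theorem forcedRank_lt {N l i s : ℕ} {v : LocalVar} (q : List Bool)
    (hv : (wallaceCol N l i)[s]? = some v) : forcedRank (.node q v) < l + 2 := by
  cases l with
  | zero =>
    obtain ⟨rfl, -, -⟩ := getElem?_wallaceCol_zero hv
    simp [forcedRank]
  | succ l =>
    rcases getElem?_wallaceCol_succ hv with ⟨j', rfl, -, -⟩ | ⟨j', rfl, -, -, -⟩ <;>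
      simp [forcedRank]

/-- One gate suffices: the inputs of a far adder are constants 0 or far variables of smaller rank,
and a far partial product has a constant input 0. -/
theorem Ref.of_forced_true {D : Clause Var} {z : Var} (hz : IsForced L R n z)
    (h0 : (.const false, true) ∈ D)
    (hlow : ∀ y, IsForced L R n y → forcedRank y < forcedRank z → (y, true) ∈ D)
    (hzD : (z, false) ∈ D) : Ref (phiWall L R n) D 32 := by
  obtain ⟨q, a, b, v, hq, rfl, hv⟩ := hz
  set N := max (a.width n) (b.width n) with hN
  obtain ⟨c, b', hfar, hop, hforced⟩ : ∃ c b', Far N c b' v ∧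
      (∀ i j, j ≤ i → ¬ NearRow c (constRow b' i) j →
        a.bit n (false :: q) (i - j) = .const false ∨ b.bit n (true :: q) j = .const false) ∧
      ∀ v', Far N c b' v' → IsForced L R n (.node q v') := by
    rcases hv with ⟨ha, hv⟩ | ⟨ha, hb, hv⟩
    · refine ⟨_, _, hv, fun i j hj h => Or.inl (bit_of_le ?_), fun v' hv' =>
        ⟨q, a, b, v', hq, rfl, Or.inl ⟨ha, hv'⟩⟩⟩
      simp only [NearRow, constRow, if_true] at h
      omega
    · refine ⟨_, _, hv, fun i j hj h => Or.inr (bit_of_le ?_), fun v' hv' =>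
        ⟨q, a, b, v', hq, rfl, Or.inr ⟨ha, hb, hv'⟩⟩⟩
      simp only [NearRow, constRow, Bool.false_eq_true, if_false] at h
      omega
  have hbits : ∀ l i j, forcedRank (.node q v) = l + 2 → l < wallaceDepth N → i < 2 * N →
      ¬ NearTree (2 * c + 5) l (constRow b' i) j → ∀ α, Falsifies α D → ∀ s < 3,
      α (wallaceBit q N l i (3 * j + s)) = false := by
    intro l i j hr hl hi hnear α hα s hs
    refine wallaceBit_cases (P := fun v => α v = false) (by simpa using hα _ h0) fun v' hv' => ?_
    have := hlow _ (hforced v' (far_input hl hi hnear hs hv'))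
      ((forcedRank_lt q hv').trans_le hr.ge)
    simpa using hα _ this
  have hsub := wallaceMultiplier_subset (n := n) hq
  cases v with
  | partialProduct i j =>
    obtain ⟨h1, h2, h3, h4, h5⟩ := hfar
    refine Ref.of_gate (hsub (StripGate.mem (A := 0) (w := i) (.pp i j (Nat.zero_le _) le_rfl h1 h2
      h3 h4))) (by simp) fun α hα h => ?_
    have hα1 := hα _ hzD
    have hα0 : α (.const false) = false := by simpa using hα _ h0
    simp only [Gate.Holds, List.map_cons, List.map_nil, conj_two] at h
    rw [h] at hα1
    rcases hop i j h3 h5 with h | h <;> simp [h, hα0] at hα1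
  | treeSum l i j =>
    obtain ⟨h1, h2, h3, h4⟩ := hfar
    refine Ref.of_gate (hsub (StripGate.mem (A := 0) (w := i) (.sum l i j h1 (by have := h1.le; rw [hN] at this; omega) le_rfl h2
      h3))) (by simp) fun α hα h => ?_
    have hb := hbits l i j rfl h1 h2 h4 α hα
    have hb0 := hb 0 (by norm_num)
    rw [add_zero] at hb0
    have hα1 := hα _ hzD
    simp only [Gate.Holds, List.map_cons, List.map_nil] at h
    rw [h, hb0, hb 1 (by norm_num), hb 2 (by norm_num)] at hα1
    exact hα1 rfl
  | treeCarry l i j =>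
    obtain ⟨h1, h2, h3, h4⟩ := hfar
    refine Ref.of_gate (hsub (StripGate.mem (A := 0) (w := i) (.carry l i j h1 (by have := h1.le; rw [hN] at this; omega) le_rfl h2
      h3))) (by simp) fun α hα h => ?_
    have hb := hbits l i j rfl h1 h2 h4 α hα
    have hb0 := hb 0 (by norm_num)
    rw [add_zero] at hb0
    have hα1 := hα _ hzD
    simp only [Gate.Holds, List.map_cons, List.map_nil] at h
    rw [h, hb0, hb 1 (by norm_num), hb 2 (by norm_num)] at hα1
    exact hα1 rfl
  | _ => exact hfar.elim

theorem Ref.of_identity (hLR : Identity L R) (hL : L.degree ≤ 2) (hR : R.degree ≤ 2) :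
    Ref (phiWall L R n) ∅ (1 + outWidth L R n * (disagreeCost L R n + 1) +
      (forcedVars L R n).card * 33 + 4) := by
  refine (Ref.split (.const false) (Ref.split (.const true) (s₁ := 1)
    (Ref.of_mem (C := {(.const true, true)}) (Or.inr (by simp)) (by simp))
    (Ref.of_forced (c := 32) (s := 1 + outWidth L R n * (disagreeCost L R n + 1))
      (forcedVars L R n) forcedRank ?_ ?_))
    (Ref.of_mem (C := {(.const false, false)}) (Or.inr (by simp)) (by simp))).mono (by omega)
  · intro z hz D hD hlow hzD
    exact Ref.of_forced_true (mem_forcedVars.1 hz) (hD (by simp))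
      (fun y hy => hlow y (mem_forcedVars.2 hy)) hzD
  · intro D hD hK
    exact Ref.of_base hLR hL hR ⟨hD (by simp), hD (by simp), fun z hz => hK z (mem_forcedVars.2 hz)⟩

end

/-! ### The size of the refutation -/

/-- Every quantity that occurs is at most a small power of `T = 2 ^ Y` with `Y` of order `P ^ 2`, so
the cost is polynomial in `T`. The exponent 15 is generous and absorbs all numerical factors. -/
theorem totalCost_le {M P l κ Q : ℕ} (hM : M ≤ 2 ^ P) (hκ : κ + 2 ≤ P) (hl : 1 ≤ l) {K : ℕ}
    (hK : K ≤ l * (M * M + P * (M * M) * 2)) {X : ℕ}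
    (hX : X = M * 2 ^ (l * (1000 * (P * Q) ^ 2) + 1)) :
    1 + M * (2 ^ (l * (κ + 2)) * (X + 6 * M * (X + 1) + 1) + 1) + K * 33 + 4 ≤
      2 ^ (15 * ((l * 1000 * Q ^ 2 + l) * P ^ 2)) := by
  set Y := (l * 1000 * Q ^ 2 + l) * P ^ 2 with hY
  have hP1 : 1 ≤ P ^ 2 := Nat.one_le_pow _ _ (by omega)
  have hPY : P ≤ P ^ 2 := Nat.le_self_pow two_ne_zero _
  have hlY : l * P ^ 2 ≤ Y := Nat.mul_le_mul_right _ (Nat.le_add_left _ _)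
  have h1 : P ≤ Y := hPY.trans ((Nat.le_mul_of_pos_left _ hl).trans hlY)
  have h2 : l ≤ Y := (Nat.le_mul_of_pos_right _ hP1).trans hlY
  have h3 : l * (κ + 2) ≤ Y := (Nat.mul_le_mul_left _ (hκ.trans hPY)).trans hlY
  have h4 : l * (1000 * (P * Q) ^ 2) + 1 ≤ Y := by
    have : Y = l * (1000 * (P * Q) ^ 2) + l * P ^ 2 := by rw [hY]; ring
    have : 1 ≤ l * P ^ 2 := Nat.mul_pos hl hP1
    omega
  have hM' : M ≤ 2 ^ Y := hM.trans (Nat.pow_le_pow_right (by norm_num) h1)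
  have hP' : P ≤ 2 ^ Y := h1.trans Nat.lt_two_pow_self.le
  have hl' : l ≤ 2 ^ Y := h2.trans Nat.lt_two_pow_self.le
  have h3' : 2 ^ (l * (κ + 2)) ≤ 2 ^ Y := Nat.pow_le_pow_right (by norm_num) h3
  have h4' : 2 ^ (l * (1000 * (P * Q) ^ 2) + 1) ≤ 2 ^ Y := Nat.pow_le_pow_right (by norm_num) h4
  have hT : 2 ≤ 2 ^ Y := by
    have : 1 ≤ Y := by omega
    calc 2 = 2 ^ 1 := rfl
      _ ≤ _ := Nat.pow_le_pow_right (by norm_num) this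
  rw [show 2 ^ (15 * Y) = (2 ^ Y) ^ 15 by rw [← pow_mul, mul_comm]]
  generalize 2 ^ Y = T at *
  have hX' : X ≤ T ^ 2 := by
    rw [hX, sq T]; exact Nat.mul_le_mul hM' h4'
  have p1 : 1 ≤ T := by omega
  have pow_mono : ∀ {i j}, i ≤ j → T ^ i ≤ T ^ j := fun h => Nat.pow_le_pow_right p1 h
  have t2 : ∀ j k, 2 ^ j * T ^ k ≤ T ^ (j + k) := fun j k => by
    rw [pow_add]; exact Nat.mul_le_mul_right _ (Nat.pow_le_pow_left hT _)
  have a1 : X + 1 ≤ T ^ 3 := by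
    have : 2 * T ^ 2 ≤ T ^ 3 := t2 1 2
    have := Nat.one_le_pow 2 T p1
    omega
  have a2 : X + 6 * M * (X + 1) + 1 ≤ T ^ 7 := by
    have e1 : 6 * M * (X + 1) ≤ 6 * T * T ^ 3 := Nat.mul_le_mul (Nat.mul_le_mul_left _ hM') a1
    have e2 : 6 * T * T ^ 3 = 6 * T ^ 4 := by ring
    have e3 : 8 * T ^ 4 ≤ T ^ 7 := t2 3 4
    have e4 : T ^ 3 ≤ T ^ 4 := pow_mono (by norm_num)
    omega
  have a3 : M * (2 ^ (l * (κ + 2)) * (X + 6 * M * (X + 1) + 1) + 1) ≤ T ^ 10 := by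
    have e1 : 2 ^ (l * (κ + 2)) * (X + 6 * M * (X + 1) + 1) ≤ T * T ^ 7 := Nat.mul_le_mul h3' a2
    have e2 : T * T ^ 7 = T ^ 8 := by ring
    have e3 : 2 * T ^ 8 ≤ T ^ 9 := t2 1 8
    have e4 : 1 ≤ T ^ 8 := Nat.one_le_pow _ _ p1
    calc _ ≤ T * T ^ 9 := Nat.mul_le_mul hM' (by omega)
      _ = _ := by ring
  have a4 : K * 33 ≤ T ^ 12 := by
    have e1 : M * M ≤ T * T := Nat.mul_le_mul hM' hM'
    have e2 : M * M + P * (M * M) * 2 ≤ T * T + T * (T * T) * 2 :=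
      add_le_add e1 (Nat.mul_le_mul_right _ (Nat.mul_le_mul hP' e1))
    have e3 : K ≤ T * (T * T + T * (T * T) * 2) := hK.trans (Nat.mul_le_mul hl' e2)
    have e4 : T * (T * T + T * (T * T) * 2) = T ^ 3 + 2 * T ^ 4 := by ring
    have e5 : T ^ 3 ≤ T ^ 4 := pow_mono (by norm_num)
    have e6 : 128 * T ^ 4 ≤ T ^ 11 := t2 7 4
    have e7 : T ^ 11 ≤ T ^ 12 := pow_mono (by norm_num)
    omega
  have a5 : T ^ 10 ≤ T ^ 12 := pow_mono (by norm_num)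
  have a6 : 8 * T ^ 12 ≤ T ^ 15 := t2 3 12
  have a7 : 1 ≤ T ^ 12 := Nat.one_le_pow _ _ p1
  omega

/-- One factor of the squared logarithm is absorbed by `2 ^ Nat.log 2 n ≤ n`, and `(k + 1) ^ 2 ≤ 1 +
3 * k ^ 2`. The factor `2 ^ c` in front covers `n = 1`, where the exponent of `n` vanishes. -/
theorem two_pow_log_sq_le (c n : ℕ) (hn : 1 ≤ n) :
    2 ^ (c * (Nat.log 2 n + 1) ^ 2) ≤ (2 ^ c + 3 * c) * n ^ ((2 ^ c + 3 * c) * Nat.log 2 n) := by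
  have h1 : c * (Nat.log 2 n + 1) ^ 2 ≤ c + Nat.log 2 n * (3 * c * Nat.log 2 n) := by
    have : Nat.log 2 n ≤ Nat.log 2 n ^ 2 := Nat.le_self_pow two_ne_zero _
    nlinarith
  calc 2 ^ (c * (Nat.log 2 n + 1) ^ 2)
      ≤ 2 ^ (c + Nat.log 2 n * (3 * c * Nat.log 2 n)) := Nat.pow_le_pow_right (by norm_num) h1
    _ = 2 ^ c * (2 ^ Nat.log 2 n) ^ (3 * c * Nat.log 2 n) := by rw [pow_add, pow_mul]
    _ ≤ (2 ^ c + 3 * c) * n ^ ((2 ^ c + 3 * c) * Nat.log 2 n) := by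
      refine Nat.mul_le_mul (Nat.le_add_right _ _) ?_
      refine (Nat.pow_le_pow_left (Nat.pow_log_le_self 2 (by omega)) _).trans
        (Nat.pow_le_pow_right hn (Nat.mul_le_mul_right _ (Nat.le_add_left _ _)))

theorem exists_logSize_le (L R : RingExpr) :
    ∃ c, ∀ n, 1 ≤ n → logSize L R n ≤ c * (Nat.log 2 n + 1) := by
  obtain ⟨c, hc⟩ := exists_width_le L
  obtain ⟨d, hd⟩ := exists_width_le R
  refine ⟨stripBits L R + 2 * (c + d) + constWidth L R + 22, fun n hn => ?_⟩
  have h1 : Nat.log 2 (outWidth L R n) ≤ c + d + Nat.log 2 n := by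
    refine Nat.lt_succ_iff.1 (Nat.log_lt_of_lt_pow (by
      have := (width_pos hn L).trans (le_max_left _ (R.width n))
      rw [outWidth]; omega) ?_)
    have h2 : outWidth L R n ≤ (c + d) * n := by
      rw [add_mul]
      exact max_le ((hc n hn).trans (Nat.le_add_right _ _)) ((hd n hn).trans (Nat.le_add_left _ _))
    refine h2.trans_lt ?_
    rw [Nat.succ_eq_add_one, add_assoc, pow_add]
    exact Nat.mul_lt_mul'' Nat.lt_two_pow_self (Nat.lt_pow_succ_log_self (by norm_num) n)
  rw [logSize]
  nlinarith [Nat.zero_le (Nat.log 2 n), Nat.zero_le (stripBits L R * Nat.log 2 n),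
    Nat.zero_le ((c + d) * Nat.log 2 n), Nat.zero_le (constWidth L R * Nat.log 2 n)]

theorem exists_totalCost_le (L R : RingExpr) : ∃ C, ∀ n, 1 ≤ n →
    1 + outWidth L R n * (disagreeCost L R n + 1) + (forcedVars L R n).card * 33 + 4 ≤
      C * n ^ (C * Nat.log 2 n) := by
  obtain ⟨c, hc⟩ := exists_logSize_le L R
  set l := (allNodes L R).length with hl
  set Q := constWidth L R with hQ
  set C := 15 * ((l * 1000 * Q ^ 2 + l) * c ^ 2) with hC
  refine ⟨2 ^ C + 3 * C, fun n hn => ?_⟩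
  have hl1 : 1 ≤ l := by
    have : (([false] : List Bool), L) ∈ allNodes L R := List.mem_append_left _ (self_mem_nodes _ _)
    exact List.length_pos_of_mem this
  have hM : outWidth L R n ≤ 2 ^ logSize L R n :=
    (Nat.lt_pow_succ_log_self (by norm_num) _).le.trans
      (Nat.pow_le_pow_right (by norm_num) (by rw [logSize]; omega))
  refine (totalCost_le (Q := Q) hM (κ := stripBits L R) (by rw [logSize]; omega) hl1
    (card_forcedVars_le L R n) rfl).trans (le_trans ?_ (two_pow_log_sq_le C n hn))
  refine Nat.pow_le_pow_right (by norm_num) ?_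
  have := Nat.pow_le_pow_left (hc n hn) 2
  calc 15 * ((l * 1000 * Q ^ 2 + l) * logSize L R n ^ 2)
      ≤ 15 * ((l * 1000 * Q ^ 2 + l) * (c * (Nat.log 2 n + 1)) ^ 2) := by gcongr
    _ = C * (Nat.log 2 n + 1) ^ 2 := by rw [hC]; ring

end WallaceCNF

theorem mainTheorem2 (L R : WallaceCNF.RingExpr)
    (hLR : WallaceCNF.RingExpr.Identity L R) (hL : L.degree ≤ 2) (hR : R.degree ≤ 2) :
    ∃ C : ℕ, ∀ n : ℕ, 1 ≤ n →
      ∃ π : WallaceCNF.Refutation (WallaceCNF.phiWall L R n),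
        π.Regular ∧ π.size ≤ C * n ^ (C * Nat.log 2 n) := by
  obtain ⟨C, hC⟩ := WallaceCNF.exists_totalCost_le L R
  refine ⟨C, fun n hn => ?_⟩
  obtain ⟨π, hreg, hsize⟩ := (WallaceCNF.Ref.of_identity hLR hL hR).exists_refutation
  exact ⟨π, hreg, hsize.trans (hC n hn)⟩
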